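/- Call a convex $4$-polytope $P\subset\mathbb{R}^4$ \emph{cubical} if every $k$-dimensional face of $P$, $0\le k\le 3$, is combinatorially equivalent to the cube $[0,1]^k$. The \emph{derivative complex} of its boundary complex is the abstract cubical cell complex whose cells are the pairs $(F,[e])$, where $F$ is a proper face of $P$ and $[e]$ is a parallel class of edges of $F$, that is, a class of the equivalence relation on the edges of $F$ generated by being opposite in a $2$-face of $F$; the cell $(F,[e])$ has dimension $\dim F-1$, and it is a face of $(F',[e'])$ if $F\subseteq F'$ and $[e]\subseteq[e']$. Its connected components are the \emph{dual manifolds} of $P$. Each of them has a canonical map to the boundary $\partial P$, which is affine on the simplices of the barycentric subdivision and maps the barycenter of $(F,[e])$ to the barycenter of the vertices of $F$. Theorem. There is a cubical $4$-polytope $P_{72}\subset\mathbb{R}^4$ with $f$-vector $$f(P_{72})=(72,196,186,62),$$ one of whose dual manifolds has $f$-vector $(80,160,80)$, is homeomorphic to the Klein bottle, and is immersed in $\partial P_{72}$ by the canonical map (i.e. this map is locally an embedding). Moreover, $P_{72}$ is not edge-orientable: it is impossible to orient all edges of $P_{72}$ in such a way that in each $2$-face opposite edges are oriented in parallel (rather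 than antiparallel) direction. In particular, cubical $4$-polytopes that are not edge-orientable exist, as conjectured by Hetyei. -/

import Mathlib

noncomputable section

namespace CubicalPolytope

variable {E : Type*} [NormedAddCommGroup E] [NormedSpace ℝ E]
variable {E' : Type*} [NormedAddCommGroup E'] [NormedSpace ℝ E']

/-! ### Polytopes, faces, cubical polytopes -/

/-- Dimension of (the affine hull of) a set. -/
def dim (A : Set E) : ℕ := Module.finrank ℝ (vectorSpan ℝ A)

/-- `P` is a convex `d`-polytope: the convex hull of a nonempty finite set, of dimension `d`. -/
def IsPolytope (d : ℕ) (P : Set E) : Prop :=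
  (∃ s : Set E, s.Finite ∧ s.Nonempty ∧ P = convexHull ℝ s) ∧ dim P = d

/-- `F` is a `k`-dimensional face of the polytope `P`. -/
def IsFace (P : Set E) (k : ℕ) (F : Set E) : Prop :=
  IsExposed ℝ P F ∧ F.Nonempty ∧ dim F = k

/-- The number of `k`-dimensional faces of `P`. -/
def fNumber (P : Set E) (k : ℕ) : ℕ := {F : Set E | IsFace P k F}.ncard

/-- Combinatorial equivalence of polytopes: isomorphism of the face lattices, ordered by inclusion
(the empty face and the whole polytope are included). -/
def CombEquiv (A : Set E) (B : Set E') : Prop :=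
  Nonempty ({F : Set E // IsExposed ℝ A F} ≃o {G : Set E' // IsExposed ℝ B G})

/-- The standard `k`-cube `[0,1]^k`. -/
def stdCube (k : ℕ) : Set (Fin k → ℝ) := Set.Icc 0 1

/-- `P` is a cubical `d`-polytope: all its proper faces are combinatorial cubes. -/
def IsCubicalPolytope (d : ℕ) (P : Set E) : Prop :=
  IsPolytope d P ∧ ∀ k < d, ∀ F : Set E, IsFace P k F → CombEquiv F (stdCube k)

/-! ### Parallel edges and edge orientations -/

/-- `e` and `e'` are opposite (that is, disjoint) edges of a quadrilateral `2`-face of `P` which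
is contained in `F`. -/
def OppositeEdges (P F e e' : Set E) : Prop :=
  ∃ G : Set E, IsFace P 2 G ∧ G ⊆ F ∧ IsFace P 1 e ∧ IsFace P 1 e' ∧ e ⊆ G ∧ e' ⊆ G ∧
    Disjoint e e'

/-- Parallelism of edges of the face `F`: the equivalence relation generated by being opposite in
a `2`-face of `F`. -/
def ParallelEdges (P F e e' : Set E) : Prop := Relation.EqvGen (OppositeEdges P F) e e'

/-- The `2`-skeleton of `P` has a consistent edge orientation: every edge `e` can be directed,
from `tail e` to `head e`, such that opposite edges of each `2`-face get parallel (rather than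
antiparallel) directions. Opposite edges are parallel precisely if the other two edges of the
`2`-face join tail to tail and head to head; for antiparallel ones these segments are diagonals. -/
def EdgeOrientable (P : Set E) : Prop :=
  ∃ tail head : Set E → E,
    (∀ e, IsFace P 1 e → e = segment ℝ (tail e) (head e)) ∧
    ∀ e e', OppositeEdges P P e e' →
      IsFace P 1 (segment ℝ (tail e) (tail e')) ∧ IsFace P 1 (segment ℝ (head e) (head e'))

/-! ### The derivative complex of the boundary complex and the dual manifolds -/

/-- A cell `(F, [e])` of the derivative complex of the boundary complex of `P`: a nonempty proper
face `F` together with a parallel class `[e]` of edges of `F`. The cell has dimension `dim F - 1`;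
it separates the two opposite facets of the cube `F` that are joined by the edges in `[e]`. -/
@[ext]
structure DerivCell (P : Set E) where
  /-- the face containing the cell -/
  face : Set E
  /-- the parallel class of edges of the face -/
  cls : Set (Set E)
  isExposed : IsExposed ℝ P face
  nonempty : face.Nonempty
  proper : face ≠ P
  isClass : ∃ e, IsFace P 1 e ∧ e ⊆ face ∧ cls = {e' | ParallelEdges P face e e'}

/-- Cells are ordered by inclusion: `(F, [e])` is a face of `(F', [e'])` iff `F ⊆ F'` and
`[e] ⊆ [e']`. -/
instance (P : Set E) : PartialOrder (DerivCell P) where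
  le c c' := c.face ⊆ c'.face ∧ c.cls ⊆ c'.cls
  le_refl _ := ⟨subset_rfl, subset_rfl⟩
  le_trans _ _ _ h h' := ⟨h.1.trans h'.1, h.2.trans h'.2⟩
  le_antisymm _ _ h h' := DerivCell.ext (h.1.antisymm h'.1) (h.2.antisymm h'.2)

/-- `M` is (the set of cells of) a dual manifold of `P`: a connected component of the derivative
complex. -/
def IsDualManifold (P : Set E) (M : Set (DerivCell P)) : Prop :=
  ∃ c : DerivCell P, M = {c' | Relation.EqvGen (· ≤ ·) c c'}

/-- The number of `k`-dimensional cells of a set of cells of the derivative complex. -/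
def cellNumber {P : Set E} (M : Set (DerivCell P)) (k : ℕ) : ℕ :=
  {c ∈ M | dim c.face = k + 1}.ncard

/-- Geometric realization of the order complex of a (finite) poset `X`, in barycentric coordinates.
If `X` is the poset of nonempty cells of a cell complex, this is the barycentric subdivision of the
complex. -/
abbrev OrderRealization (X : Type*) [PartialOrder X] : Type _ :=
  {w : X → ℝ // (∀ x, 0 ≤ w x) ∧ IsChain (· ≤ ·) (Function.support w) ∧ ∑ᶠ x, w x = 1}

/-- The barycenter of the vertices of a face. -/
def barycenter (F : Set E) : E :=
  ((F.extremePoints ℝ).ncard : ℝ)⁻¹ • ∑ᶠ v ∈ F.extremePoints ℝ, v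

/-- The canonical map of a dual manifold: the simplicial map of barycentric subdivisions that sends
the barycenter of the cell `(F, [e])` to the barycenter of the face `F`. -/
def canonicalMap {P : Set E} (M : Set (DerivCell P)) (w : OrderRealization M) : E :=
  ∑ᶠ c : M, w.1 c • barycenter c.1.face

/-- `f` is a (topological) immersion: locally an embedding. -/
def IsTopImmersion {X Y : Type*} [TopologicalSpace X] [TopologicalSpace Y] (f : X → Y) : Prop :=
  ∀ x, ∃ U ∈ nhds x, Topology.IsEmbedding (U.domRestrict f)

/-! ### The Klein bottle -/

/-- The side identifications `(0, t) ∼ (1, t)` and `(t, 0) ∼ (1 - t, 1)` of the unit square. -/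
inductive KleinRel : unitInterval × unitInterval → unitInterval × unitInterval → Prop
  | straight (t : unitInterval) : KleinRel (0, t) (1, t)
  | reversed (t : unitInterval) : KleinRel (t, 0) (unitInterval.symm t, 1)

/-- The Klein bottle, with the quotient topology. -/
abbrev KleinBottle : Type := Quot KleinRel

end CubicalPolytope

end

/-!
# A cubical `4`-polytope that is not edge-orientable

The polytope is obtained by lifting. A ball in `ℝ³` is subdivided into `14` cubes with `36`
vertices, and a positive concave function `h` on it is affine on each cube. The polytope consists
of the points `(x, t)` with `|t| ≤ h x`. Its facets are the `14` cubes in the graph of `h`, their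
`14` mirror images in the graph of `-h`, and the prisms over the `34` boundary squares of the ball;
its `72` vertices are the vertices `(v, ±h v)`.

*The polytope is the convex hull of these points.* All facet functionals are nonnegative at all
vertices. Conversely, let all facet inequalities hold at `(x, t)`, and let `C` be a cube whose
affine function is minimal at `x`. The facet functions of `C` are differences of the affine
functions of two cubes, or belong to the boundary of the ball, so that they are nonnegative at `x`.
As `C` is a union of six tetrahedra around a diagonal, `x` is a convex combination of the vertices
of `C`, and `(x, t)` is a convex combination of the vertices of the polytope above and below these
(`mem_convexHull_vertexPoint`).

*Faces.* For a polytope that is given by vertices and by facets at once (`HVRep`), all exposed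
faces are hulls of intersections of vertex sets of facets (`HVRep.exists_eq_hull`), and a bijection
of vertices that respects these intersections is a combinatorial equivalence
(`combEquiv_of_vertices`). Hence the face lattice can be read off from the incidences of vertices
and facets: `exists_faceMask` says that the listed cubes are all the proper faces. Dimensions need
no linear algebra: they increase strictly along chains of faces, and every listed face lies in such
a chain of length `4`, so that they are as large as the position in the chain (`dim_faceOf`).

*The Klein bottle.* A single class of parallel edges of the boundary has `80` elements, and the
cells `(F, [e])` with `e` in this class form the component `surface` (`isDualManifold_surface`).
Its order complex has `640` triangles. Stellar subdivisions of edges and their inverses, which do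
not change the realization (`IsStellar.homeomorph`), transform it into the triangulation of the
Klein bottle that comes from a square grid with `3 × 3` fields (`runMoves_surface`,
`kleinBottle_homeomorph`).

*The immersion.* The facet functionals are nonnegative at the barycenter of a face, and vanish
there exactly for the facets that contain the face. A point of `surface` is a convex combination of
barycenters of a chain of faces, and it can be recovered from the values of the facet functionals
at its image: the functionals that vanish there belong to the largest face of the chain, its part
can be split off, and so on (`eq_of_sum_eq`). This determines the point up to the choice of a cell
for each face of the chain. In the open star of a cell there is no choice, since two cells that are
comparable to a given one and have the same face agree (`eq_of_cellMask_eq`). So the canonical map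
is injective on open stars (`canonicalMap_injOn_star`), and it is a local embedding by compactness.
The image lies in the boundary as some facet functional vanishes.

*Orientations.* Following the class of parallel edges through nine `2`-faces leads from a directed
edge back to the same edge with the opposite direction (`moebiusPath`), so that no orientation of
the edges is parallel on all `2`-faces (`not_edgeOrientable_polytope`).

The finite verifications are Boolean functions on lists of numbers that the kernel evaluates. Sets
of vertices, of edges, or of cells are encoded as natural numbers through their binary digits
(`maskSet`); the list functions are written with recursors, which the kernel reduces fast.
-/

noncomputable section

namespace CubicalPolytope

/-! ### Polytopes with a vertex description and a facet description -/

/-- The points `V i` and the affine functionals `x ↦ l j x + c j` describe one and the same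
polytope: the convex hull of the points is the set on which all functionals are nonnegative. -/
structure HVRep {E ι κ : Type*} [NormedAddCommGroup E] [NormedSpace ℝ E]
    (V : ι → E) (l : κ → E →L[ℝ] ℝ) (c : κ → ℝ) : Prop where
  nonneg : ∀ j i, 0 ≤ l j (V i) + c j
  complete : ∀ x, (∀ j, 0 ≤ l j x + c j) → x ∈ convexHull ℝ (Set.range V)

/-- The convex hull of the points with index in `S`. -/
def hull {E ι : Type*} [NormedAddCommGroup E] [NormedSpace ℝ E] (V : ι → E) (S : Set ι) : Set E :=
  convexHull ℝ (V '' S)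

/-- The facet functionals that vanish on all the points with index in `S`. -/
def active {E ι κ : Type*} [NormedAddCommGroup E] [NormedSpace ℝ E]
    (V : ι → E) (l : κ → E →L[ℝ] ℝ) (c : κ → ℝ) (S : Set ι) : Set κ :=
  {j | ∀ i ∈ S, l j (V i) + c j = 0}

/-- `S` is an intersection of vertex sets of facets. -/
def IsClosedIdx {E ι κ : Type*} [NormedAddCommGroup E] [NormedSpace ℝ E]
    (V : ι → E) (l : κ → E →L[ℝ] ℝ) (c : κ → ℝ) (S : Set ι) : Prop :=
  ∀ i, (∀ j ∈ active V l c S, l j (V i) + c j = 0) → i ∈ S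

section HV

variable {E ι κ : Type*} [NormedAddCommGroup E] [NormedSpace ℝ E]
  {V : ι → E} {l : κ → E →L[ℝ] ℝ} {c : κ → ℝ} {S T : Set ι}

lemma hull_mono (h : S ⊆ T) : hull V S ⊆ hull V T :=
  convexHull_mono (Set.image_mono h)

lemma vertex_mem_hull {i : ι} (h : i ∈ S) : V i ∈ hull V S :=
  subset_convexHull ℝ _ (Set.mem_image_of_mem V h)

lemma hull_nonempty (h : S.Nonempty) : (hull V S).Nonempty :=
  let ⟨_, hi⟩ := h; ⟨_, vertex_mem_hull hi⟩

lemma active_anti (h : S ⊆ T) : active V l c T ⊆ active V l c S :=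
  fun _ hj i hi => hj i (h hi)

lemma hull_nonneg {a : E →L[ℝ] ℝ} {b : ℝ} (h : ∀ i ∈ S, 0 ≤ a (V i) + b) {x : E}
    (hx : x ∈ hull V S) : 0 ≤ a x + b := by
  have hc : Convex ℝ {x : E | 0 ≤ a x + b} := by
    have := (convex_Ici (-b) (𝕜 := ℝ)).is_linear_preimage a.toLinearMap.isLinear
    convert this using 1
    ext x
    simp only [Set.mem_ofPred_eq, Set.mem_preimage, Set.mem_Ici]
    constructor <;> intro h <;> · simp at h ⊢; linarith
  refine convexHull_min ?_ hc hx
  rintro _ ⟨i, hi, rfl⟩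
  exact h i hi

lemma hull_eq_zero {a : E →L[ℝ] ℝ} {b : ℝ} (h : ∀ i ∈ S, a (V i) + b = 0) {x : E}
    (hx : x ∈ hull V S) : a x + b = 0 := by
  have h1 := hull_nonneg (V := V) (S := S) (a := a) (b := b) (fun i hi => (h i hi).ge) hx
  have h2 := hull_nonneg (V := V) (S := S) (a := -a) (b := -b)
    (fun i hi => by have := h i hi; simp; linarith) hx
  simp at h2
  linarith

/-- A point of the hull at which a functional vanishes is a combination of vertices at which the
functional vanishes, provided it is nonnegative on all vertices. -/
lemma mem_hull_of_eq_zero [Finite ι] {J : Set κ} (h : ∀ j ∈ J, ∀ i ∈ S, 0 ≤ l j (V i) + c j)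
    {x : E} (hx : x ∈ hull V S) (h0 : ∀ j ∈ J, l j x + c j = 0) :
    x ∈ hull V {i ∈ S | ∀ j ∈ J, l j (V i) + c j = 0} := by
  classical
  obtain ⟨α, _, w, z, hw, hw1, hz, rfl⟩ := mem_convexHull_iff_exists_fintype.1 hx
  have hne : ∃ k, w k ≠ 0 := by
    by_contra! hcon
    simp [hcon] at hw1
  have key : ∀ j ∈ J, ∀ k, w k ≠ 0 → l j (z k) + c j = 0 := by
    intro j hj k hk
    have hs : ∑ k, w k * (l j (z k) + c j) = 0 := by
      have := h0 j hj
      simp only [map_sum, map_smul, smul_eq_mul] at this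
      simp only [mul_add, Finset.sum_add_distrib, ← Finset.sum_mul, hw1, one_mul]
      exact this
    have hn : ∀ k ∈ Finset.univ, 0 ≤ w k * (l j (z k) + c j) := by
      intro k _
      obtain ⟨i, hi, hik⟩ := hz k
      exact mul_nonneg (hw k) (by rw [← hik]; exact h j hj i hi)
    have := (Finset.sum_eq_zero_iff_of_nonneg hn).1 hs k (Finset.mem_univ _)
    exact (mul_eq_zero.1 this).resolve_left hk
  have hconv := convex_convexHull ℝ (V '' {i ∈ S | ∀ j ∈ J, l j (V i) + c j = 0})
  have hsum : ∑ k, w k • z k = ∑ k ∈ Finset.univ.filter (fun k => w k ≠ 0), w k • z k := by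
    rw [Finset.sum_filter_of_ne]
    intro k _ hk h
    simp [h] at hk
  rw [hsum]
  refine hconv.sum_mem (fun k _ => hw k) ?_ ?_
  · rw [Finset.sum_filter_ne_zero, hw1]
  · intro k hk
    obtain ⟨i, hi, hik⟩ := hz k
    refine subset_convexHull ℝ _ ⟨i, ⟨hi, fun j hj => ?_⟩, hik⟩
    rw [hik]
    exact key j hj k (by simpa using hk)

lemma isClosedIdx_univ : IsClosedIdx V l c Set.univ := fun _ _ => trivial

/-- Strictly nested faces have strictly increasing dimensions. -/
lemma dim_hull_lt [FiniteDimensional ℝ E] (hS : IsClosedIdx V l c S)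
    (hne : S.Nonempty) (hST : S ⊂ T) : dim (hull V S) < dim (hull V T) := by
  obtain ⟨i, hiT, hiS⟩ := Set.exists_of_ssubset hST
  have hex : ∃ j ∈ active V l c S, l j (V i) + c j ≠ 0 := by
    by_contra! hcon
    exact hiS (hS i hcon)
  obtain ⟨j, hj, hji⟩ := hex
  obtain ⟨i0, hi0⟩ := hne
  refine Submodule.finrank_lt_finrank_of_lt (lt_of_le_of_ne (vectorSpan_mono ℝ
    (hull_mono hST.subset)) fun heq => hji ?_)
  have hker : vectorSpan ℝ (hull V S) ≤ (LinearMap.ker (l j).toLinearMap) := by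
    rw [vectorSpan_def, Submodule.span_le]
    rintro _ ⟨x, hx, y, hy, rfl⟩
    have h1 := hull_eq_zero hj hx
    have h2 := hull_eq_zero hj hy
    simp only [SetLike.mem_coe, LinearMap.mem_ker, ContinuousLinearMap.coe_coe, vsub_eq_sub,
      map_sub]
    linarith
  have hmem : V i - V i0 ∈ vectorSpan ℝ (hull V T) :=
    vsub_mem_vectorSpan ℝ (vertex_mem_hull hiT) (vertex_mem_hull (hST.subset hi0))
  rw [← heq] at hmem
  have h3 := hker hmem
  simp only [LinearMap.mem_ker, ContinuousLinearMap.coe_coe, map_sub] at h3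
  have h4 := hj i0 hi0
  linarith

lemma HVRep.nonneg_of_mem (H : HVRep V l c) {x : E} (hx : x ∈ hull V S) (j : κ) : 0 ≤ l j x + c j :=
  hull_nonneg (fun i _ => H.nonneg j i) hx

variable [Finite ι]

namespace HVRep

variable (H : HVRep V l c)
include H

/-- A face is cut out by the facets that contain it. -/
lemma mem_hull_iff (hS : IsClosedIdx V l c S) {x : E} :
    x ∈ hull V S ↔ (∀ j, 0 ≤ l j x + c j) ∧ ∀ j ∈ active V l c S, l j x + c j = 0 := by
  refine ⟨fun hx => ⟨fun j => H.nonneg_of_mem hx j, fun j hj => hull_eq_zero hj hx⟩, fun hx => ?_⟩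
  have h1 : x ∈ hull V (Set.univ : Set ι) := by
    rw [hull, Set.image_univ]
    exact H.complete x hx.1
  refine hull_mono ?_ (mem_hull_of_eq_zero (fun j _ i _ => H.nonneg j i) h1 hx.2)
  exact fun i hi => hS i hi.2

lemma vertex_mem_iff (hS : IsClosedIdx V l c S) {i : ι} : V i ∈ hull V S ↔ i ∈ S :=
  ⟨fun h => hS i ((H.mem_hull_iff hS).1 h).2, vertex_mem_hull⟩

lemma hull_subset_iff (hT : IsClosedIdx V l c T) : hull V S ⊆ hull V T ↔ S ⊆ T :=
  ⟨fun h _ hi => (H.vertex_mem_iff hT).1 (h (vertex_mem_hull hi)), hull_mono⟩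

lemma hull_inter (hT : IsClosedIdx V l c T) :
    hull V S ∩ hull V T = hull V (S ∩ T) := by
  refine Set.Subset.antisymm ?_ (Set.subset_inter (hull_mono Set.inter_subset_left)
    (hull_mono Set.inter_subset_right))
  rintro x ⟨h1, h2⟩
  have h2' := ((H.mem_hull_iff hT).1 h2).2
  refine hull_mono ?_ (mem_hull_of_eq_zero (fun j _ i _ => H.nonneg j i) h1 h2')
  exact fun i hi => ⟨hi.1, hT i hi.2⟩

/-- The intersection of a family of facets is exposed by the sum of the facet functionals. -/
lemma isExposed_hull [Finite κ] (hS : IsClosedIdx V l c S) (hST : S ⊆ T) :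
    IsExposed ℝ (hull V T) (hull V S) := by
  classical
  intro hne
  obtain ⟨x0, hx0⟩ := hne
  have := Fintype.ofFinite κ
  set J := Finset.univ.filter (fun j => j ∈ active V l c S) with hJ
  have hval : ∀ x, (-∑ j ∈ J, l j) x = (∑ j ∈ J, c j) - ∑ j ∈ J, (l j x + c j) := by
    intro x
    simp [Finset.sum_add_distrib]
  have hle : ∀ x ∈ hull V T, (-∑ j ∈ J, l j) x ≤ ∑ j ∈ J, c j := by
    intro x hx
    rw [hval]
    have : 0 ≤ ∑ j ∈ J, (l j x + c j) := Finset.sum_nonneg fun j _ => H.nonneg_of_mem hx j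
    linarith
  have heq : ∀ x ∈ hull V S, (-∑ j ∈ J, l j) x = ∑ j ∈ J, c j := by
    intro x hx
    rw [hval, sub_eq_self]
    refine Finset.sum_eq_zero fun j hj => ?_
    exact ((H.mem_hull_iff hS).1 hx).2 j (by simpa [hJ] using hj)
  refine ⟨-∑ j ∈ J, l j, Set.Subset.antisymm (fun x hx => ⟨hull_mono hST hx, fun y hy => ?_⟩) ?_⟩
  · rw [heq x hx]; exact hle y hy
  · rintro x ⟨hx, hmax⟩
    refine (H.mem_hull_iff hS).2 ⟨fun j => H.nonneg_of_mem hx j, fun j hj => ?_⟩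
    have h1 := hmax x0 (hull_mono hST hx0)
    rw [heq x0 hx0, hval] at h1
    have h2 : ∑ j ∈ J, (l j x + c j) = 0 :=
      le_antisymm (by linarith) (Finset.sum_nonneg fun j _ => H.nonneg_of_mem hx j)
    exact (Finset.sum_eq_zero_iff_of_nonneg fun j _ => H.nonneg_of_mem hx j).1 h2 j
      (by simpa [hJ] using hj)

/-- Every nonempty exposed face is an intersection of facets. With `x` the mean of the vertices of
the face `G` and `y` in all facets containing `G`, the segment from `y` to `x` can be prolonged
beyond `x` within the polytope, so that a functional exposing `G` is maximal at `y` as well. -/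
lemma exists_eq_hull [Finite κ] (hT : IsClosedIdx V l c T) {G : Set E}
    (hG : IsExposed ℝ (hull V T) G) (hne : G.Nonempty) :
    ∃ S ⊆ T, S.Nonempty ∧ IsClosedIdx V l c S ∧ G = hull V S := by
  classical
  obtain ⟨f, hf⟩ := hG hne
  have := Fintype.ofFinite ι
  have := Fintype.ofFinite κ
  set S : Set ι := {i ∈ T | V i ∈ G}
  -- `G` is the hull of its vertices.
  have hGS : G ⊆ hull V S := by
    intro x hx
    have hx' := hx
    rw [hf] at hx'
    have h0 : ∀ j ∈ (Set.univ : Set Unit), (fun _ : Unit => -f) j x + f x = 0 := by simp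
    have := mem_hull_of_eq_zero (V := V) (S := T) (l := fun _ : Unit => -f) (c := fun _ => f x)
      (J := Set.univ) (fun j _ i hi => by
        have := hx'.2 (V i) (vertex_mem_hull hi)
        simp; linarith) hx'.1 h0
    refine hull_mono ?_ this
    rintro i ⟨hi, hi2⟩
    refine ⟨hi, ?_⟩
    rw [hf]
    refine ⟨vertex_mem_hull hi, fun y hy => ?_⟩
    have h3 := hi2 () trivial
    simp at h3
    have := hx'.2 y hy
    linarith
  have hSne : S.Nonempty := by
    by_contra hcon
    rw [Set.not_nonempty_iff_eq_empty] at hcon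
    obtain ⟨x, hx⟩ := hne
    have := hGS hx
    simp [hcon, hull] at this
  have hconv : Convex ℝ G := hG.convex (convex_convexHull ℝ _)
  have hSG : hull V S ⊆ G := by
    refine convexHull_min ?_ hconv
    rintro _ ⟨i, hi, rfl⟩
    exact hi.2
  -- The mean of the vertices of `G`.
  set F : Finset ι := S.toFinset with hF
  have hFne : F.Nonempty := by rw [hF]; simpa using hSne
  have hFpos : (0 : ℝ) < F.card := by exact_mod_cast hFne.card_pos
  set x : E := ∑ i ∈ F, ((F.card : ℝ)⁻¹) • V i with hxdef
  have hxG : x ∈ G := by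
    refine hconv.sum_mem (fun _ _ => by positivity) ?_ ?_
    · simp [hFpos.ne']
    · intro i hi
      exact hSG (vertex_mem_hull (by simpa [hF] using hi))
  have hax : ∀ j, l j x + c j = ∑ i ∈ F, (F.card : ℝ)⁻¹ * (l j (V i) + c j) := by
    intro j
    simp only [hxdef, map_sum, map_smul, smul_eq_mul, mul_add, Finset.sum_add_distrib]
    simp [hFpos.ne']
  have hpos : ∀ j, j ∉ active V l c S → 0 < l j x + c j := by
    intro j hj
    rw [hax]
    simp only [active, Set.mem_ofPred_eq, not_forall] at hj
    obtain ⟨i, hi, hij⟩ := hj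
    refine Finset.sum_pos' (fun i _ => mul_nonneg (by positivity) (H.nonneg j i)) ⟨i, ?_, ?_⟩
    · simpa [hF] using hi
    · exact mul_pos (by positivity) (lt_of_le_of_ne (H.nonneg j i) (Ne.symm hij))
  have hcl : ∀ y, (∀ j, 0 ≤ l j y + c j) → (∀ j ∈ active V l c S, l j y + c j = 0) → y ∈ G := by
    intro y hy hy0
    have hyT : y ∈ hull V T := (H.mem_hull_iff hT).2
      ⟨hy, fun j hj => hy0 j (active_anti (fun i hi => hi.1) hj)⟩
    -- For a small `ε` the point `x + ε (x - y)` satisfies all facet inequalities.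
    have hex : ∃ ε : ℝ, 0 < ε ∧ ∀ j, 0 ≤ (l j x + c j) + ε * ((l j x + c j) - (l j y + c j)) := by
      have hev : ∀ j, ∀ᶠ ε in nhdsWithin (0 : ℝ) (Set.Ioi 0),
          0 ≤ (l j x + c j) + ε * ((l j x + c j) - (l j y + c j)) := by
        intro j
        by_cases hj : j ∈ active V l c S
        · have h1 : l j x + c j = 0 := hull_eq_zero hj (hGS hxG)
          rw [h1, hy0 j hj]
          simp
        · have ht : Filter.Tendsto
              (fun ε : ℝ => (l j x + c j) + ε * ((l j x + c j) - (l j y + c j)))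
              (nhdsWithin 0 (Set.Ioi 0)) (nhds (l j x + c j)) := by
            have hc : Continuous
              (fun ε : ℝ => (l j x + c j) + ε * ((l j x + c j) - (l j y + c j))) := by fun_prop
            have := hc.tendsto 0
            simp only [zero_mul, add_zero] at this
            exact this.mono_left nhdsWithin_le_nhds
          exact (ht.eventually (lt_mem_nhds (hpos j hj))).mono fun _ h => h.le
      have hall := Filter.eventually_all.2 hev
      obtain ⟨ε, h1, h2⟩ := (hall.and self_mem_nhdsWithin).exists
      exact ⟨ε, h2, h1⟩
    obtain ⟨ε, hε, hall⟩ := hex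
    have hlin : ∀ j, l j (x + ε • (x - y)) + c j =
        (l j x + c j) + ε * ((l j x + c j) - (l j y + c j)) := by
      intro j
      simp only [map_add, map_smul, map_sub, smul_eq_mul]
      ring
    have hz : x + ε • (x - y) ∈ hull V T := by
      refine (H.mem_hull_iff hT).2 ⟨fun j => by rw [hlin]; exact hall j, fun j hj => ?_⟩
      have hj' := active_anti (l := l) (c := c) (V := V) (S := S) (fun i hi => hi.1) hj
      rw [hlin, hy0 j hj', hull_eq_zero hj' (hGS hxG)]
      simp
    rw [hf] at hxG ⊢
    have h1 := hxG.2 _ hz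
    simp only [map_add, map_smul, map_sub, smul_eq_mul] at h1
    have h2 : f x ≤ f y := by nlinarith
    exact ⟨hyT, fun u hu => (hxG.2 u hu).trans h2⟩
  refine ⟨S, fun i hi => hi.1, hSne, fun i hi => ?_, hGS.antisymm hSG⟩
  have hiG := hcl (V i) (fun j => H.nonneg j i) hi
  refine ⟨hT i fun j hj => hi j (active_anti (fun i hi => hi.1) hj), hiG⟩

end HVRep
end HV

/-! ### Combinatorial equivalence with a cube -/

/-- If facets restrict to faces under a map of vertices, then so do all faces. -/
lemma isClosedIdx_preimage {E ι κ E' ι' κ' : Type*} [NormedAddCommGroup E] [NormedSpace ℝ E]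
    [NormedAddCommGroup E'] [NormedSpace ℝ E'] {V : ι → E} {l : κ → E →L[ℝ] ℝ} {c : κ → ℝ}
    {S : Set ι} {V' : ι' → E'} {l' : κ' → E' →L[ℝ] ℝ} {c' : κ' → ℝ} (φ : ι' → ι)
    (h1 : ∀ j, {i' | l j (V (φ i')) + c j = 0} = ∅ ∨
      IsClosedIdx V' l' c' {i' | l j (V (φ i')) + c j = 0}) (hS : IsClosedIdx V l c S) :
    φ ⁻¹' S = ∅ ∨ IsClosedIdx V' l' c' (φ ⁻¹' S) := by
  rcases (φ ⁻¹' S).eq_empty_or_nonempty with h0 | ⟨i0, hi0⟩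
  · exact Or.inl h0
  right
  intro i' hi'
  refine hS _ fun j hj => ?_
  have hsub : φ ⁻¹' S ⊆ {i' | l j (V (φ i')) + c j = 0} := fun k hk => hj _ hk
  rcases h1 j with h3 | h3
  · exact absurd (hsub hi0) (by simp [h3])
  · exact h3 i' fun j' hj' => hi' j' (active_anti hsub hj')

section CombEquiv

variable {E ι κ : Type*} [NormedAddCommGroup E] [NormedSpace ℝ E]
  {V : ι → E} {l : κ → E →L[ℝ] ℝ} {c : κ → ℝ} {S T : Set ι} [Finite ι] [Finite κ]

/-- The exposed faces of a face `hull V T` correspond to the closed index sets in `T`; the empty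
face, which need not be closed, is added by hand. -/
def HVRep.exposedIso (H : HVRep V l c) (hT : IsClosedIdx V l c T) :
    {G : Set E // IsExposed ℝ (hull V T) G} ≃o
      {S : Set ι // S ⊆ T ∧ (S = ∅ ∨ IsClosedIdx V l c S)} where
  toFun G := ⟨{i ∈ T | V i ∈ G.1}, fun _ h => h.1, by
    rcases G.1.eq_empty_or_nonempty with h | h
    · left; simp [h]
    · obtain ⟨S, hS, -, hc, hG⟩ := H.exists_eq_hull hT G.2 h
      right
      convert hc using 1
      ext i
      simp only [hG, Set.mem_ofPred_eq, H.vertex_mem_iff hc]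
      exact ⟨fun h => h.2, fun h => ⟨hS h, h⟩⟩⟩
  invFun S := ⟨hull V S.1, by
    rcases S.2.2 with h | h
    · rw [h]; simp [hull]; exact fun h => absurd h (by simp)
    · exact H.isExposed_hull h S.2.1⟩
  left_inv G := by
    apply Subtype.ext
    rcases G.1.eq_empty_or_nonempty with h | h
    · simp [h, hull]
    · obtain ⟨S, hS, -, hc, hG⟩ := H.exists_eq_hull hT G.2 h
      simp only [hG]
      congr 1
      ext i
      simp only [Set.mem_ofPred_eq, H.vertex_mem_iff hc]
      exact ⟨fun h => h.2, fun h => ⟨hS h, h⟩⟩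
  right_inv S := by
    apply Subtype.ext
    rcases S.2.2 with h | h
    · simp [h, hull]
    · ext i
      simp only [Set.mem_ofPred_eq, H.vertex_mem_iff h]
      exact ⟨fun h => h.2, fun h => ⟨S.2.1 h, h⟩⟩
  map_rel_iff' := by
    intro G G'
    change {i ∈ T | V i ∈ G.1} ⊆ {i ∈ T | V i ∈ G'.1} ↔ G.1 ⊆ G'.1
    refine ⟨fun h => ?_, fun h i hi => ⟨hi.1, h hi.2⟩⟩
    rcases G.1.eq_empty_or_nonempty with h0 | h0
    · simp [h0]
    · obtain ⟨S, hS, hne, hc, hG⟩ := H.exists_eq_hull hT G.2 h0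
      have hsub : ∀ i ∈ S, V i ∈ G'.1 := fun i hi =>
        (h ⟨hS hi, by rw [hG]; exact vertex_mem_hull hi⟩).2
      have hG' := G'.2.convex (convex_convexHull ℝ _)
      rw [hG]
      refine convexHull_min ?_ hG'
      rintro _ ⟨i, hi, rfl⟩
      exact hsub i hi

variable {E' ι' κ' : Type*} [NormedAddCommGroup E'] [NormedSpace ℝ E']
  {V' : ι' → E'} {l' : κ' → E' →L[ℝ] ℝ} {c' : κ' → ℝ} [Finite ι'] [Finite κ']

/-- A bijection between the vertices of a face `hull V T` and those of a second polytope induces a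
combinatorial equivalence if facets of the first polytope restrict to faces of the second one, and
all facets of the second one arise in this way. -/
lemma combEquiv_of_vertices (H : HVRep V l c) (H' : HVRep V' l' c') (hT : IsClosedIdx V l c T)
    (φ : ι' → ι) (hφ : Function.Injective φ) (hr : Set.range φ = T)
    (h1 : ∀ j, {i' | l j (V (φ i')) + c j = 0} = ∅ ∨
      IsClosedIdx V' l' c' {i' | l j (V (φ i')) + c j = 0})
    (h2 : ∀ j', ∃ j, ∀ i', l j (V (φ i')) + c j = 0 ↔ l' j' (V' i') + c' j' = 0) :
    CombEquiv (hull V T) (hull V' Set.univ) := by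
  have himg : ∀ S' : Set ι', IsClosedIdx V' l' c' S' → IsClosedIdx V l c (φ '' S') := by
    intro S' hS' i hi
    have hsub : φ '' S' ⊆ T := by rw [← hr]; exact Set.image_subset_range _ _
    have hiT : i ∈ T := hT i fun j hj => hi j (active_anti hsub hj)
    rw [← hr] at hiT
    obtain ⟨i', rfl⟩ := hiT
    refine ⟨i', hS' i' fun j' hj' => ?_, rfl⟩
    obtain ⟨j, hj⟩ := h2 j'
    refine (hj i').1 (hi j ?_)
    rintro _ ⟨k, hk, rfl⟩
    exact (hj k).2 (hj' k hk)
  let e : {S : Set ι // S ⊆ T ∧ (S = ∅ ∨ IsClosedIdx V l c S)} ≃o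
      {S : Set ι' // S ⊆ Set.univ ∧ (S = ∅ ∨ IsClosedIdx V' l' c' S)} :=
    { toFun := fun S => ⟨φ ⁻¹' S.1, Set.subset_univ _, by
        rcases S.2.2 with h | h
        · left; simp [h]
        · exact isClosedIdx_preimage φ h1 h⟩
      invFun := fun S => ⟨φ '' S.1, by rw [← hr]; exact Set.image_subset_range _ _, by
        rcases S.2.2 with h | h
        · left; simp [h]
        · exact Or.inr (himg _ h)⟩
      left_inv := fun S => Subtype.ext (by
        simp only
        rw [Set.image_preimage_eq_iff, hr]; exact S.2.1)
      right_inv := fun S => Subtype.ext (by simp only [Set.preimage_image_eq _ hφ])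
      map_rel_iff' := by
        intro S S'
        change φ ⁻¹' S.1 ⊆ φ ⁻¹' S'.1 ↔ S.1 ⊆ S'.1
        exact Set.preimage_subset_preimage_iff (by rw [hr]; exact S.2.1) }
  exact ⟨(H.exposedIso hT).trans (e.trans (H'.exposedIso isClosedIdx_univ).symm)⟩

end CombEquiv

/-- The vertices of the standard cube, indexed by the binary expansion of their coordinates. -/
def cubeVertex (k : ℕ) (n : Fin (2 ^ k)) : Fin k → ℝ :=
  fun i => if (n : ℕ).testBit i then 1 else 0

/-- The linear parts of the facet functionals `x i` and `1 - x i` of the standard cube. -/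
def cubeLin (k : ℕ) (j : Fin k × Bool) : (Fin k → ℝ) →L[ℝ] ℝ :=
  if j.2 then -ContinuousLinearMap.proj j.1 else ContinuousLinearMap.proj j.1

/-- The constant terms of the facet functionals of the standard cube. -/
def cubeConst (k : ℕ) (j : Fin k × Bool) : ℝ := if j.2 then 1 else 0

lemma cube_eq_zero_iff {k : ℕ} (j : Fin k × Bool) (n : Fin (2 ^ k)) :
    cubeLin k j (cubeVertex k n) + cubeConst k j = 0 ↔ (n : ℕ).testBit j.1 = j.2 := by
  obtain ⟨i, b⟩ := j
  cases b <;> by_cases h : (n : ℕ).testBit i <;> simp [cubeLin, cubeConst, cubeVertex, h]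

lemma range_cubeVertex (k : ℕ) :
    Set.range (cubeVertex k) = Set.univ.pi fun _ : Fin k => ({0, 1} : Set ℝ) := by
  ext x
  simp only [Set.mem_range, Set.mem_pi, Set.mem_univ, forall_const, Set.mem_insert_iff,
    Set.mem_singleton_iff]
  constructor
  · rintro ⟨n, rfl⟩ i
    by_cases h : (n : ℕ).testBit i <;> simp [cubeVertex, h]
  · intro h
    refine ⟨⟨Nat.ofBits fun i => decide (x i = 1), Nat.ofBits_lt_two_pow _⟩, ?_⟩
    ext i
    rcases h i with h | h <;> simp [cubeVertex, Nat.testBit_ofBits_lt, h]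

lemma convexHull_range_cubeVertex (k : ℕ) :
    convexHull ℝ (Set.range (cubeVertex k)) = stdCube k := by
  rw [range_cubeVertex, convexHull_pi]
  simp only [convexHull_pair, segment_eq_Icc zero_le_one]
  exact Set.pi_univ_Icc _ _

lemma hull_cubeVertex (k : ℕ) : hull (cubeVertex k) Set.univ = stdCube k := by
  rw [hull, Set.image_univ, convexHull_range_cubeVertex]

lemma hvRep_cube (k : ℕ) : HVRep (cubeVertex k) (cubeLin k) (cubeConst k) where
  nonneg := by
    rintro ⟨i, b⟩ n
    cases b <;> by_cases h : (n : ℕ).testBit i <;> simp [cubeLin, cubeConst, cubeVertex, h]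
  complete := by
    intro x hx
    rw [convexHull_range_cubeVertex]
    refine ⟨fun i => ?_, fun i => ?_⟩
    · simpa [cubeLin, cubeConst] using hx (i, false)
    · have := hx (i, true)
      simp only [cubeLin, cubeConst, if_true, neg_apply,
        ContinuousLinearMap.proj_apply] at this
      simp only [Pi.one_apply]
      linarith

/-- Subcubes, which fix the binary digits in the positions `a`, are faces of the cube. -/
lemma isClosedIdx_subcube (k a b : ℕ) :
    ({n : Fin (2 ^ k) | (n : ℕ) &&& a = b} : Set _) = ∅ ∨
      IsClosedIdx (cubeVertex k) (cubeLin k) (cubeConst k) {n | (n : ℕ) &&& a = b} := by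
  rcases ({n : Fin (2 ^ k) | (n : ℕ) &&& a = b} : Set _).eq_empty_or_nonempty with h | ⟨m, hm⟩
  · exact Or.inl h
  right
  intro n hn
  have hm' : (m : ℕ) &&& a = b := hm
  change (n : ℕ) &&& a = b
  rw [← hm']
  refine Nat.eq_of_testBit_eq fun i => ?_
  rw [Nat.testBit_land, Nat.testBit_land]
  by_cases ha : a.testBit i
  swap
  · simp [ha]
  by_cases hi : i < k
  · have := hn (⟨i, hi⟩, (m : ℕ).testBit i) fun n' hn' => by
      rw [cube_eq_zero_iff]
      have hn'' : (n' : ℕ) &&& a = b := hn'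
      have h2 := congrArg (fun t => t.testBit i) (hn''.trans hm'.symm)
      simpa [Nat.testBit_land, ha] using h2
    rw [cube_eq_zero_iff] at this
    simp only at this
    rw [this]
  · have hle : 2 ^ k ≤ 2 ^ i := Nat.pow_le_pow_right (by norm_num) (not_lt.1 hi)
    rw [Nat.testBit_lt_two_pow (n.2.trans_le hle), Nat.testBit_lt_two_pow (m.2.trans_le hle)]

/-- A nonempty face of the cube is a subcube. -/
lemma exists_subcube_of_isClosedIdx {k : ℕ} {S : Set (Fin (2 ^ k))} (hne : S.Nonempty)
    (hS : IsClosedIdx (cubeVertex k) (cubeLin k) (cubeConst k) S) :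
    ∃ a < 2 ^ k, ∃ b, S = {n : Fin (2 ^ k) | (n : ℕ) &&& a = b} := by
  classical
  obtain ⟨m, hm⟩ := hne
  set a := Nat.ofBits fun i : Fin k => decide (∀ n ∈ S, (n : ℕ).testBit i = (m : ℕ).testBit i)
    with ha
  refine ⟨a, Nat.ofBits_lt_two_pow _, m &&& a, ?_⟩
  ext n
  refine ⟨fun hn => Nat.eq_of_testBit_eq fun i => ?_, fun hn => hS n fun j hj => ?_⟩
  · rw [Nat.testBit_land, Nat.testBit_land]
    by_cases hi : i < k
    · rw [ha, Nat.testBit_ofBits_lt _ _ hi]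
      by_cases hc : ∀ n ∈ S, (n : ℕ).testBit i = (m : ℕ).testBit i
      · rw [hc n hn]
      · simp [hc]
    · rw [ha, Nat.testBit_ofBits_ge _ _ (not_lt.1 hi)]; simp
  · have hj' : ∀ n' ∈ S, (n' : ℕ).testBit j.1 = j.2 := fun n' hn' =>
      (cube_eq_zero_iff j n').1 (hj n' hn')
    rw [cube_eq_zero_iff]
    have h2 := congrArg (fun t => t.testBit j.1) (show (n : ℕ) &&& a = m &&& a from hn)
    have h3 : a.testBit j.1 = true := by
      rw [ha, Nat.testBit_ofBits_lt _ _ j.1.2]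
      simp only [decide_eq_true_eq]
      exact fun n' hn' => (hj' n' hn').trans (hj' m hm).symm
    simp only [Nat.testBit_land, h3, Bool.and_true] at h2
    rw [h2, hj' m hm]

/-! ### Boolean list functions for kernel computation -/

/-- `List.all`, written with the recursor because the kernel evaluates that form fastest. -/
def allL {α : Type*} (p : α → Bool) (l : List α) : Bool :=
  List.rec true (fun a _ r => cond (p a) r false) l

/-- `List.any`, written with the recursor. -/
def anyL {α : Type*} (p : α → Bool) (l : List α) : Bool :=
  List.rec false (fun a _ r => cond (p a) true r) l

/-- `List.filter`, written with the recursor. -/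
def filterL {α : Type*} (p : α → Bool) (l : List α) : List α :=
  List.rec [] (fun a _ r => cond (p a) (a :: r) r) l

/-- Membership in a list of natural numbers. -/
def memL (n : ℕ) (l : List ℕ) : Bool := anyL (Nat.beq n) l

/-- The binary digit of `t` in position `i`. -/
def hasBit (t i : ℕ) : Bool := Nat.beq (Nat.land 1 (Nat.shiftRight t i)) 1

/-- The bit mask of a singleton. -/
def bitMask (i : ℕ) : ℕ := Nat.shiftLeft 1 i

lemma allL_iff {α : Type*} {p : α → Bool} {l : List α} : allL p l = true ↔ ∀ a ∈ l, p a = true := by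
  induction l with
  | nil => simp [allL]
  | cons a l ih =>
    have : allL p (a :: l) = cond (p a) (allL p l) false := rfl
    rw [this]
    cases h : p a <;> simp [h, ih]

lemma anyL_iff {α : Type*} {p : α → Bool} {l : List α} : anyL p l = true ↔ ∃ a ∈ l, p a = true := by
  induction l with
  | nil => simp [anyL]
  | cons a l ih =>
    have : anyL p (a :: l) = cond (p a) true (anyL p l) := rfl
    rw [this]
    cases h : p a <;> simp [h, ih]

lemma mem_filterL {α : Type*} {p : α → Bool} {l : List α} {a : α} :
    a ∈ filterL p l ↔ a ∈ l ∧ p a = true := by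
  induction l with
  | nil => simp [filterL]
  | cons b l ih =>
    have : filterL p (b :: l) = cond (p b) (b :: filterL p l) (filterL p l) := rfl
    rw [this]
    cases h : p b
    · simp only [cond_false, ih, List.mem_cons]
      constructor
      · exact fun h => ⟨Or.inr h.1, h.2⟩
      · rintro ⟨rfl | h1, h2⟩
        · simp [h] at h2
        · exact ⟨h1, h2⟩
    · simp only [cond_true, ih, List.mem_cons]
      constructor
      · rintro (rfl | h1)
        · exact ⟨Or.inl rfl, h⟩
        · exact ⟨Or.inr h1.1, h1.2⟩
      · rintro ⟨rfl | h1, h2⟩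
        · exact Or.inl rfl
        · exact Or.inr ⟨h1, h2⟩

lemma memL_iff {n : ℕ} {l : List ℕ} : memL n l = true ↔ n ∈ l := by
  simp [memL, anyL_iff, Nat.beq_eq]

lemma hasBit_eq (t i : ℕ) : hasBit t i = t.testBit i := by
  have : Nat.land 1 (Nat.shiftRight t i) = (t >>> i) % 2 := by
    rw [← Nat.one_and_eq_mod_two]; rfl
  rw [hasBit, this, Nat.testBit_eq_decide_div_mod_eq, Nat.shiftRight_eq_div_pow]
  rw [Bool.eq_iff_iff]
  simp [Nat.beq_eq]

lemma testBit_bitMask (i j : ℕ) : (bitMask i).testBit j = decide (i = j) := by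
  have : bitMask i = 2 ^ i := Nat.one_shiftLeft i
  rw [this, Nat.testBit_two_pow]

/-! ### Geometric realizations and stellar subdivisions of edges -/

/-- The geometric realization, in barycentric coordinates, of the abstract simplicial complex on
the vertex set `ι` that is generated by the simplices in `K`. -/
abbrev Realization {ι : Type*} [Fintype ι] (K : Set (Set ι)) : Type _ :=
  {w : ι → ℝ // (∀ i, 0 ≤ w i) ∧ ∑ i, w i = 1 ∧ ∃ T ∈ K, Function.support w ⊆ T}

/-- `K'` is the stellar subdivision of `K` at the edge `a b`, with new vertex `m`. -/
structure IsStellar {ι : Type*} (K K' : Set (Set ι)) (a b m : ι) : Prop where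
  ab : a ≠ b
  am : a ≠ m
  bm : b ≠ m
  new : ∀ T ∈ K, m ∉ T
  keep : ∀ T ∈ K, ¬ (a ∈ T ∧ b ∈ T) → T ∈ K'
  split : ∀ T ∈ K, a ∈ T → b ∈ T → insert m (T \ {a}) ∈ K' ∧ insert m (T \ {b}) ∈ K'
  old : ∀ T ∈ K', m ∉ T → T ∈ K ∧ ¬ (a ∈ T ∧ b ∈ T)
  star : ∀ T ∈ K', m ∈ T → (a ∉ T ∧ b ∈ T ∧ insert a (T \ {m}) ∈ K) ∨
    (b ∉ T ∧ a ∈ T ∧ insert b (T \ {m}) ∈ K)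

/-- A stellar subdivision does not change the realization: where `m` is the midpoint of `a b`, a
point with coordinates `w a` and `w b` gets the coordinate `2 * min (w a) (w b)` at `m`. -/
def IsStellar.homeomorph {ι : Type*} [Fintype ι] [DecidableEq ι] {K K' : Set (Set ι)} {a b m : ι}
    (h : IsStellar K K' a b m) : Realization K ≃ₜ Realization K' := by
  have hab := h.ab
  have ham := h.am
  have hbm := h.bm
  let d : ι → ℝ := 2 • Pi.single m 1 - Pi.single a 1 - Pi.single b 1
  have hdm : d m = 2 := by simp [d, ham, hbm]
  have hda : d a = -1 := by simp [d, hab, ham]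
  have hdb : d b = -1 := by simp [d, hab.symm, hbm]
  have hd0 : ∀ i, i ≠ a → i ≠ b → i ≠ m → d i = 0 := by
    intro i h1 h2 h3
    simp [d, h1, h2, h3]
  have hdsum : ∑ i, d i = 0 := by
    simp only [d, Pi.sub_apply, Pi.smul_apply, Finset.sum_sub_distrib, ← Finset.smul_sum]
    simp
    norm_num
  -- Supports of points of the two realizations.
  have hK : ∀ w : ι → ℝ, (∃ T ∈ K, Function.support w ⊆ T) → w m = 0 := by
    rintro w ⟨T, hT, hw⟩
    by_contra hne
    exact h.new T hT (hw hne)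
  have hf : ∀ w : ι → ℝ, (∀ i, 0 ≤ w i) → (∃ T ∈ K, Function.support w ⊆ T) →
      ∃ T ∈ K', Function.support (w + min (w a) (w b) • d) ⊆ T := by
    rintro w h0 ⟨T, hT, hw⟩
    by_cases hc : a ∈ T ∧ b ∈ T
    · obtain ⟨h1, h2⟩ := h.split T hT hc.1 hc.2
      rcases le_total (w a) (w b) with hle | hle
      · refine ⟨_, h1, fun i hi => ?_⟩
        by_cases him : i = m
        · simp [him]
        right
        have hia : i ≠ a := by
          rintro rfl
          simp [hda, hle] at hi
        refine ⟨?_, hia⟩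
        by_cases hib : i = b
        · rw [hib]; exact hc.2
        · exact hw (by simpa [hd0 i hia hib him] using hi)
      · refine ⟨_, h2, fun i hi => ?_⟩
        by_cases him : i = m
        · simp [him]
        right
        have hib : i ≠ b := by
          rintro rfl
          simp [hdb, hle] at hi
        refine ⟨?_, hib⟩
        by_cases hia : i = a
        · rw [hia]; exact hc.1
        · exact hw (by simpa [hd0 i hia hib him] using hi)
    · have hmin : min (w a) (w b) = 0 := by
        rcases not_and_or.1 hc with hc | hc
        · have : w a = 0 := by by_contra hne; exact hc (hw hne)
          rw [this]; exact min_eq_left (h0 b)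
        · have : w b = 0 := by by_contra hne; exact hc (hw hne)
          rw [this]; exact min_eq_right (h0 a)
      exact ⟨T, h.keep T hT hc, by simpa [hmin] using hw⟩
  have hg : ∀ w : ι → ℝ, (∀ i, 0 ≤ w i) → (∃ T ∈ K', Function.support w ⊆ T) →
      min (w a) (w b) = 0 ∧ ∃ T ∈ K, Function.support (w - (w m / 2) • d) ⊆ T := by
    rintro w h0 ⟨T, hT, hw⟩
    by_cases hm : m ∈ T
    · rcases h.star T hT hm with ⟨h1, h2, h3⟩ | ⟨h1, h2, h3⟩
      · have hwa : w a = 0 := by by_contra hne; exact h1 (hw hne)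
        refine ⟨by rw [hwa]; exact min_eq_left (h0 b), _, h3, fun i hi => ?_⟩
        by_cases hia : i = a
        · simp [hia]
        right
        have him : i ≠ m := by
          rintro rfl
          simp [hdm] at hi
        refine ⟨?_, him⟩
        by_cases hib : i = b
        · rw [hib]; exact h2
        · exact hw (by simpa [hd0 i hia hib him] using hi)
      · have hwb : w b = 0 := by by_contra hne; exact h1 (hw hne)
        refine ⟨by rw [hwb]; exact min_eq_right (h0 a), _, h3, fun i hi => ?_⟩
        by_cases hib : i = b
        · simp [hib]
        right
        have him : i ≠ m := by
          rintro rfl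
          simp [hdm] at hi
        refine ⟨?_, him⟩
        by_cases hia : i = a
        · rw [hia]; exact h2
        · exact hw (by simpa [hd0 i hia hib him] using hi)
    · obtain ⟨hTK, hc⟩ := h.old T hT hm
      have hwm : w m = 0 := by by_contra hne; exact hm (hw hne)
      refine ⟨?_, T, hTK, by simpa [hwm] using hw⟩
      rcases not_and_or.1 hc with hc | hc
      · have : w a = 0 := by by_contra hne; exact hc (hw hne)
        rw [this]; exact min_eq_left (h0 b)
      · have : w b = 0 := by by_contra hne; exact hc (hw hne)
        rw [this]; exact min_eq_right (h0 a)
  refine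
    { toFun := fun w => ⟨w.1 + min (w.1 a) (w.1 b) • d, ?_, ?_, hf w.1 w.2.1 w.2.2.2⟩
      invFun := fun w => ⟨w.1 - (w.1 m / 2) • d, ?_, ?_, (hg w.1 w.2.1 w.2.2.2).2⟩
      left_inv := ?_
      right_inv := ?_
      continuous_toFun := ?_
      continuous_invFun := ?_ }
  · intro i
    have h0 := w.2.1
    simp only [Pi.add_apply, Pi.smul_apply, smul_eq_mul]
    by_cases hia : i = a
    · rw [hia, hda]; linarith [min_le_left (w.1 a) (w.1 b)]
    by_cases hib : i = b
    · rw [hib, hdb]; linarith [min_le_right (w.1 a) (w.1 b)]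
    by_cases him : i = m
    · rw [him, hdm]; linarith [h0 m, le_min (h0 a) (h0 b)]
    rw [hd0 i hia hib him]; linarith [h0 i]
  · simp only [Pi.add_apply, Pi.smul_apply, smul_eq_mul, Finset.sum_add_distrib, ← Finset.mul_sum,
      hdsum, w.2.2.1]
    simp
  · intro i
    have h0 := w.2.1
    simp only [Pi.sub_apply, Pi.smul_apply, smul_eq_mul]
    by_cases hia : i = a
    · rw [hia, hda]; linarith [h0 a, h0 m]
    by_cases hib : i = b
    · rw [hib, hdb]; linarith [h0 b, h0 m]
    by_cases him : i = m
    · rw [him, hdm]; linarith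
    rw [hd0 i hia hib him]; linarith [h0 i]
  · simp only [Pi.sub_apply, Pi.smul_apply, smul_eq_mul, Finset.sum_sub_distrib, ← Finset.mul_sum,
      hdsum, w.2.2.1]
    simp
  · intro w
    apply Subtype.ext
    have hwm := hK w.1 w.2.2.2
    simp only [Pi.add_apply, Pi.smul_apply, smul_eq_mul, hwm, hdm]
    ext i
    simp
  · intro w
    apply Subtype.ext
    have hmin := (hg w.1 w.2.1 w.2.2.2).1
    have hm2 : min (w.1 a - (w.1 m / 2) * d a) (w.1 b - (w.1 m / 2) * d b) = w.1 m / 2 := by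
      rw [hda, hdb]
      have : ∀ x y z : ℝ, min (x - y * -1) (z - y * -1) = min x z + y := by
        intro x y z
        rw [← min_add_add_right]; congr 1 <;> ring
      rw [this, hmin, zero_add]
    simp only [Pi.sub_apply, Pi.smul_apply, smul_eq_mul, hm2]
    ext i
    simp
  · have hc : Continuous fun w : Realization K => w.1 := continuous_subtype_val
    exact (hc.add ((((continuous_apply a).comp hc).min ((continuous_apply b).comp hc)).smul
      continuous_const)).subtype_mk _
  · have hc : Continuous fun w : Realization K' => w.1 := continuous_subtype_val
    exact (hc.sub ((((continuous_apply m).comp hc).div_const 2).smul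
      continuous_const)).subtype_mk _

/-! ### Stellar moves on complexes given by bit masks -/

/-- The set with the given bit mask. -/
def maskSet (N t : ℕ) : Set (Fin N) := {i | t.testBit i}

/-- The simplices with the given bit masks. -/
def maskComplex (N : ℕ) (L : List ℕ) : Set (Set (Fin N)) := {T | ∃ t ∈ L, T = maskSet N t}

/-- Subdivision of the edge `a b` by the new vertex `m`. -/
def subdivide (a b m : ℕ) (L : List ℕ) : List ℕ :=
  List.rec [] (fun t _ r => cond (cond (hasBit t a) (hasBit t b) false)
    (Nat.xor t (Nat.xor (bitMask a) (bitMask m)) ::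
      Nat.xor t (Nat.xor (bitMask b) (bitMask m)) :: r) (t :: r)) L

/-- The inverse of `subdivide`: the vertex `m` is removed, and the two simplices that contain `m`
and one of the vertices `a` and `b` are merged. -/
def weld (a b m : ℕ) (L : List ℕ) : List ℕ :=
  List.rec [] (fun t _ r => cond (hasBit t m)
    (cond (hasBit t a) (Nat.xor t (Nat.xor (bitMask b) (bitMask m)) :: r) r) (t :: r)) L

/-- `m` is a new vertex. -/
def canSubdivide (m : ℕ) (L : List ℕ) : Bool := allL (fun t => !hasBit t m) L

/-- The simplices containing `m` come in pairs, one containing `a` and one containing `b`. -/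
def canWeld (a b m : ℕ) (L : List ℕ) : Bool :=
  allL (fun t => cond (hasBit t m)
    (cond (hasBit t a) (!hasBit t b) (hasBit t b) &&
      memL (Nat.xor t (Nat.xor (bitMask a) (bitMask b))) L)
    (!(hasBit t a && hasBit t b))) L

lemma mem_subdivide {a b m : ℕ} {L : List ℕ} {t : ℕ} : t ∈ subdivide a b m L ↔ ∃ s ∈ L,
    ((s.testBit a ∧ s.testBit b) ∧ (t = s ^^^ (bitMask a ^^^ bitMask m) ∨
      t = s ^^^ (bitMask b ^^^ bitMask m))) ∨ (¬ (s.testBit a ∧ s.testBit b) ∧ t = s) := by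
  induction L with
  | nil => simp [subdivide]
  | cons s L ih =>
    have h : subdivide a b m (s :: L) = cond (cond (hasBit s a) (hasBit s b) false)
      (Nat.xor s (Nat.xor (bitMask a) (bitMask m)) ::
        Nat.xor s (Nat.xor (bitMask b) (bitMask m)) :: subdivide a b m L)
      (s :: subdivide a b m L) := rfl
    rw [h, hasBit_eq, hasBit_eq]
    have hx : ∀ x y, Nat.xor x y = x ^^^ y := fun _ _ => rfl
    simp only [hx, List.mem_cons, exists_eq_or_imp, ← ih]
    cases h1 : s.testBit a <;> cases h2 : s.testBit b <;> simp [or_assoc]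

lemma mem_weld {a b m : ℕ} {L : List ℕ} {t : ℕ} : t ∈ weld a b m L ↔ ∃ s ∈ L,
    (s.testBit m ∧ s.testBit a ∧ t = s ^^^ (bitMask b ^^^ bitMask m)) ∨
      (¬ s.testBit m ∧ t = s) := by
  induction L with
  | nil => simp [weld]
  | cons s L ih =>
    have h : weld a b m (s :: L) = cond (hasBit s m)
      (cond (hasBit s a) (Nat.xor s (Nat.xor (bitMask b) (bitMask m)) :: weld a b m L)
        (weld a b m L)) (s :: weld a b m L) := rfl
    rw [h, hasBit_eq, hasBit_eq]
    have hx : ∀ x y, Nat.xor x y = x ^^^ y := fun _ _ => rfl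
    simp only [hx, List.mem_cons, exists_eq_or_imp, ← ih]
    cases h1 : s.testBit m <;> cases h2 : s.testBit a <;> simp

/-- Exchanging an element for another one, on the level of bit masks. -/
lemma maskSet_xor {N s : ℕ} {a m : Fin N} (ha : s.testBit a) (hm : ¬ s.testBit m) :
    maskSet N (s ^^^ (bitMask a ^^^ bitMask m)) = insert m (maskSet N s \ {a}) := by
  have hne : a ≠ m := by rintro rfl; exact hm ha
  ext i
  simp only [maskSet, Set.mem_ofPred_eq, Nat.testBit_xor, testBit_bitMask, Set.mem_insert_iff,
    Set.mem_sdiff, Set.mem_singleton_iff, Fin.val_inj]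
  by_cases h1 : i = a
  · subst h1; simp [ha, hne, hne.symm]
  by_cases h2 : i = m
  · subst h2; simp [hm, h1, Ne.symm h1]
  simp [h1, h2, Ne.symm h1, Ne.symm h2]

lemma isStellar_subdivide {N : ℕ} {a b m : Fin N} (hab : a ≠ b) (ham : a ≠ m) (hbm : b ≠ m)
    {L : List ℕ} (h : canSubdivide m L = true) :
    IsStellar (maskComplex N L) (maskComplex N (subdivide a b m L)) a b m := by
  have hm : ∀ s ∈ L, ¬ s.testBit m := by
    intro s hs
    have := allL_iff.1 h s hs
    simpa [hasBit_eq] using this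
  refine ⟨hab, ham, hbm, ?_, ?_, ?_, ?_, ?_⟩
  · rintro _ ⟨t, ht, rfl⟩
    exact hm t ht
  · rintro _ ⟨t, ht, rfl⟩ hc
    exact ⟨t, mem_subdivide.2 ⟨t, ht, Or.inr ⟨hc, rfl⟩⟩, rfl⟩
  · rintro _ ⟨t, ht, rfl⟩ ha hb
    exact ⟨⟨_, mem_subdivide.2 ⟨t, ht, Or.inl ⟨⟨ha, hb⟩, Or.inl rfl⟩⟩,
        (maskSet_xor ha (hm t ht)).symm⟩,
      ⟨_, mem_subdivide.2 ⟨t, ht, Or.inl ⟨⟨ha, hb⟩, Or.inr rfl⟩⟩,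
        (maskSet_xor hb (hm t ht)).symm⟩⟩
  · rintro _ ⟨t, ht, rfl⟩ hmt
    obtain ⟨s, hs, ⟨⟨ha, hb⟩, rfl | rfl⟩ | ⟨hc, rfl⟩⟩ := mem_subdivide.1 ht
    · rw [maskSet_xor ha (hm s hs)] at hmt; simp at hmt
    · rw [maskSet_xor hb (hm s hs)] at hmt; simp at hmt
    · exact ⟨⟨_, hs, rfl⟩, hc⟩
  · rintro _ ⟨t, ht, rfl⟩ hmt
    have hback : ∀ (s : ℕ) (x : Fin N), s.testBit x → ¬ s.testBit m →
        insert x (insert m (maskSet N s \ {x}) \ {m}) = maskSet N s := by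
      intro s x hx hsm
      ext i
      simp only [maskSet, Set.mem_insert_iff, Set.mem_sdiff, Set.mem_singleton_iff,
        Set.mem_ofPred_eq]
      by_cases h1 : i = x
      · subst h1; simp [hx]
      by_cases h2 : i = m
      · subst h2; simp [h1, hsm]
      simp [h1, h2]
    obtain ⟨s, hs, ⟨⟨ha, hb⟩, rfl | rfl⟩ | ⟨hc, rfl⟩⟩ := mem_subdivide.1 ht
    · left
      rw [maskSet_xor ha (hm s hs), hback s a ha (hm s hs)]
      refine ⟨by simp [ham], ?_, s, hs, rfl⟩
      exact Or.inr ⟨hb, by simpa using hab.symm⟩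
    · right
      rw [maskSet_xor hb (hm s hs), hback s b hb (hm s hs)]
      refine ⟨by simp [hbm], ?_, s, hs, rfl⟩
      exact Or.inr ⟨ha, by simpa using hab⟩
    · exact absurd hmt (hm _ hs)

lemma isStellar_weld {N : ℕ} {a b m : Fin N} (hab : a ≠ b) (ham : a ≠ m) (hbm : b ≠ m)
    {L : List ℕ} (h : canWeld a b m L = true) :
    IsStellar (maskComplex N (weld a b m L)) (maskComplex N L) a b m := by
  have hx : ∀ x y, Nat.xor x y = x ^^^ y := fun _ _ => rfl
  have h1 : ∀ s ∈ L, s.testBit m → ((s.testBit a ∧ ¬ s.testBit b) ∨ (¬ s.testBit a ∧ s.testBit b)) ∧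
      s ^^^ (bitMask a ^^^ bitMask b) ∈ L := by
    intro s hs hm
    have := allL_iff.1 h s hs
    simp only [hasBit_eq, hm, cond_true, Bool.and_eq_true, memL_iff, hx] at this
    refine ⟨?_, this.2⟩
    cases ha : s.testBit a <;> cases hb : s.testBit b <;> simp_all
  have h2 : ∀ s ∈ L, ¬ s.testBit m → ¬ (s.testBit a ∧ s.testBit b) := by
    intro s hs hm
    have := allL_iff.1 h s hs
    simp only [Bool.not_eq_true] at hm
    simp only [hasBit_eq, hm, cond_false, Bool.not_eq_true', Bool.and_eq_false_iff] at this
    rintro ⟨ha, hb⟩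
    simp [ha, hb] at this
  -- Simplices of the welded complex that contain `a b` come from simplices containing `a m`.
  have h3 : ∀ s : ℕ, s.testBit a → ¬ s.testBit b → s.testBit m →
      maskSet N (s ^^^ (bitMask b ^^^ bitMask m)) = insert b (maskSet N s \ {m}) := by
    intro s _ hb hm
    rw [Nat.xor_comm (bitMask b)]
    exact maskSet_xor hm hb
  refine ⟨hab, ham, hbm, ?_, ?_, ?_, ?_, ?_⟩
  · rintro _ ⟨t, ht, rfl⟩ hmt
    obtain ⟨s, hs, ⟨hm, ha, rfl⟩ | ⟨hm, rfl⟩⟩ := mem_weld.1 ht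
    · have hb : ¬ s.testBit b := by
        rcases (h1 s hs hm).1 with h | h
        · exact h.2
        · exact absurd ha h.1
      rw [h3 s ha hb hm] at hmt
      simp [hbm.symm] at hmt
    · exact hm hmt
  · rintro _ ⟨t, ht, rfl⟩ hc
    obtain ⟨s, hs, ⟨hm, ha, rfl⟩ | ⟨hm, rfl⟩⟩ := mem_weld.1 ht
    · have hb : ¬ s.testBit b := by
        rcases (h1 s hs hm).1 with h | h
        · exact h.2
        · exact absurd ha h.1
      rw [h3 s ha hb hm] at hc
      exact absurd ⟨Or.inr ⟨ha, by simpa using ham⟩, by simp⟩ hc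
    · exact ⟨_, hs, rfl⟩
  · rintro _ ⟨t, ht, rfl⟩ hat hbt
    obtain ⟨s, hs, ⟨hm, ha, rfl⟩ | ⟨hm, rfl⟩⟩ := mem_weld.1 ht
    · have hb : ¬ s.testBit b := by
        rcases (h1 s hs hm).1 with h | h
        · exact h.2
        · exact absurd ha h.1
      rw [h3 s ha hb hm]
      refine ⟨⟨_, (h1 s hs hm).2, ?_⟩, ⟨s, hs, ?_⟩⟩
      · rw [maskSet_xor ha hb]
        ext i
        simp only [Set.mem_insert_iff, Set.mem_sdiff, Set.mem_singleton_iff]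
        by_cases hi : i = m
        · subst hi; simp only [true_or, true_iff]
          exact Or.inr ⟨hm, ham.symm⟩
        by_cases hi2 : i = b
        · subst hi2; simp [hab.symm]
        simp [hi, hi2]
      · ext i
        simp only [Set.mem_insert_iff, Set.mem_sdiff, Set.mem_singleton_iff]
        by_cases hi : i = m
        · subst hi; simpa [maskSet] using hm
        by_cases hi2 : i = b
        · subst hi2; simpa [maskSet, hi] using hb
        simp [hi, hi2]
    · exact absurd ⟨hat, hbt⟩ (h2 _ hs hm)
  · rintro _ ⟨t, ht, rfl⟩ hmt
    exact ⟨⟨t, mem_weld.2 ⟨t, ht, Or.inr ⟨hmt, rfl⟩⟩, rfl⟩, h2 t ht hmt⟩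
  · rintro _ ⟨t, ht, rfl⟩ hmt
    rcases (h1 t ht hmt).1 with ⟨ha, hb⟩ | ⟨ha, hb⟩
    · right
      exact ⟨hb, ha, _, mem_weld.2 ⟨t, ht, Or.inl ⟨hmt, ha, rfl⟩⟩, (h3 t ha hb hmt).symm⟩
    · left
      refine ⟨ha, hb, ?_⟩
      set s := t ^^^ (bitMask a ^^^ bitMask b) with hs
      have hsL : s ∈ L := (h1 t ht hmt).2
      have hsa : s.testBit a := by
        simp only [Bool.not_eq_true] at ha
        simp [hs, Nat.testBit_xor, testBit_bitMask, ha, Fin.val_inj, hab.symm]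
      have hsb : ¬ s.testBit b := by
        simp [hs, Nat.testBit_xor, testBit_bitMask, hb, Fin.val_inj, hab]
      have hsm : s.testBit m := by
        rw [hs]
        have hmt' : t.testBit m = true := hmt
        simpa [Nat.testBit_xor, testBit_bitMask, Fin.val_inj, ham, hbm] using hmt'
      refine ⟨_, mem_weld.2 ⟨s, hsL, Or.inl ⟨hsm, hsa, rfl⟩⟩, ?_⟩
      rw [h3 s hsa hsb hsm, hs, Nat.xor_comm (bitMask _) (bitMask _), maskSet_xor hb ha]
      ext i
      simp only [Set.mem_insert_iff, Set.mem_sdiff, Set.mem_singleton_iff]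
      by_cases hi : i = a
      · subst hi; simp [ham]
      by_cases hi2 : i = b
      · subst hi2; simp [hbm, hab.symm]; exact hb
      simp [hi, hi2]

/-- A stellar move: a subdivision (`true`) or a weld (`false`) with the vertices `a`, `b`, `m`. -/
abbrev Move := Bool × ℕ × ℕ × ℕ

/-- A list of masks together with a mask that contains all of them. In a complex that is cut into
such blocks, most blocks can be skipped in the search for the star of a vertex. -/
abbrev Block := ℕ × List ℕ

/-- The masks in a list of blocks. -/
def flatten (C : List Block) : List ℕ := C.flatMap Prod.snd

/-- The first entry of each block contains the masks in the block. -/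
def IsCover (C : List Block) : Prop := ∀ c ∈ C, ∀ t ∈ c.2, ∀ i, t.testBit i → c.1.testBit i

/-- The block with the given masks. -/
def blockOf (l : List ℕ) : Block := (List.rec 0 (fun t _ r => Nat.lor t r) l, l)

/-- Division of a list into blocks of size `n`, of which all but the last one are put in front. -/
def blocks (n : ℕ) : ℕ → List ℕ → List Block
  | 0, l => [blockOf l]
  | k + 1, l => blockOf (l.take n) :: blocks n k (l.drop n)

/-- The simplices that contain `m`. -/
def blockStar (m : ℕ) (C : List Block) : List ℕ :=
  C.flatMap fun c => cond (hasBit c.1 m) (filterL (fun t => hasBit t m) c.2) []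

/-- `subdivide` for blocks. -/
def blockSubdivide (a b m : ℕ) (C : List Block) : List Block :=
  C.map fun c => cond (cond (hasBit c.1 a) (hasBit c.1 b) false)
    (Nat.lor c.1 (bitMask m), subdivide a b m c.2) c

/-- `weld` for blocks. -/
def blockWeld (a b m : ℕ) (C : List Block) : List Block :=
  C.map fun c => cond (hasBit c.1 m) (Nat.lor c.1 (bitMask b), weld a b m c.2) c

/-- `canSubdivide` for blocks. -/
def blockCanSubdivide (m : ℕ) (C : List Block) : Bool :=
  allL (fun c => cond (hasBit c.1 m) (canSubdivide m c.2) true) C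

/-- `canWeld` for blocks. -/
def blockCanWeld (a b m : ℕ) (C : List Block) : Bool :=
  cond (allL (fun c => cond (cond (hasBit c.1 a) (hasBit c.1 b) false)
    (allL (fun t => cond (hasBit t m) true (!(hasBit t a && hasBit t b))) c.2) true) C)
    ((fun S => allL (fun t => cond (hasBit t a) (!hasBit t b) (hasBit t b) &&
      memL (Nat.xor t (Nat.xor (bitMask a) (bitMask b))) S) S) (blockStar m C)) false

lemma mem_flatten {C : List Block} {t : ℕ} : t ∈ flatten C ↔ ∃ c ∈ C, t ∈ c.2 := List.mem_flatMap

lemma isCover_blockOf (l : List ℕ) : ∀ t ∈ (blockOf l).2, ∀ i, t.testBit i →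
    (blockOf l).1.testBit i := by
  induction l with
  | nil => exact fun t ht => absurd ht List.not_mem_nil
  | cons s l ih =>
    intro t ht i hi
    have h : (blockOf (s :: l)).1 = s ||| (blockOf l).1 := rfl
    rw [h, Nat.testBit_lor, Bool.or_eq_true]
    rcases List.mem_cons.1 ht with rfl | ht
    · exact Or.inl hi
    · exact Or.inr (ih t ht i hi)

lemma isCover_blocks (n k : ℕ) (l : List ℕ) : IsCover (blocks n k l) := by
  induction k generalizing l with
  | zero =>
    intro c hc
    rw [blocks, List.mem_singleton] at hc
    exact hc ▸ isCover_blockOf l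
  | succ k ih =>
    intro c hc
    rw [blocks, List.mem_cons] at hc
    rcases hc with rfl | hc
    · exact isCover_blockOf _
    · exact ih _ c hc

lemma flatten_blocks (n k : ℕ) (l : List ℕ) : flatten (blocks n k l) = l := by
  induction k generalizing l with
  | zero => simp [blocks, flatten, blockOf]
  | succ k ih =>
    have h : flatten (blocks n (k + 1) l) = l.take n ++ flatten (blocks n k (l.drop n)) := rfl
    rw [h, ih, List.take_append_drop]

lemma subdivide_append (a b m : ℕ) (l l' : List ℕ) :
    subdivide a b m (l ++ l') = subdivide a b m l ++ subdivide a b m l' := by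
  induction l with
  | nil => rfl
  | cons t l ih =>
    have h : ∀ l, subdivide a b m (t :: l) = cond (cond (hasBit t a) (hasBit t b) false)
      (Nat.xor t (Nat.xor (bitMask a) (bitMask m)) ::
        Nat.xor t (Nat.xor (bitMask b) (bitMask m)) :: subdivide a b m l)
      (t :: subdivide a b m l) := fun _ => rfl
    rw [List.cons_append, h, h, ih]
    cases cond (hasBit t a) (hasBit t b) false <;> rfl

lemma weld_append (a b m : ℕ) (l l' : List ℕ) :
    weld a b m (l ++ l') = weld a b m l ++ weld a b m l' := by
  induction l with
  | nil => rfl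
  | cons t l ih =>
    have h : ∀ l, weld a b m (t :: l) = cond (hasBit t m)
      (cond (hasBit t a) (Nat.xor t (Nat.xor (bitMask b) (bitMask m)) :: weld a b m l)
        (weld a b m l)) (t :: weld a b m l) := fun _ => rfl
    rw [List.cons_append, h, h, ih]
    cases hasBit t m <;> cases hasBit t a <;> rfl

lemma subdivide_eq_self {a b m : ℕ} {l : List ℕ} (h : ∀ t ∈ l, ¬ (t.testBit a ∧ t.testBit b)) :
    subdivide a b m l = l := by
  induction l with
  | nil => rfl
  | cons t l ih =>
    have h1 : subdivide a b m (t :: l) = cond (cond (hasBit t a) (hasBit t b) false)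
      (Nat.xor t (Nat.xor (bitMask a) (bitMask m)) ::
        Nat.xor t (Nat.xor (bitMask b) (bitMask m)) :: subdivide a b m l)
      (t :: subdivide a b m l) := rfl
    have h2 := h t List.mem_cons_self
    have h3 : cond (hasBit t a) (hasBit t b) false = false := by
      rw [hasBit_eq, hasBit_eq]
      cases h4 : t.testBit a <;> cases h5 : t.testBit b <;> simp_all
    rw [h1, h3, ih fun t ht => h t (List.mem_cons_of_mem _ ht)]
    rfl

lemma weld_eq_self {a b m : ℕ} {l : List ℕ} (h : ∀ t ∈ l, ¬ t.testBit m) : weld a b m l = l := by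
  induction l with
  | nil => rfl
  | cons t l ih =>
    have h1 : weld a b m (t :: l) = cond (hasBit t m)
      (cond (hasBit t a) (Nat.xor t (Nat.xor (bitMask b) (bitMask m)) :: weld a b m l)
        (weld a b m l)) (t :: weld a b m l) := rfl
    have h3 : hasBit t m = false := by
      rw [hasBit_eq]
      simpa using h t List.mem_cons_self
    rw [h1, h3, ih fun t ht => h t (List.mem_cons_of_mem _ ht)]
    rfl

section Block

variable {C : List Block} {a b m : ℕ}

lemma IsCover.tail {c : Block} (h : IsCover (c :: C)) : IsCover C :=
  fun c' hc' => h c' (List.mem_cons_of_mem _ hc')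

lemma flatten_blockSubdivide (hC : IsCover C) :
    flatten (blockSubdivide a b m C) = subdivide a b m (flatten C) := by
  induction C with
  | nil => rfl
  | cons c C ih =>
    have h1 : flatten (c :: C) = c.2 ++ flatten C := rfl
    have h2 : flatten (blockSubdivide a b m (c :: C)) =
      (cond (cond (hasBit c.1 a) (hasBit c.1 b) false)
        (Nat.lor c.1 (bitMask m), subdivide a b m c.2) c).2 ++
        flatten (blockSubdivide a b m C) := rfl
    rw [h1, h2, ih hC.tail, subdivide_append]
    cases h3 : cond (hasBit c.1 a) (hasBit c.1 b) false
    · have h4 : ∀ t ∈ c.2, ¬ (t.testBit a ∧ t.testBit b) := by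
        rintro t ht ⟨ha, hb⟩
        rw [hasBit_eq, hasBit_eq, hC c List.mem_cons_self t ht a ha,
          hC c List.mem_cons_self t ht b hb] at h3
        exact Bool.noConfusion h3
      rw [subdivide_eq_self h4]
      rfl
    · rfl

lemma flatten_blockWeld (hC : IsCover C) :
    flatten (blockWeld a b m C) = weld a b m (flatten C) := by
  induction C with
  | nil => rfl
  | cons c C ih =>
    have h1 : flatten (c :: C) = c.2 ++ flatten C := rfl
    have h2 : flatten (blockWeld a b m (c :: C)) =
      (cond (hasBit c.1 m) (Nat.lor c.1 (bitMask b), weld a b m c.2) c).2 ++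
        flatten (blockWeld a b m C) := rfl
    rw [h1, h2, ih hC.tail, weld_append]
    cases h3 : hasBit c.1 m
    · have h4 : ∀ t ∈ c.2, ¬ t.testBit m := by
        intro t ht hm
        rw [hasBit_eq, hC c List.mem_cons_self t ht m hm] at h3
        exact Bool.noConfusion h3
      rw [weld_eq_self h4]
      rfl
    · rfl

lemma IsCover.blockSubdivide (hC : IsCover C) : IsCover (blockSubdivide a b m C) := by
  intro c' hc' t ht i hi
  obtain ⟨c, hc, rfl⟩ := List.mem_map.1 hc'
  have hx : ∀ x y, Nat.xor x y = x ^^^ y := fun _ _ => rfl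
  cases h : cond (hasBit c.1 a) (hasBit c.1 b) false
  · rw [h] at ht
    exact hC c hc t ht i hi
  · rw [h] at ht
    change (c.1 ||| bitMask m).testBit i
    rw [Nat.testBit_lor, Bool.or_eq_true, testBit_bitMask, decide_eq_true_iff]
    obtain ⟨s, hs, ⟨⟨ha, hb⟩, rfl | rfl⟩ | ⟨-, rfl⟩⟩ := mem_subdivide.1 ht
    · by_contra! hcon
      rw [Nat.testBit_xor, Nat.testBit_xor, testBit_bitMask, testBit_bitMask] at hi
      have h1 : s.testBit i = false := by
        by_contra h1
        exact hcon.1 (hC c hc s hs i (by simpa using h1))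
      have h2 : a ≠ i := by rintro rfl; simp [ha] at h1
      simp [h1, h2, hcon.2] at hi
    · by_contra! hcon
      rw [Nat.testBit_xor, Nat.testBit_xor, testBit_bitMask, testBit_bitMask] at hi
      have h1 : s.testBit i = false := by
        by_contra h1
        exact hcon.1 (hC c hc s hs i (by simpa using h1))
      have h2 : b ≠ i := by rintro rfl; simp [hb] at h1
      simp [h1, h2, hcon.2] at hi
    · exact Or.inl (hC c hc _ hs i hi)

lemma IsCover.blockWeld (hC : IsCover C) : IsCover (blockWeld a b m C) := by
  intro c' hc' t ht i hi
  obtain ⟨c, hc, rfl⟩ := List.mem_map.1 hc'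
  cases h : hasBit c.1 m
  · rw [h] at ht
    exact hC c hc t ht i hi
  · rw [h] at ht
    change (c.1 ||| bitMask b).testBit i
    rw [Nat.testBit_lor, Bool.or_eq_true, testBit_bitMask, decide_eq_true_iff]
    obtain ⟨s, hs, ⟨hm, -, rfl⟩ | ⟨-, rfl⟩⟩ := mem_weld.1 ht
    · by_contra! hcon
      rw [Nat.testBit_xor, Nat.testBit_xor, testBit_bitMask, testBit_bitMask] at hi
      have h1 : s.testBit i = false := by
        by_contra h1
        exact hcon.1 (hC c hc s hs i (by simpa using h1))
      have h2 : m ≠ i := by rintro rfl; simp [hm] at h1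
      simp [h1, h2, hcon.2] at hi
    · exact Or.inl (hC c hc _ hs i hi)

lemma canSubdivide_flatten (hC : IsCover C) (h : blockCanSubdivide m C = true) :
    canSubdivide m (flatten C) = true := by
  refine allL_iff.2 fun t ht => ?_
  obtain ⟨c, hc, ht⟩ := mem_flatten.1 ht
  have h1 := allL_iff.1 h c hc
  cases h2 : hasBit c.1 m
  · rw [Bool.not_eq_true', hasBit_eq, ← Bool.not_eq_true]
    intro h3
    rw [hasBit_eq, hC c hc t ht m h3] at h2
    exact Bool.noConfusion h2
  · rw [h2] at h1
    exact allL_iff.1 h1 t ht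

lemma mem_blockStar (hC : IsCover C) {t : ℕ} :
    t ∈ blockStar m C ↔ t ∈ flatten C ∧ t.testBit m = true := by
  rw [mem_flatten]
  constructor
  · intro h
    obtain ⟨c, hc, h⟩ := List.mem_flatMap.1 h
    cases h2 : hasBit c.1 m
    · rw [h2] at h; exact absurd h List.not_mem_nil
    · rw [h2, cond_true, mem_filterL, hasBit_eq] at h
      exact ⟨⟨c, hc, h.1⟩, h.2⟩
  · rintro ⟨⟨c, hc, h⟩, hm⟩
    refine List.mem_flatMap.2 ⟨c, hc, ?_⟩
    rw [hasBit_eq, hC c hc t h m hm, cond_true, mem_filterL, hasBit_eq]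
    exact ⟨h, hm⟩

lemma canWeld_flatten (hC : IsCover C) (h : blockCanWeld a b m C = true) :
    canWeld a b m (flatten C) = true := by
  unfold blockCanWeld at h
  simp only [Bool.cond_eq_true_distrib, Bool.false_eq_true, if_false_right] at h
  obtain ⟨h1, h2⟩ := h
  refine allL_iff.2 fun t ht => ?_
  cases hm : hasBit t m
  · obtain ⟨c, hc, htc⟩ := mem_flatten.1 ht
    have h3 := allL_iff.1 h1 c hc
    rw [cond_false, Bool.not_eq_true', ← Bool.not_eq_true, Bool.and_eq_true, hasBit_eq, hasBit_eq]
    rintro ⟨ha, hb⟩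
    rw [hasBit_eq, hasBit_eq, hC c hc t htc a ha, hC c hc t htc b hb] at h3
    have h4 := allL_iff.1 h3 t htc
    rw [hm, hasBit_eq, hasBit_eq, ha, hb] at h4
    exact Bool.noConfusion h4
  · have h3 := allL_iff.1 h2 t ((mem_blockStar hC).2 ⟨ht, by rw [← hasBit_eq, hm]⟩)
    rw [Bool.and_eq_true, memL_iff, mem_blockStar hC] at h3
    rw [cond_true, Bool.and_eq_true, memL_iff]
    exact ⟨h3.1, h3.2.1⟩

end Block

/-- All moves are admissible, and they lead from the complex `C` to the complex `L'`. -/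
def runMoves (N : ℕ) (L' : List ℕ) (ms : List Move) (C : List Block) : Bool :=
  List.rec (motive := fun _ => List Block → Bool)
    (fun C => cond (allL (fun t => memL t L') (flatten C))
      (allL (fun t => memL t (flatten C)) L') false)
    (fun mv _ r C =>
      cond (cond (Nat.beq mv.2.1 mv.2.2.1) true (cond (Nat.beq mv.2.1 mv.2.2.2) true
        (cond (Nat.beq mv.2.2.1 mv.2.2.2) true
        (!(Nat.blt mv.2.1 N && Nat.blt mv.2.2.1 N && Nat.blt mv.2.2.2 N))))) false
      (cond mv.1
        (cond (blockCanSubdivide mv.2.2.2 C) (r (blockSubdivide mv.2.1 mv.2.2.1 mv.2.2.2 C)) false)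
        (cond (blockCanWeld mv.2.1 mv.2.2.1 mv.2.2.2 C)
          (r (blockWeld mv.2.1 mv.2.2.1 mv.2.2.2 C)) false)))
    ms C

lemma realization_homeomorph_of_runMoves {N : ℕ} {L' : List ℕ} (ms : List Move) (C : List Block)
    (hC : IsCover C) (h : runMoves N L' ms C = true) :
    Nonempty (Realization (maskComplex N (flatten C)) ≃ₜ Realization (maskComplex N L')) := by
  induction ms generalizing C with
  | nil =>
    have h' : cond (allL (fun t => memL t L') (flatten C))
      (allL (fun t => memL t (flatten C)) L') false = true := h
    cases h1 : allL (fun t => memL t L') (flatten C)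
    · simp [h1] at h'
    · rw [h1, cond_true] at h'
      have : maskComplex N (flatten C) = maskComplex N L' := by
        ext T
        constructor
        · rintro ⟨t, ht, rfl⟩
          exact ⟨t, memL_iff.1 (allL_iff.1 h1 t ht), rfl⟩
        · rintro ⟨t, ht, rfl⟩
          exact ⟨t, memL_iff.1 (allL_iff.1 h' t ht), rfl⟩
      rw [this]
      exact ⟨Homeomorph.refl _⟩
  | cons mv ms ih =>
    obtain ⟨s, a, b, m⟩ := mv
    have h' : cond (cond (Nat.beq a b) true (cond (Nat.beq a m) true (cond (Nat.beq b m) true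
        (!(Nat.blt a N && Nat.blt b N && Nat.blt m N))))) false
      (cond s (cond (blockCanSubdivide m C) (runMoves N L' ms (blockSubdivide a b m C)) false)
        (cond (blockCanWeld a b m C) (runMoves N L' ms (blockWeld a b m C)) false)) = true := h
    have hlt : ∀ x, Nat.blt x N = true ↔ x < N := by simp [Nat.blt_eq]
    cases hab : Nat.beq a b
    swap
    · simp [hab] at h'
    cases ham : Nat.beq a m
    swap
    · simp [ham] at h'
    cases hbm : Nat.beq b m
    swap
    · simp [hbm] at h'
    cases hN : (Nat.blt a N && Nat.blt b N && Nat.blt m N)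
    · simp [hN] at h'
    simp only [hab, ham, hbm, hN, cond_false, Bool.not_true] at h'
    simp only [Bool.and_eq_true, hlt] at hN
    obtain ⟨⟨haN, hbN⟩, hmN⟩ := hN
    have hab' : (⟨a, haN⟩ : Fin N) ≠ ⟨b, hbN⟩ := by
      intro h; simp at h; subst h; simp at hab
    have ham' : (⟨a, haN⟩ : Fin N) ≠ ⟨m, hmN⟩ := by
      intro h; simp at h; subst h; simp at ham
    have hbm' : (⟨b, hbN⟩ : Fin N) ≠ ⟨m, hmN⟩ := by
      intro h; simp at h; subst h; simp at hbm
    cases s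
    · cases hc : blockCanWeld a b m C
      · simp [hc] at h'
      · rw [hc] at h'
        obtain ⟨e⟩ := ih _ hC.blockWeld h'
        rw [flatten_blockWeld hC] at e
        exact ⟨(isStellar_weld hab' ham' hbm' (canWeld_flatten hC hc)).homeomorph.symm.trans e⟩
    · cases hc : blockCanSubdivide m C
      · simp [hc] at h'
      · rw [hc] at h'
        obtain ⟨e⟩ := ih _ hC.blockSubdivide h'
        rw [flatten_blockSubdivide hC] at e
        exact ⟨(isStellar_subdivide hab' ham' hbm' (canSubdivide_flatten hC hc)).homeomorph.trans e⟩

/-! ### A triangulation of the Klein bottle -/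

/-- The vertices of the `3 × 3` grid on the square. -/
abbrev GridPoint := Fin 4 × Fin 4

/-- The triangles of the grid: each of the nine squares is cut along its diagonal from the lower
left to the upper right corner. -/
abbrev GridTriangle := (Fin 3 × Fin 3) × Bool

/-- The vertices of a triangle of the grid. -/
def GridTriangle.vertex (τ : GridTriangle) : Fin 3 → GridPoint :=
  ![(τ.1.1.castSucc, τ.1.2.castSucc),
    if τ.2 then (τ.1.1.castSucc, τ.1.2.succ) else (τ.1.1.succ, τ.1.2.castSucc),
    (τ.1.1.succ, τ.1.2.succ)]

/-- Two grid points have the same label iff they are the same point of the Klein bottle. -/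
def gridLabel (a : GridPoint) : Fin 9 :=
  if a.2 = 3 then Fin.ofNat 9 ((3 - a.1.val) % 3) else Fin.ofNat 9 (a.1.val % 3 + 3 * a.2.val)

/-- The piecewise linear function that is `1` at the origin and `0` at all other lattice points. -/
def hat (u v : ℝ) : ℝ := max 0 (1 - max (max |u| |v|) |u - v|)

/-- The piecewise linear map of the square `[0, 3]²` to the space of barycentric coordinates of the
quotient triangulation. -/
def gridMap {ι : Type*} [DecidableEq ι] (q : Fin 9 → ι) (x y : ℝ) : ι → ℝ :=
  ∑ a : GridPoint, hat (x - a.1.val) (y - a.2.val) • Pi.single (q (gridLabel a)) 1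

/-- The triangles of the quotient triangulation. -/
def kleinComplex {ι : Type*} (q : Fin 9 → ι) : Set (Set ι) :=
  {T | ∃ τ : GridTriangle, T = Set.range fun k => q (gridLabel (τ.vertex k))}

lemma hat_eq_zero {u v : ℝ} (h : 1 ≤ |u| ∨ 1 ≤ |v| ∨ 1 ≤ |u - v|) : hat u v = 0 := by
  rw [hat, max_eq_left]
  rcases h with h | h | h
  · linarith [le_max_left (max |u| |v|) |u - v|, le_max_left |u| |v|]
  · linarith [le_max_left (max |u| |v|) |u - v|, le_max_right |u| |v|]
  · linarith [le_max_right (max |u| |v|) |u - v|]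

lemma hat_eq {u v t : ℝ} (ht : 0 ≤ t) (hu : -(1 - t) ≤ u ∧ u ≤ 1 - t)
    (hv : -(1 - t) ≤ v ∧ v ≤ 1 - t) (huv : -(1 - t) ≤ u - v ∧ u - v ≤ 1 - t)
    (hm : 1 - t ≤ u ∨ 1 - t ≤ -v ∨ 1 - t ≤ v ∨ 1 - t ≤ -(u - v) ∨ 1 - t ≤ u - v ∨ 1 - t ≤ -u) :
    hat u v = t := by
  have : max (max |u| |v|) |u - v| = 1 - t := by
    refine le_antisymm (max_le (max_le (abs_le.2 hu) (abs_le.2 hv)) (abs_le.2 huv)) ?_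
    rcases hm with h | h | h | h | h | h
    · exact (h.trans (le_abs_self _)).trans (le_max_of_le_left (le_max_left _ _))
    · exact (h.trans (neg_le_abs _)).trans (le_max_of_le_left (le_max_right _ _))
    · exact (h.trans (le_abs_self _)).trans (le_max_of_le_left (le_max_right _ _))
    · exact (h.trans (neg_le_abs _)).trans (le_max_right _ _)
    · exact (h.trans (le_abs_self _)).trans (le_max_right _ _)
    · exact (h.trans (neg_le_abs _)).trans (le_max_of_le_left (le_max_left _ _))
  rw [hat, this, max_eq_right] <;> linarith

lemma hat_neg (u v : ℝ) : hat (-u) (-v) = hat u v := by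
  have : -u - -v = -(u - v) := by ring
  simp only [hat, abs_neg, this]

lemma one_le_abs_sub_natCast {t : ℝ} {i d : ℕ} (h0 : i ≤ t) (h1 : t ≤ i + 1) (hi : d ≠ i)
    (hi' : d ≠ i + 1) : 1 ≤ |t - d| := by
  rcases Nat.lt_or_gt_of_ne hi with h | h
  · have : (d : ℝ) + 1 ≤ i := by exact_mod_cast h
    exact le_abs.2 (Or.inl (by linarith))
  · have : (i : ℝ) + 2 ≤ d := by exact_mod_cast (show i + 2 ≤ d by omega)
    exact le_abs.2 (Or.inr (by linarith))

/-- The hat functions restrict to the barycentric coordinates on each triangle. -/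
lemma hat_sub_vertex (τ : GridTriangle) (w : Fin 3 → ℝ) (hw : ∀ k, 0 ≤ w k) (h1 : ∑ k, w k = 1)
    (a : GridPoint) :
    hat ((∑ k, w k * (τ.vertex k).1.val) - a.1.val) ((∑ k, w k * (τ.vertex k).2.val) - a.2.val) =
      ∑ k, if τ.vertex k = a then w k else 0 := by
  obtain ⟨⟨⟨i, hi⟩, ⟨j, hj⟩⟩, s⟩ := τ
  obtain ⟨⟨c, hc⟩, ⟨d, hd⟩⟩ := a
  have w0 := hw 0
  have w1 := hw 1
  have w2 := hw 2
  rw [Fin.sum_univ_three] at h1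
  have h0 : w 0 = 1 - w 1 - w 2 := by linarith
  cases s
  · simp only [Fin.sum_univ_three, GridTriangle.vertex, Matrix.cons_val_zero, Matrix.cons_val_one,
      Matrix.cons_val, Fin.castSucc_mk, Fin.succ_mk, Bool.false_eq_true, if_false, Prod.mk.injEq,
      Fin.mk.injEq, Nat.cast_add, Nat.cast_one]
    have hx : w 0 * i + w 1 * (i + 1) + w 2 * (i + 1) = i + (w 1 + w 2) := by rw [h0]; ring
    have hy : w 0 * j + w 1 * j + w 2 * (j + 1) = j + w 2 := by rw [h0]; ring
    rw [hx, hy]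
    by_cases c0 : i = c
    · subst c0
      by_cases d0 : j = d
      · subst d0
        rw [hat_eq w0 (by constructor <;> linarith)
          (by constructor <;> linarith) (by constructor <;> linarith)
          (Or.inl (by linarith))]
        simp
      · by_cases d1 : j + 1 = d
        · subst d1
          rw [hat_eq_zero (Or.inr (Or.inr (le_abs.2 (Or.inl (by push_cast; linarith)))))]
          simp
        · rw [hat_eq_zero (Or.inr (Or.inl (one_le_abs_sub_natCast (by linarith) (by linarith)
            (Ne.symm d0) (Ne.symm d1))))]
          simp [d0]
    · by_cases c1 : i + 1 = c
      · subst c1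
        by_cases d0 : j = d
        · subst d0
          rw [hat_eq w1 (by constructor <;> push_cast <;> linarith)
            (by constructor <;> linarith) (by constructor <;> push_cast <;> linarith)
            (Or.inr (Or.inr (Or.inr (Or.inl (by push_cast; linarith)))))]
          simp
        · by_cases d1 : j + 1 = d
          · subst d1
            rw [hat_eq w2 (by constructor <;> push_cast <;> linarith)
              (by constructor <;> push_cast <;> linarith) (by constructor <;> push_cast <;> linarith)
              (Or.inr (Or.inl (by push_cast; linarith)))]
            simp
          · rw [hat_eq_zero (Or.inr (Or.inl (one_le_abs_sub_natCast (by linarith) (by linarith)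
              (Ne.symm d0) (Ne.symm d1))))]
            simp [d0, d1]
      · rw [hat_eq_zero (Or.inl (one_le_abs_sub_natCast (by linarith) (by linarith)
          (Ne.symm c0) (Ne.symm c1)))]
        simp [c0, c1]
  · simp only [Fin.sum_univ_three, GridTriangle.vertex, Matrix.cons_val_zero, Matrix.cons_val_one,
      Matrix.cons_val, Fin.castSucc_mk, Fin.succ_mk, if_true, Prod.mk.injEq,
      Fin.mk.injEq, Nat.cast_add, Nat.cast_one]
    have hx : w 0 * i + w 1 * i + w 2 * (i + 1) = i + w 2 := by rw [h0]; ring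
    have hy : w 0 * j + w 1 * (j + 1) + w 2 * (j + 1) = j + (w 1 + w 2) := by rw [h0]; ring
    rw [hx, hy]
    by_cases d0 : j = d
    · subst d0
      by_cases c0 : i = c
      · subst c0
        rw [hat_eq w0 (by constructor <;> linarith)
          (by constructor <;> linarith) (by constructor <;> linarith)
          (Or.inr (Or.inr (Or.inl (by linarith))))]
        simp
      · by_cases c1 : i + 1 = c
        · subst c1
          rw [hat_eq_zero (Or.inr (Or.inr (le_abs.2 (Or.inr (by push_cast; linarith)))))]
          simp
        · rw [hat_eq_zero (Or.inl (one_le_abs_sub_natCast (by linarith) (by linarith)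
            (Ne.symm c0) (Ne.symm c1)))]
          simp [c0]
    · by_cases d1 : j + 1 = d
      · subst d1
        by_cases c0 : i = c
        · subst c0
          rw [hat_eq w1 (by constructor <;> linarith)
            (by constructor <;> push_cast <;> linarith) (by constructor <;> push_cast <;> linarith)
            (Or.inr (Or.inr (Or.inr (Or.inr (Or.inl (by push_cast; linarith))))))]
          simp
        · by_cases c1 : i + 1 = c
          · subst c1
            rw [hat_eq w2 (by constructor <;> push_cast <;> linarith)
              (by constructor <;> push_cast <;> linarith) (by constructor <;> push_cast <;> linarith)
              (Or.inr (Or.inr (Or.inr (Or.inr (Or.inr (by push_cast; linarith))))))]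
            simp
          · rw [hat_eq_zero (Or.inl (one_le_abs_sub_natCast (by linarith) (by linarith)
              (Ne.symm c0) (Ne.symm c1)))]
            simp [c0, c1]
      · rw [hat_eq_zero (Or.inr (Or.inl (one_le_abs_sub_natCast (by linarith) (by linarith)
          (Ne.symm d0) (Ne.symm d1))))]
        simp [d0, d1]

/-- Every point of the square lies in a triangle. -/
lemma exists_gridTriangle {x y : ℝ} (hx : x ∈ Set.Icc (0 : ℝ) 3) (hy : y ∈ Set.Icc (0 : ℝ) 3) :
    ∃ (τ : GridTriangle) (w : Fin 3 → ℝ), (∀ k, 0 ≤ w k) ∧ ∑ k, w k = 1 ∧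
      x = ∑ k, w k * (τ.vertex k).1.val ∧ y = ∑ k, w k * (τ.vertex k).2.val := by
  have hfl : ∀ t : ℝ, t ∈ Set.Icc (0 : ℝ) 3 →
      ∃ i : Fin 3, (i.val : ℝ) ≤ t ∧ t ≤ i.val + 1 := by
    rintro t ⟨h0, h3⟩
    rcases le_total t 1 with h | h
    · exact ⟨0, by simpa using h0, by simpa using h⟩
    rcases le_total t 2 with h' | h'
    · exact ⟨1, by simpa using h, by norm_num; linarith⟩
    · exact ⟨2, by simpa using h', by norm_num; linarith⟩
  obtain ⟨i, hi, hi'⟩ := hfl x hx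
  obtain ⟨j, hj, hj'⟩ := hfl y hy
  rcases le_total (y - j.val) (x - i.val) with h | h
  · refine ⟨((i, j), false), ![1 - (x - i.val), (x - i.val) - (y - j.val), y - j.val], ?_, ?_, ?_, ?_⟩
    · intro k
      fin_cases k <;> simp <;> linarith
    · simp [Fin.sum_univ_three]
    · simp [Fin.sum_univ_three, GridTriangle.vertex]; ring
    · simp [Fin.sum_univ_three, GridTriangle.vertex]; ring
  · refine ⟨((i, j), true), ![1 - (y - j.val), (y - j.val) - (x - i.val), x - i.val], ?_, ?_, ?_, ?_⟩
    · intro k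
      fin_cases k <;> simp <;> linarith
    · simp [Fin.sum_univ_three]
    · simp [Fin.sum_univ_three, GridTriangle.vertex]; ring
    · simp [Fin.sum_univ_three, GridTriangle.vertex]; ring

lemma gridLabel_vertex_injective (τ : GridTriangle) :
    Function.Injective fun k => gridLabel (τ.vertex k) := by
  revert τ
  decide +kernel

/-- An identification of boundary points of the square `[0, 3]²`, as a list of equations
`e.1 * x + e.2.1 * y + e.2.2.1 * x' + e.2.2.2.1 * y' = e.2.2.2.2`. -/
abbrev Identification := List (ℤ × ℤ × ℤ × ℤ × ℤ)

/-- The identity, the side identifications and their inverses, and the compositions that exchange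
corners. -/
def identifications : List Identification :=
  [[(1, 0, -1, 0, 0), (0, 1, 0, -1, 0)],
   [(1, 0, 0, 0, 0), (0, 0, 1, 0, 3), (0, 1, 0, -1, 0)],
   [(1, 0, 0, 0, 3), (0, 0, 1, 0, 0), (0, 1, 0, -1, 0)],
   [(0, 1, 0, 0, 0), (0, 0, 0, 1, 3), (1, 0, 1, 0, 3)],
   [(0, 1, 0, 0, 3), (0, 0, 0, 1, 0), (1, 0, 1, 0, 3)],
   [(1, 0, 0, 0, 0), (0, 1, 0, 0, 0), (0, 0, 1, 0, 0), (0, 0, 0, 1, 3)],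
   [(1, 0, 0, 0, 0), (0, 1, 0, 0, 3), (0, 0, 1, 0, 0), (0, 0, 0, 1, 0)],
   [(1, 0, 0, 0, 3), (0, 1, 0, 0, 0), (0, 0, 1, 0, 3), (0, 0, 0, 1, 3)],
   [(1, 0, 0, 0, 3), (0, 1, 0, 0, 3), (0, 0, 1, 0, 3), (0, 0, 0, 1, 0)]]

/-- The vertices that two triangles have in common in the quotient are matched by one of the
identifications. -/
lemma exists_identification : ∀ τ τ' : GridTriangle, ∃ m ∈ identifications, ∀ k k' : Fin 3,
    gridLabel (τ.vertex k) = gridLabel (τ'.vertex k') → ∀ e ∈ m,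
      e.1 * (τ.vertex k).1.val + e.2.1 * (τ.vertex k).2.val + e.2.2.1 * (τ'.vertex k').1.val +
        e.2.2.2.1 * (τ'.vertex k').2.val = e.2.2.2.2 := by
  decide +kernel

section Klein

variable {ι : Type*} [DecidableEq ι] {q : Fin 9 → ι}

/-- On each triangle of the grid, `gridMap` is the affine map to the simplex of its labels. -/
lemma gridMap_vertex (τ : GridTriangle) (w : Fin 3 → ℝ) (hw : ∀ k, 0 ≤ w k) (h1 : ∑ k, w k = 1) :
    gridMap q (∑ k, w k * (τ.vertex k).1.val) (∑ k, w k * (τ.vertex k).2.val) =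
      ∑ k, w k • Pi.single (q (gridLabel (τ.vertex k))) 1 := by
  simp only [gridMap, hat_sub_vertex τ w hw h1, Finset.sum_smul]
  rw [Finset.sum_comm]
  refine Finset.sum_congr rfl fun k _ => ?_
  rw [Finset.sum_eq_single (τ.vertex k)]
  · simp
  · intro a _ ha
    simp [ha.symm]
  · simp

lemma continuous_gridMap : Continuous fun p : ℝ × ℝ => gridMap q p.1 p.2 := by
  unfold gridMap hat
  fun_prop

/-- The map respects the identification of the vertical sides. -/
lemma gridMap_left (y : ℝ) : gridMap q 0 y = gridMap q 3 y := by
  have h0 : ∀ u v : ℝ, 1 ≤ |u| → hat u v = 0 := fun u v h => hat_eq_zero (Or.inl h)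
  simp only [gridMap, Fintype.sum_prod_type, Fin.sum_univ_four (f := fun i : Fin 4 => ∑ j, _)]
  have e1 : ∀ j : Fin 4, gridLabel (0, j) = gridLabel (3, j) := by decide +kernel
  simp only [e1]
  norm_num [h0]

/-- The map respects the identification of the horizontal sides. -/
lemma gridMap_bottom (x : ℝ) : gridMap q x 0 = gridMap q (3 - x) 3 := by
  have h0 : ∀ u v : ℝ, 1 ≤ |v| → hat u v = 0 := fun u v h => hat_eq_zero (Or.inr (Or.inl h))
  simp only [gridMap, Fintype.sum_prod_type_right,
    Fin.sum_univ_four (f := fun j : Fin 4 => ∑ i, _)]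
  have e1 : ∀ i : Fin 4, gridLabel (i.rev, 3) = gridLabel (i, 0) := by decide +kernel
  have e2 : ∑ i : Fin 4, hat (3 - x - (i.val : ℝ)) 0 •
      (Pi.single (q (gridLabel (i, 3))) 1 : ι → ℝ) =
      ∑ i : Fin 4, hat (x - (i.val : ℝ)) 0 • Pi.single (q (gridLabel (i, 0))) 1 := by
    rw [← Equiv.sum_comp Fin.revPerm]
    refine Finset.sum_congr rfl fun i _ => ?_
    have hi : ((Fin.rev i).val : ℝ) = 3 - i.val := by
      rw [Fin.val_rev]
      have := i.2
      rw [Nat.cast_sub (by omega)]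
      push_cast
      ring
    rw [Fin.revPerm_apply, e1, hi, ← hat_neg]
    congr 2 <;> ring
  norm_num [h0]
  exact e2.symm

/-- If two convex combinations of unit vectors agree, then so do the combinations of real numbers
with the same coefficients, provided that the numbers agree for equal labels. -/
lemma sum_eq_of_match {L L' : Fin 3 → ι} (hL : Function.Injective L) (hL' : Function.Injective L')
    {w w' : Fin 3 → ℝ}
    (h : ∑ k, w k • (Pi.single (L k) 1 : ι → ℝ) = ∑ k, w' k • Pi.single (L' k) 1)
    {φ ψ : Fin 3 → ℝ} (hφ : ∀ k k', L k = L' k' → φ k = ψ k') :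
    ∑ k, w k * φ k = ∑ k, w' k * ψ k := by
  have hw : ∀ k, w k = ∑ k', if L k = L' k' then w' k' else 0 := by
    intro k
    have := congrFun h (L k)
    simp only [Finset.sum_apply, Pi.smul_apply, Pi.single_apply, smul_eq_mul, mul_ite, mul_one,
      mul_zero, hL.eq_iff, Finset.sum_ite_eq, Finset.mem_univ, if_true] at this
    exact this
  have hw' : ∀ k', w' k' = ∑ k, if L k = L' k' then w k else 0 := by
    intro k'
    have := congrFun h (L' k')
    simp only [Finset.sum_apply, Pi.smul_apply, Pi.single_apply, smul_eq_mul, mul_ite, mul_one,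
      mul_zero, hL'.eq_iff, Finset.sum_ite_eq, Finset.mem_univ, if_true] at this
    rw [← this]
    exact Finset.sum_congr rfl fun k _ => by simp only [eq_comm]
  have hm : ∀ k k', L k = L' k' → w k = w' k' := by
    intro k k' hk
    rw [hw k, Finset.sum_eq_single k']
    · simp [hk]
    · intro b _ hb
      rw [if_neg]
      intro hb'
      exact hb (hL' (hb'.symm.trans hk))
    · simp
  calc ∑ k, w k * φ k = ∑ k, ∑ k', if L k = L' k' then w' k' * φ k else 0 := by
        refine Finset.sum_congr rfl fun k _ => ?_
        conv_lhs => rw [hw k, Finset.sum_mul]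
        exact Finset.sum_congr rfl fun k' _ => by split_ifs <;> simp
    _ = ∑ k, ∑ k', if L k = L' k' then w k * ψ k' else 0 := by
        refine Finset.sum_congr rfl fun k _ => Finset.sum_congr rfl fun k' _ => ?_
        split_ifs with h
        · rw [hm k k' h, hφ k k' h]
        · rfl
    _ = ∑ k', ∑ k, if L k = L' k' then w k * ψ k' else 0 := Finset.sum_comm
    _ = ∑ k, w' k * ψ k := by
        refine Finset.sum_congr rfl fun k' _ => ?_
        conv_rhs => rw [hw' k', Finset.sum_mul]
        exact Finset.sum_congr rfl fun k _ => by split_ifs <;> simp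

/-- Points of the square with the same image are identified in the Klein bottle. -/
lemma eqvGen_of_gridMap_eq (hq : Function.Injective q) {s s' : unitInterval × unitInterval}
    (h : gridMap q (3 * s.1) (3 * s.2) = gridMap q (3 * s'.1) (3 * s'.2)) :
    Relation.EqvGen KleinRel s s' := by
  have hI : ∀ t : unitInterval, (3 * t : ℝ) ∈ Set.Icc (0 : ℝ) 3 := fun t =>
    ⟨by linarith [t.2.1], by linarith [t.2.2]⟩
  obtain ⟨τ, w, hw, hw1, hx, hy⟩ := exists_gridTriangle (hI s.1) (hI s.2)
  obtain ⟨τ', w', hw', hw1', hx', hy'⟩ := exists_gridTriangle (hI s'.1) (hI s'.2)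
  rw [hx, hy, hx', hy', gridMap_vertex τ w hw hw1, gridMap_vertex τ' w' hw' hw1'] at h
  obtain ⟨m, hm, hmatch⟩ := exists_identification τ τ'
  have key : ∀ e ∈ m, (e.1 : ℝ) * (3 * s.1) + e.2.1 * (3 * s.2) + e.2.2.1 * (3 * s'.1) +
      e.2.2.2.1 * (3 * s'.2) = e.2.2.2.2 := by
    intro e he
    have := sum_eq_of_match (hq.comp (gridLabel_vertex_injective τ))
      (hq.comp (gridLabel_vertex_injective τ')) h
      (φ := fun k => (e.1 : ℝ) * (τ.vertex k).1.val + e.2.1 * (τ.vertex k).2.val - e.2.2.2.2)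
      (ψ := fun k => -(e.2.2.1 * (τ'.vertex k).1.val + e.2.2.2.1 * (τ'.vertex k).2.val : ℝ))
      (fun k k' hk => by
        have := hmatch k k' (hq hk) e he
        have h2 : (e.1 : ℝ) * (τ.vertex k).1.val + e.2.1 * (τ.vertex k).2.val +
          e.2.2.1 * (τ'.vertex k').1.val + e.2.2.2.1 * (τ'.vertex k').2.val = e.2.2.2.2 := by
          exact_mod_cast this
        linarith)
    rw [hx, hy, hx', hy']
    simp only [Fin.sum_univ_three] at this hw1 hw1' ⊢
    linear_combination this + (e.2.2.2.2 : ℝ) * hw1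
  have ext : ∀ {x y : unitInterval}, (x : ℝ) = y → x = y := fun h => Subtype.ext h
  have e0 : ∀ {x : unitInterval}, (x : ℝ) = 0 → x = 0 := fun h => Subtype.ext h
  have e1 : ∀ {x : unitInterval}, (x : ℝ) = 1 → x = 1 := fun h => Subtype.ext h
  obtain ⟨x, y⟩ := s
  obtain ⟨x', y'⟩ := s'
  have hstr : ∀ t, Relation.EqvGen KleinRel (0, t) (1, t) := fun t => .rel _ _ (.straight t)
  have hrev : ∀ t, Relation.EqvGen KleinRel (t, 0) (unitInterval.symm t, 1) :=
    fun t => .rel _ _ (.reversed t)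
  have hs0 : unitInterval.symm 0 = 1 := unitInterval.symm_zero
  have hs1 : unitInterval.symm 1 = 0 := unitInterval.symm_one
  simp only [identifications, List.mem_cons, List.not_mem_nil, or_false] at hm
  rcases hm with rfl | rfl | rfl | rfl | rfl | rfl | rfl | rfl | rfl <;>
    simp only [List.mem_cons, List.not_mem_nil, or_false, forall_eq_or_imp, forall_eq] at key <;>
    push_cast at key
  · have h1 : x = x' := ext (by linarith [key.1])
    have h2 : y = y' := ext (by linarith [key.2])
    rw [h1, h2]; exact .refl _
  · have h1 : x = 0 := e0 (by linarith [key.1])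
    have h2 : x' = 1 := e1 (by linarith [key.2.1])
    have h3 : y = y' := ext (by linarith [key.2.2])
    rw [h1, h2, h3]; exact hstr _
  · have h1 : x = 1 := e1 (by linarith [key.1])
    have h2 : x' = 0 := e0 (by linarith [key.2.1])
    have h3 : y = y' := ext (by linarith [key.2.2])
    rw [h1, h2, h3]; exact (hstr _).symm _ _
  · have h1 : y = 0 := e0 (by linarith [key.1])
    have h2 : y' = 1 := e1 (by linarith [key.2.1])
    have h3 : x' = unitInterval.symm x := ext (by rw [unitInterval.coe_symm_eq]; linarith [key.2.2])
    rw [h1, h2, h3]; exact hrev _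
  · have h1 : y = 1 := e1 (by linarith [key.1])
    have h2 : y' = 0 := e0 (by linarith [key.2.1])
    have h3 : x = unitInterval.symm x' := ext (by rw [unitInterval.coe_symm_eq]; linarith [key.2.2])
    rw [h1, h2, h3]; exact (hrev _).symm _ _
  · have h1 : x = 0 := e0 (by linarith [key.1])
    have h2 : y = 0 := e0 (by linarith [key.2.1])
    have h3 : x' = 0 := e0 (by linarith [key.2.2.1])
    have h4 : y' = 1 := e1 (by linarith [key.2.2.2])
    rw [h1, h2, h3, h4]
    have := hrev 1
    rw [hs1] at this
    exact (hstr 0).trans _ _ _ this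
  · have h1 : x = 0 := e0 (by linarith [key.1])
    have h2 : y = 1 := e1 (by linarith [key.2.1])
    have h3 : x' = 0 := e0 (by linarith [key.2.2.1])
    have h4 : y' = 0 := e0 (by linarith [key.2.2.2])
    rw [h1, h2, h3, h4]
    have := hrev 1
    rw [hs1] at this
    exact ((hstr 0).trans _ _ _ this).symm _ _
  · have h1 : x = 1 := e1 (by linarith [key.1])
    have h2 : y = 0 := e0 (by linarith [key.2.1])
    have h3 : x' = 1 := e1 (by linarith [key.2.2.1])
    have h4 : y' = 1 := e1 (by linarith [key.2.2.2])
    rw [h1, h2, h3, h4]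
    have := hrev 0
    rw [hs0] at this
    exact ((hstr 0).symm _ _).trans _ _ _ this
  · have h1 : x = 1 := e1 (by linarith [key.1])
    have h2 : y = 1 := e1 (by linarith [key.2.1])
    have h3 : x' = 1 := e1 (by linarith [key.2.2.1])
    have h4 : y' = 0 := e0 (by linarith [key.2.2.2])
    rw [h1, h2, h3, h4]
    have := hrev 0
    rw [hs0] at this
    exact (((hstr 0).symm _ _).trans _ _ _ this).symm _ _

variable [Fintype ι]

/-- The realization of the quotient triangulation is the Klein bottle: the piecewise linear map of
the square induces a continuous bijection from a compact space to a Hausdorff space. -/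
lemma kleinBottle_homeomorph (hq : Function.Injective q) :
    Nonempty (Realization (kleinComplex q) ≃ₜ KleinBottle) := by
  have hI : ∀ t : unitInterval, (3 * t : ℝ) ∈ Set.Icc (0 : ℝ) 3 := fun t =>
    ⟨by linarith [t.2.1], by linarith [t.2.2]⟩
  have hmem : ∀ s : unitInterval × unitInterval,
      (∀ i, 0 ≤ gridMap q (3 * s.1) (3 * s.2) i) ∧ ∑ i, gridMap q (3 * s.1) (3 * s.2) i = 1 ∧
      ∃ T ∈ kleinComplex q, Function.support (gridMap q (3 * s.1) (3 * s.2)) ⊆ T := by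
    intro s
    obtain ⟨τ, w, hw, hw1, hx, hy⟩ := exists_gridTriangle (hI s.1) (hI s.2)
    rw [hx, hy, gridMap_vertex τ w hw hw1]
    refine ⟨fun i => ?_, ?_, _, ⟨τ, rfl⟩, fun i hi => ?_⟩
    · simp only [Finset.sum_apply, Pi.smul_apply, Pi.single_apply, smul_eq_mul]
      exact Finset.sum_nonneg fun k _ => mul_nonneg (hw k) (by split_ifs <;> norm_num)
    · simp only [Finset.sum_apply, Pi.smul_apply, smul_eq_mul]
      rw [Finset.sum_comm]
      simp only [← Finset.mul_sum]
      simpa using hw1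
    · by_contra hne
      refine hi ?_
      simp only [Set.mem_range, not_exists] at hne
      simp [Finset.sum_apply, fun k => Ne.symm (hne k)]
  let g : unitInterval × unitInterval → Realization (kleinComplex q) :=
    fun s => ⟨gridMap q (3 * s.1) (3 * s.2), hmem s⟩
  have hg : Continuous g := by
    refine Continuous.subtype_mk ?_ _
    exact continuous_gridMap.comp
      (f := fun s : unitInterval × unitInterval => ((3 * s.1 : ℝ), (3 * s.2 : ℝ))) (by fun_prop)
  have hrel : ∀ s s', KleinRel s s' → g s = g s' := by
    rintro _ _ (t | t) <;> apply Subtype.ext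
    · simpa [g] using gridMap_left (q := q) (3 * t)
    · simpa [g, mul_sub] using gridMap_bottom (q := q) (3 * t)
  let G : KleinBottle → Realization (kleinComplex q) := Quot.lift g hrel
  have hG : Continuous G := continuous_quot_lift hrel hg
  have hinj : Function.Injective G := by
    rintro ⟨s⟩ ⟨s'⟩ h
    exact Quot.eqvGen_sound (eqvGen_of_gridMap_eq hq (congrArg Subtype.val h))
  have hsurj : Function.Surjective G := by
    rintro ⟨f, hf0, hf1, _, ⟨τ, rfl⟩, hsupp⟩
    set L : Fin 3 → ι := fun k => q (gridLabel (τ.vertex k)) with hL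
    have hLi : Function.Injective L := hq.comp (gridLabel_vertex_injective τ)
    have hf : f = ∑ k, f (L k) • Pi.single (L k) 1 := by
      ext i
      simp only [Finset.sum_apply, Pi.smul_apply, Pi.single_apply, smul_eq_mul, mul_ite, mul_one,
        mul_zero]
      by_cases hi : i ∈ Set.range L
      · obtain ⟨k, rfl⟩ := hi
        simp [hLi.eq_iff]
      · have h0 : f i = 0 := by by_contra hne; exact hi (hsupp hne)
        rw [h0, Finset.sum_eq_zero]
        intro k _
        rw [if_neg]
        rintro rfl
        exact hi ⟨k, rfl⟩
    have hsum : ∑ k, f (L k) = 1 := by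
      rw [← hf1]
      conv_rhs => rw [hf]
      simp only [Finset.sum_apply, Pi.smul_apply, smul_eq_mul]
      rw [Finset.sum_comm]
      simp only [← Finset.mul_sum]
      simp
    have hb : ∀ c : Fin 3 → Fin 4, (∑ k, f (L k) * (c k).val) / 3 ∈ unitInterval := by
      intro c
      constructor
      · exact div_nonneg (Finset.sum_nonneg fun k _ => mul_nonneg (hf0 _) (by positivity))
          (by norm_num)
      · rw [div_le_one (by norm_num)]
        calc ∑ k, f (L k) * ((c k).val : ℝ) ≤ ∑ k, f (L k) * 3 := by
              refine Finset.sum_le_sum fun k _ => mul_le_mul_of_nonneg_left ?_ (hf0 _)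
              exact_mod_cast Nat.le_of_lt_succ (c k).2
          _ = 3 := by rw [← Finset.sum_mul, hsum, one_mul]
    refine ⟨Quot.mk _ (⟨_, hb fun k => (τ.vertex k).1⟩, ⟨_, hb fun k => (τ.vertex k).2⟩), ?_⟩
    apply Subtype.ext
    change gridMap q (3 * ((∑ k, f (L k) * ((τ.vertex k).1.val : ℝ)) / 3))
      (3 * ((∑ k, f (L k) * ((τ.vertex k).2.val : ℝ)) / 3)) = f
    rw [mul_div_cancel₀ _ (by norm_num), mul_div_cancel₀ _ (by norm_num),
      gridMap_vertex τ (fun k => f (L k)) (fun k => hf0 _) hsum]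
    exact hf.symm
  have hcompact : CompactSpace KleinBottle := Quot.compactSpace
  exact ⟨(hG.homeoOfEquivCompactToT2 (f := Equiv.ofBijective G ⟨hinj, hsurj⟩)).symm⟩

end Klein

/-! ### The polytope -/

/-- The vertices `(x, y, z)` of a cubical ball in `ℝ³`, with their heights `h`. -/
def ballPoint : List (ℤ × ℤ × ℤ × ℤ) :=
  [(180, 180, 0, 225), (120, 120, 225, 120), (180, -180, 0, 225), (80, 20, 375, 50),
   (-180, -180, 0, 225), (36, 36, 405, 36), (-180, 180, 0, 225), (20, 80, 375, 50),
   (-120, 120, 240, 105), (6, 78, 387, 42), (-72, 96, 336, 57), (-6, 78, 393, 36),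
   (-30, -30, 420, 15), (15, 15, 435, 15), (96, -72, 336, 57), (78, -6, 393, 36),
   (120, -120, 240, 105), (78, 6, 387, 42), (-120, -120, 240, 105), (30, 30, 415, 30),
   (120, -120, -225, 120), (80, -20, -375, 50), (36, -36, -405, 36), (20, -80, -375, 50),
   (-120, -120, -240, 105), (6, -78, -387, 42), (-72, -96, -336, 57), (-6, -78, -393, 36),
   (-30, 30, -420, 15), (15, -15, -435, 15), (96, 72, -336, 57), (78, 6, -393, 36),
   (120, 120, -240, 105), (78, -6, -387, 42), (-120, 120, -240, 105), (30, -30, -415, 30)]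

/-- The cells of the ball. The list of the vertices of a cube is always ordered by the binary
expansion of the position, so that positions which differ in one binary digit are adjacent. -/
def ballCell : List (List ℕ) :=
  [[0, 2, 1, 3, 6, 4, 7, 5], [0, 6, 1, 7, 10, 8, 11, 9], [0, 14, 1, 15, 2, 16, 3, 17],
   [18, 4, 8, 6, 19, 5, 9, 7], [18, 8, 12, 10, 19, 9, 13, 11], [18, 12, 16, 14, 19, 13, 17, 15],
   [18, 16, 4, 2, 19, 17, 5, 3], [2, 0, 20, 21, 4, 6, 23, 22], [2, 4, 20, 23, 26, 24, 27, 25],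
   [2, 30, 20, 31, 0, 32, 21, 33], [34, 6, 24, 4, 35, 22, 25, 23],
   [34, 24, 28, 26, 35, 25, 29, 27], [34, 28, 32, 30, 35, 29, 33, 31],
   [34, 32, 6, 0, 35, 33, 22, 21]]

/-- The affine functions `a x + b y + c z + d` that agree with `255 h` on the cells. -/
def cellHeight : List (ℤ × ℤ × ℤ × ℤ) :=
  [(0, 0, -119, 57375), (0, -510, -255, 149175), (-510, 0, -255, 149175), (30, 0, -135, 62775),
   (51, 0, -153, 69615), (0, 51, -153, 69615), (0, 30, -135, 62775), (0, 0, 119, 57375),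
   (0, 510, 255, 149175), (-510, 0, 255, 149175), (30, 0, 135, 62775), (51, 0, 153, 69615),
   (0, -51, 153, 69615), (0, -30, 135, 62775)]

/-- The boundary squares of the ball. -/
def ballSide : List (List ℕ) :=
  [[1, 3, 7, 5], [0, 10, 1, 11], [0, 6, 10, 8], [1, 7, 11, 9], [0, 14, 1, 15], [0, 14, 2, 16],
   [1, 15, 3, 17], [18, 4, 8, 6], [19, 5, 9, 7], [12, 10, 13, 11], [18, 8, 12, 10],
   [19, 9, 13, 11], [12, 14, 13, 15], [18, 12, 16, 14], [19, 13, 17, 15], [18, 16, 4, 2],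
   [19, 17, 5, 3], [20, 21, 23, 22], [2, 26, 20, 27], [2, 4, 26, 24], [20, 23, 27, 25],
   [2, 30, 20, 31], [2, 30, 0, 32], [20, 31, 21, 33], [34, 6, 24, 4], [35, 22, 25, 23],
   [28, 26, 29, 27], [34, 24, 28, 26], [35, 25, 29, 27], [28, 30, 29, 31], [34, 28, 32, 30],
   [35, 29, 33, 31], [34, 32, 6, 0], [35, 33, 22, 21]]

/-- The affine functions `a x + b y + c z + d` that define the boundary squares. -/
def sideFunction : List (ℤ × ℤ × ℤ × ℤ) :=
  [(-15, -15, -14, 6750), (-1, -29, -8, 5400), (0, -4, -1, 720), (-1, -5, -2, 1170),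
   (-29, -1, -8, 5400), (-4, 0, -1, 720), (-5, -1, -2, 1170), (4, 0, -1, 720),
   (-13, -17, -18, 8370), (9, -5, -12, 5160), (2, 0, -1, 480), (-3, -5, -6, 2730),
   (-5, 9, -12, 5160), (0, 2, -1, 480), (-5, -3, -6, 2730), (0, 4, -1, 720),
   (-17, -13, -18, 8370), (-15, 15, 14, 6750), (-1, 29, 8, 5400), (0, 4, 1, 720),
   (-1, 5, 2, 1170), (-29, 1, 8, 5400), (-4, 0, 1, 720), (-5, 1, 2, 1170), (4, 0, 1, 720),
   (-13, 17, 18, 8370), (9, 5, 12, 5160), (2, 0, 1, 480), (-3, 5, 6, 2730), (-5, -9, 12, 5160),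
   (0, -2, 1, 480), (-5, 3, 6, 2730), (0, -4, 1, 720), (-17, 13, 18, 8370)]

/-- For each cell, what lies behind its facets in the directions `-0, -1, -2, +0, +1, +2`: the cell
`k < 14`, or the boundary square `k - 14`. -/
def cellNeighbour : List (List ℕ) :=
  [[1, 7, 2, 6, 14, 3], [15, 16, 0, 3, 17, 4], [0, 19, 18, 5, 20, 6], [4, 6, 21, 0, 1, 22],
   [5, 3, 24, 1, 23, 25], [6, 4, 27, 26, 2, 28], [3, 5, 29, 2, 0, 30], [8, 0, 9, 13, 31, 10],
   [32, 33, 7, 10, 34, 11], [7, 36, 35, 12, 37, 13], [11, 13, 38, 7, 8, 39],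
   [12, 10, 41, 8, 40, 42], [13, 11, 44, 43, 9, 45], [10, 12, 46, 9, 7, 47]]

/-- The vertices of the polytope are `(x, y, z, h)`, with numbers below `36`, and `(x, y, z, -h)`. -/
def vertexCoord (i : ℕ) : ℤ × ℤ × ℤ × ℤ :=
  cond (Nat.blt i 36) (ballPoint.getD i 0)
    (let p := ballPoint.getD (Nat.sub i 36) 0; (p.1, p.2.1, p.2.2.1, Int.neg p.2.2.2))

/-- The facet functionals `a x + b y + c z + d t + e`: the graph of the height function, its mirror
image, and the vertical sides. -/
def facetFunctional (j : ℕ) : ℤ × ℤ × ℤ × ℤ × ℤ :=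
  cond (Nat.blt j 14) (let f := cellHeight.getD j 0; (f.1, f.2.1, f.2.2.1, -255, f.2.2.2))
  (cond (Nat.blt j 28)
    (let f := cellHeight.getD (Nat.sub j 14) 0; (f.1, f.2.1, f.2.2.1, 255, f.2.2.2))
    (let f := sideFunction.getD (Nat.sub j 28) 0; (f.1, f.2.1, f.2.2.1, 0, f.2.2.2)))

/-- The vertices of the facets, as cubes: the cells on top, their mirror images, and the prisms over
the boundary squares. -/
def facetCube : List (List ℕ) :=
  ballCell ++ ballCell.map (fun c => c.map fun i => i + 36) ++
    ballSide.map (fun s => s ++ s.map fun i => i + 36)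

/-- The value of an affine functional. -/
def affineEval (f : ℤ × ℤ × ℤ × ℤ × ℤ) (p : ℤ × ℤ × ℤ × ℤ) : ℤ :=
  Int.add (Int.add (Int.add (Int.mul f.1 p.1) (Int.mul f.2.1 p.2.1))
    (Int.add (Int.mul f.2.2.1 p.2.2.1) (Int.mul f.2.2.2.1 p.2.2.2))) f.2.2.2.2

/-- The bit mask with the given elements. -/
def maskOf (l : List ℕ) : ℕ := List.rec 0 (fun i _ r => Nat.lor (bitMask i) r) l

/-- The vertex masks of the facets. -/
def facetMask : List ℕ := facetCube.map maskOf

/-- The natural numbers below `n`. -/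
def belowL (n : ℕ) : List ℕ := Nat.rec [] (fun k r => k :: r) n

lemma mem_belowL {n k : ℕ} : k ∈ belowL n ↔ k < n := by
  induction n with
  | zero => simp [belowL]
  | succ n ih =>
    have : belowL (n + 1) = n :: belowL n := rfl
    rw [this, List.mem_cons, ih]; omega

lemma testBit_maskOf {l : List ℕ} {i : ℕ} : (maskOf l).testBit i = true ↔ i ∈ l := by
  induction l with
  | nil => simp [maskOf]
  | cons a l ih =>
    have : maskOf (a :: l) = bitMask a ||| maskOf l := rfl
    rw [this, Nat.testBit_lor, testBit_bitMask, Bool.or_eq_true, ih, List.mem_cons,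
      decide_eq_true_iff]
    exact or_congr_left eq_comm

/-- `true` for a value that is positive, or that is zero when `b` says so. -/
def signOK (b : Bool) (v : ℤ) : Bool :=
  match v with
  | Int.ofNat n => cond b (Nat.beq n 0) (!Nat.beq n 0)
  | Int.negSucc _ => false

lemma signOK_iff {b : Bool} {v : ℤ} : signOK b v = true ↔ 0 ≤ v ∧ (v = 0 ↔ b = true) := by
  rcases v with n | n
  · have h' : Nat.beq n 0 = decide (n = 0) := by cases n <;> rfl
    cases b <;> simp [signOK, h']
  · simp [signOK]

/-- All functionals are nonnegative on all vertices, and the zeros are as described by the list of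
facets. -/
lemma incidence_check : allL (fun j => allL (fun i =>
    signOK (hasBit (facetMask.getD j 0) i) (affineEval (facetFunctional j) (vertexCoord i)))
      (belowL 72)) (belowL 62) = true := by
  decide +kernel

lemma affineEval_nonneg {j i : ℕ} (hj : j < 62) (hi : i < 72) :
    0 ≤ affineEval (facetFunctional j) (vertexCoord i) :=
  (signOK_iff.1 (allL_iff.1 (allL_iff.1 incidence_check j (mem_belowL.2 hj)) i
    (mem_belowL.2 hi))).1

lemma affineEval_eq_zero_iff {j i : ℕ} (hj : j < 62) (hi : i < 72) :
    affineEval (facetFunctional j) (vertexCoord i) = 0 ↔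
      (facetMask.getD j 0).testBit i = true := by
  rw [← hasBit_eq]
  exact (signOK_iff.1 (allL_iff.1 (allL_iff.1 incidence_check j (mem_belowL.2 hj)) i
    (mem_belowL.2 hi))).2

/-- The vertices of the polytope. -/
def vertexPoint (i : Fin 72) : EuclideanSpace ℝ (Fin 4) :=
  let p := vertexCoord i
  WithLp.toLp 2 ![(p.1 : ℝ), (p.2.1 : ℝ), (p.2.2.1 : ℝ), (p.2.2.2 : ℝ)]

/-- The linear parts of the facet functionals. -/
def facetLin (j : Fin 62) : EuclideanSpace ℝ (Fin 4) →L[ℝ] ℝ :=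
  let f := facetFunctional j
  (f.1 : ℝ) • EuclideanSpace.proj (0 : Fin 4) + (f.2.1 : ℝ) • EuclideanSpace.proj (1 : Fin 4) +
    ((f.2.2.1 : ℝ) • EuclideanSpace.proj (2 : Fin 4) +
      (f.2.2.2.1 : ℝ) • EuclideanSpace.proj (3 : Fin 4))

/-- The constant terms of the facet functionals. -/
def facetConst (j : Fin 62) : ℝ := ((facetFunctional j).2.2.2.2 : ℝ)

lemma facetLin_vertexPoint (j : Fin 62) (i : Fin 72) :
    facetLin j (vertexPoint i) + facetConst j =
      (affineEval (facetFunctional j) (vertexCoord i) : ℝ) := by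
  have hm : ∀ a b : ℤ, Int.mul a b = a * b := fun _ _ => rfl
  have ha : ∀ a b : ℤ, Int.add a b = a + b := fun _ _ => rfl
  simp only [affineEval, hm, ha]
  simp [facetLin, facetConst, vertexPoint]

/-! ### The facet description is complete -/

/-- Six times the signed volume of a tetrahedron. -/
def vol {R : Type*} [CommRing R] (p q r s : R × R × R) : R :=
  (q.1 - p.1) * ((r.2.1 - p.2.1) * (s.2.2 - p.2.2) - (r.2.2 - p.2.2) * (s.2.1 - p.2.1)) -
  (q.2.1 - p.2.1) * ((r.1 - p.1) * (s.2.2 - p.2.2) - (r.2.2 - p.2.2) * (s.1 - p.1)) +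
  (q.2.2 - p.2.2) * ((r.1 - p.1) * (s.2.1 - p.2.1) - (r.2.1 - p.2.1) * (s.1 - p.1))

/-- The value of the affine function `f` at `p`. -/
def affineVal {R : Type*} [CommRing R] (f : R × R × R × R) (p : R × R × R) : R :=
  f.1 * p.1 + f.2.1 * p.2.1 + f.2.2.1 * p.2.2 + f.2.2.2

/-- The vertices of a cube on a closed path around the diagonal from `0` to `7`. -/
def hexagon : Fin 6 → Fin 8 := ![1, 3, 2, 6, 4, 5]

/-- Sufficient conditions for a cube with the vertices `v` and the facet functions `f` (in the
directions `-0, -1, -2, +0, +1, +2`) to be the union of the six tetrahedra that contain the diagonal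
from `v 0` to `v 7` and an edge of the hexagon around it. -/
structure IsGoodCube {R : Type*} [CommRing R] [LinearOrder R] (v : Fin 8 → R × R × R)
    (f : Fin 6 → R × R × R × R) : Prop where
  pos : ∀ i, 0 < vol (v 0) (v (hexagon i)) (v (hexagon (i + 1))) (v 7)
  turn : ∀ i, 0 < vol (v 0) (v (hexagon i)) (v (hexagon (i + 2))) (v 7)
  front : ∀ i, ∃ k, affineVal (f k) (v (hexagon i)) = 0 ∧
    affineVal (f k) (v (hexagon (i + 1))) = 0 ∧ affineVal (f k) (v 7) = 0 ∧
    0 < affineVal (f k) (v 0)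
  back : ∀ i, ∃ k, affineVal (f k) (v (hexagon i)) = 0 ∧
    affineVal (f k) (v (hexagon (i + 1))) = 0 ∧ affineVal (f k) (v 0) = 0 ∧
    0 < affineVal (f k) (v 7)

/-- Cramer's rule, evaluated by an affine function. -/
lemma vol_mul_affineVal (f : ℝ × ℝ × ℝ × ℝ) (p q r s x : ℝ × ℝ × ℝ) :
    vol p q r s * affineVal f x = vol x q r s * affineVal f p + vol p x r s * affineVal f q +
      vol p q x s * affineVal f r + vol p q r x * affineVal f s := by
  simp only [vol, affineVal]
  ring

/-- A cyclic sequence of six signs that are not all positive and not all negative has a change from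
nonnegative to nonpositive. -/
lemma exists_sign_change (σ : Fin 6 → ℝ) (hp : ¬ ∀ i, 0 < σ i) (hn : ¬ ∀ i, σ i < 0) :
    ∃ i, 0 ≤ σ i ∧ σ (i + 1) ≤ 0 := by
  by_contra! hcon
  obtain ⟨i, hi⟩ := not_forall.1 hn
  have h1 := hcon i (not_lt.1 hi)
  have h2 := hcon _ h1.le
  have h3 := hcon _ h2.le
  have h4 := hcon _ h3.le
  have h5 := hcon _ h4.le
  have h6 := hcon _ h5.le
  refine hp fun k => ?_
  fin_cases i <;> fin_cases k <;> assumption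

/-- A point that satisfies the facet inequalities of a good cube is a convex combination of the
vertices. -/
lemma IsGoodCube.exists_weights {v : Fin 8 → ℝ × ℝ × ℝ} {f : Fin 6 → ℝ × ℝ × ℝ × ℝ}
    (h : IsGoodCube v f) {x : ℝ × ℝ × ℝ} (hx : ∀ k, 0 ≤ affineVal (f k) x) :
    ∃ w : Fin 8 → ℝ, (∀ k, 0 ≤ w k) ∧
      ∀ g : ℝ × ℝ × ℝ × ℝ, affineVal g x = ∑ k, w k * affineVal g (v k) := by
  classical
  set σ : Fin 6 → ℝ := fun i => vol (v 0) (v (hexagon i)) x (v 7) with hσ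
  have hid : ∀ i, vol (v 0) (v (hexagon (i + 2))) (v (hexagon (i + 2 + 2))) (v 7) * σ i +
      vol (v 0) (v (hexagon (i + 2 + 2))) (v (hexagon (i + 2 + 2 + 2))) (v 7) * σ (i + 2) +
      vol (v 0) (v (hexagon i)) (v (hexagon (i + 2))) (v 7) * σ (i + 2 + 2) = 0 := by
    intro i
    have : i + 2 + 2 + 2 = i := by revert i; decide
    rw [this]
    simp only [hσ, vol]
    ring
  have hp : ¬ ∀ i, 0 < σ i := by
    intro hall
    have := hid 0
    have h1 := mul_pos (h.turn (0 + 2)) (hall 0)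
    have h2 := mul_pos (h.turn (0 + 2 + 2)) (hall (0 + 2))
    have h3 := mul_pos (h.turn 0) (hall (0 + 2 + 2))
    linarith
  have hn : ¬ ∀ i, σ i < 0 := by
    intro hall
    have := hid 0
    have h1 := mul_neg_of_pos_of_neg (h.turn (0 + 2)) (hall 0)
    have h2 := mul_neg_of_pos_of_neg (h.turn (0 + 2 + 2)) (hall (0 + 2))
    have h3 := mul_neg_of_pos_of_neg (h.turn 0) (hall (0 + 2 + 2))
    linarith
  obtain ⟨i, hi, hi'⟩ := exists_sign_change σ hp hn
  set p := v 0
  set q := v (hexagon i)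
  set r := v (hexagon (i + 1))
  set s := v 7
  have hd : 0 < vol p q r s := h.pos i
  have hp0 : 0 ≤ vol x q r s := by
    obtain ⟨k, h1, h2, h3, h4⟩ := h.front i
    have := vol_mul_affineVal (f k) p q r s x
    rw [h1, h2, h3] at this
    simp only [mul_zero, add_zero] at this
    have h5 : 0 ≤ vol x q r s * affineVal (f k) p := this ▸ mul_nonneg hd.le (hx k)
    exact nonneg_of_mul_nonneg_left h5 h4
  have hs0 : 0 ≤ vol p q r x := by
    obtain ⟨k, h1, h2, h3, h4⟩ := h.back i
    have := vol_mul_affineVal (f k) p q r s x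
    rw [h1, h2, h3] at this
    simp only [mul_zero, zero_add] at this
    have h5 : 0 ≤ vol p q r x * affineVal (f k) s := this ▸ mul_nonneg hd.le (hx k)
    exact nonneg_of_mul_nonneg_left h5 h4
  have hq0 : 0 ≤ vol p x r s := by
    have : vol p x r s = -σ (i + 1) := by simp only [hσ, vol]; ring
    rw [this]; linarith
  have hr0 : 0 ≤ vol p q x s := hi
  refine ⟨fun k => (vol x q r s / vol p q r s * if k = 0 then 1 else 0) +
    (vol p x r s / vol p q r s * if k = hexagon i then 1 else 0) +
    (vol p q x s / vol p q r s * if k = hexagon (i + 1) then 1 else 0) +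
    (vol p q r x / vol p q r s * if k = 7 then 1 else 0), fun k => ?_, fun g => ?_⟩
  · have hite : ∀ P : Prop, ∀ _ : Decidable P, (0 : ℝ) ≤ if P then 1 else 0 := by
      intro P _; split_ifs <;> norm_num
    have hv := hd.le
    exact add_nonneg (add_nonneg (add_nonneg (mul_nonneg (div_nonneg hp0 hv) (hite _ _))
      (mul_nonneg (div_nonneg hq0 hv) (hite _ _))) (mul_nonneg (div_nonneg hr0 hv) (hite _ _)))
      (mul_nonneg (div_nonneg hs0 hv) (hite _ _))
  · have := vol_mul_affineVal g p q r s x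
    simp only [add_mul, Finset.sum_add_distrib, mul_assoc, ite_mul, one_mul, zero_mul, mul_ite,
      mul_zero, Finset.sum_ite_eq', Finset.mem_univ, if_true]
    rw [div_mul_eq_mul_div, div_mul_eq_mul_div, div_mul_eq_mul_div, div_mul_eq_mul_div,
      ← add_div, ← add_div, ← add_div, eq_div_iff hd.ne', mul_comm, this]

/-- The position of a vertex of the ball. -/
def ballPosition (i : ℕ) : ℤ × ℤ × ℤ :=
  let p := ballPoint.getD i 0; (p.1, p.2.1, p.2.2.1)

/-- The vertices of a cell. -/
def cellVertex (C : ℕ) (k : Fin 8) : ℕ := (ballCell.getD C []).getD k 0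

/-- The facet functions of a cell: a difference of two height functions for a facet between two
cells, and the function of the square for a facet on the boundary of the ball. -/
def cellFacet (C : ℕ) (k : Fin 6) : ℤ × ℤ × ℤ × ℤ :=
  let m := (cellNeighbour.getD C []).getD k 0
  if m < 14 then
    let f := cellHeight.getD m 0
    let g := cellHeight.getD C 0
    (f.1 - g.1, f.2.1 - g.2.1, f.2.2.1 - g.2.2.1, f.2.2.2 - g.2.2.2)
  else sideFunction.getD (m - 14) 0

lemma isGoodCube_cell : ∀ C : Fin 14,
    IsGoodCube (fun k => ballPosition (cellVertex C k)) (cellFacet C) := by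
  have h : ∀ C : Fin 14,
      (∀ i, 0 < vol (ballPosition (cellVertex C 0)) (ballPosition (cellVertex C (hexagon i)))
        (ballPosition (cellVertex C (hexagon (i + 1)))) (ballPosition (cellVertex C 7))) ∧
      (∀ i, 0 < vol (ballPosition (cellVertex C 0)) (ballPosition (cellVertex C (hexagon i)))
        (ballPosition (cellVertex C (hexagon (i + 2)))) (ballPosition (cellVertex C 7))) ∧
      (∀ i, ∃ k, affineVal (cellFacet C k) (ballPosition (cellVertex C (hexagon i))) = 0 ∧
        affineVal (cellFacet C k) (ballPosition (cellVertex C (hexagon (i + 1)))) = 0 ∧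
        affineVal (cellFacet C k) (ballPosition (cellVertex C 7)) = 0 ∧
        0 < affineVal (cellFacet C k) (ballPosition (cellVertex C 0))) ∧
      (∀ i, ∃ k, affineVal (cellFacet C k) (ballPosition (cellVertex C (hexagon i))) = 0 ∧
        affineVal (cellFacet C k) (ballPosition (cellVertex C (hexagon (i + 1)))) = 0 ∧
        affineVal (cellFacet C k) (ballPosition (cellVertex C 0)) = 0 ∧
        0 < affineVal (cellFacet C k) (ballPosition (cellVertex C 7))) := by
    decide +kernel
  exact fun C => ⟨(h C).1, (h C).2.1, (h C).2.2.1, (h C).2.2.2⟩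

/-- A triple of integers as a triple of real numbers. -/
def realTriple (p : ℤ × ℤ × ℤ) : ℝ × ℝ × ℝ := (p.1, p.2.1, p.2.2)

/-- A quadruple of integers as a quadruple of real numbers. -/
def realQuadruple (p : ℤ × ℤ × ℤ × ℤ) : ℝ × ℝ × ℝ × ℝ := (p.1, p.2.1, p.2.2.1, p.2.2.2)

lemma vol_realTriple (p q r s : ℤ × ℤ × ℤ) :
    vol (realTriple p) (realTriple q) (realTriple r) (realTriple s) = ((vol p q r s : ℤ) : ℝ) := by
  simp [vol, realTriple]

lemma affineVal_real (f : ℤ × ℤ × ℤ × ℤ) (p : ℤ × ℤ × ℤ) :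
    affineVal (realQuadruple f) (realTriple p) = ((affineVal f p : ℤ) : ℝ) := by
  simp [affineVal, realTriple, realQuadruple]

lemma IsGoodCube.real {v : Fin 8 → ℤ × ℤ × ℤ} {f : Fin 6 → ℤ × ℤ × ℤ × ℤ} (h : IsGoodCube v f) :
    IsGoodCube (fun k => realTriple (v k)) (fun k => realQuadruple (f k)) := by
  refine ⟨fun i => ?_, fun i => ?_, fun i => ?_, fun i => ?_⟩
  · rw [vol_realTriple]; exact_mod_cast h.pos i
  · rw [vol_realTriple]; exact_mod_cast h.turn i
  · obtain ⟨k, hk⟩ := h.front i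
    refine ⟨k, ?_⟩
    simp only [affineVal_real]
    exact_mod_cast hk
  · obtain ⟨k, hk⟩ := h.back i
    refine ⟨k, ?_⟩
    simp only [affineVal_real]
    exact_mod_cast hk

/-- The height of a vertex of the ball. -/
def ballHeight (i : ℕ) : ℤ := (ballPoint.getD i 0).2.2.2

lemma cellVertex_lt : ∀ (C : Fin 14) (k : Fin 8), cellVertex C k < 36 := by
  decide +kernel

lemma ballHeight_pos : ∀ i : Fin 36, 0 < ballHeight i := by
  decide +kernel

lemma affineVal_cellHeight : ∀ (C : Fin 14) (k : Fin 8),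
    affineVal (cellHeight.getD C 0) (ballPosition (cellVertex C k)) =
      255 * ballHeight (cellVertex C k) := by
  decide +kernel

lemma cellNeighbour_lt : ∀ (C : Fin 14) (k : Fin 6), (cellNeighbour.getD C []).getD k 0 < 48 := by
  decide +kernel

/-- The position of a point of the ball. -/
def spacePart (x : EuclideanSpace ℝ (Fin 4)) : ℝ × ℝ × ℝ := (x 0, x 1, x 2)

lemma facet_top (C : ℕ) (hC : C < 14) (x : EuclideanSpace ℝ (Fin 4)) :
    facetLin ⟨C, by omega⟩ x + facetConst ⟨C, by omega⟩ =
      affineVal (realQuadruple (cellHeight.getD C 0)) (spacePart x) - 255 * x 3 := by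
  have h : facetFunctional C = (let f := cellHeight.getD C 0;
      (f.1, f.2.1, f.2.2.1, -255, f.2.2.2)) := by
    have : Nat.blt C 14 = true := by simpa [Nat.blt_eq] using hC
    rw [facetFunctional, this]; rfl
  simp only [facetLin, facetConst, h]
  simp [affineVal, realQuadruple, spacePart]
  ring

lemma facet_bottom (C : ℕ) (hC : C < 14) (x : EuclideanSpace ℝ (Fin 4)) :
    facetLin ⟨C + 14, by omega⟩ x + facetConst ⟨C + 14, by omega⟩ =
      affineVal (realQuadruple (cellHeight.getD C 0)) (spacePart x) + 255 * x 3 := by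
  have h : facetFunctional (C + 14) = (let f := cellHeight.getD C 0;
      (f.1, f.2.1, f.2.2.1, 255, f.2.2.2)) := by
    have h1 : Nat.blt (C + 14) 14 = false := by
      rw [← Bool.not_eq_true, Nat.blt_eq]; omega
    have h2 : Nat.blt (C + 14) 28 = true := by rw [Nat.blt_eq]; omega
    have h3 : Nat.sub (C + 14) 14 = C := Nat.add_sub_cancel ..
    rw [facetFunctional, h1, h2, h3]; rfl
  simp only [facetLin, facetConst, h]
  simp [affineVal, realQuadruple, spacePart]
  ring

lemma facet_side (B : ℕ) (hB : B < 34) (x : EuclideanSpace ℝ (Fin 4)) :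
    facetLin ⟨B + 28, by omega⟩ x + facetConst ⟨B + 28, by omega⟩ =
      affineVal (realQuadruple (sideFunction.getD B 0)) (spacePart x) := by
  have h : facetFunctional (B + 28) = (let f := sideFunction.getD B 0;
      (f.1, f.2.1, f.2.2.1, 0, f.2.2.2)) := by
    have h1 : Nat.blt (B + 28) 14 = false := by
      rw [← Bool.not_eq_true, Nat.blt_eq]; omega
    have h2 : Nat.blt (B + 28) 28 = false := by
      rw [← Bool.not_eq_true, Nat.blt_eq]; omega
    have h3 : Nat.sub (B + 28) 28 = B := Nat.add_sub_cancel ..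
    rw [facetFunctional, h1, h2, h3]; rfl
  simp only [facetLin, facetConst, h]
  simp [affineVal, realQuadruple, spacePart]

lemma vertexPoint_top (i : ℕ) (hi : i < 36) : spacePart (vertexPoint ⟨i, by omega⟩) =
    realTriple (ballPosition i) ∧ vertexPoint ⟨i, by omega⟩ 3 = ballHeight i := by
  have h1 : Nat.blt i 36 = true := by rw [Nat.blt_eq]; omega
  have h : vertexCoord i = ballPoint.getD i 0 := by rw [vertexCoord, h1]; rfl
  simp only [vertexPoint, h, spacePart, realTriple, ballPosition, ballHeight]
  simp

lemma vertexPoint_bottom (i : ℕ) (hi : i < 36) : spacePart (vertexPoint ⟨i + 36, by omega⟩) =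
    realTriple (ballPosition i) ∧ vertexPoint ⟨i + 36, by omega⟩ 3 = -ballHeight i := by
  have h1 : Nat.blt (i + 36) 36 = false := by rw [← Bool.not_eq_true, Nat.blt_eq]; omega
  have h3 : Nat.sub (i + 36) 36 = i := Nat.add_sub_cancel ..
  have h : vertexCoord (i + 36) = (let p := ballPoint.getD i 0;
      (p.1, p.2.1, p.2.2.1, -p.2.2.2)) := by rw [vertexCoord, h1, h3]; rfl
  simp only [vertexPoint, h, spacePart, realTriple, ballPosition, ballHeight]
  simp

/-- The facet inequalities determine the polytope. Over the ball the height is bounded by the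
minimum of the height functions of the cells; where the minimum is attained at `C`, all facet
functions of `C` are nonnegative. -/
lemma mem_convexHull_vertexPoint {x : EuclideanSpace ℝ (Fin 4)}
    (hx : ∀ j, 0 ≤ facetLin j x + facetConst j) : x ∈ convexHull ℝ (Set.range vertexPoint) := by
  obtain ⟨C, -, hC⟩ := Finset.exists_min_image (Finset.univ : Finset (Fin 14))
    (fun C => affineVal (realQuadruple (cellHeight.getD C 0)) (spacePart x)) ⟨0, by simp⟩
  have hf : ∀ k, 0 ≤ affineVal (realQuadruple (cellFacet C k)) (spacePart x) := by
    intro k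
    have hlt := cellNeighbour_lt C k
    unfold cellFacet
    generalize (cellNeighbour.getD C []).getD k 0 = m at hlt
    by_cases hm : m < 14
    · have := hC ⟨m, hm⟩ (Finset.mem_univ _)
      simp only [hm, if_true]
      simp only [affineVal, realQuadruple] at this ⊢
      push_cast
      linarith
    · simp only [hm, if_false]
      have h := hx ⟨m - 14 + 28, by omega⟩
      rwa [facet_side _ (by omega)] at h
  obtain ⟨w, hw0, hw⟩ := (isGoodCube_cell C).real.exists_weights hf
  have hw1 : ∑ k, w k = 1 := by
    have := hw (0, 0, 0, 1)
    simpa [affineVal] using this.symm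
  set η : Fin 8 → ℝ := fun k => ballHeight (cellVertex C k) with hη
  have hηpos : ∀ k, 0 < η k := fun k => by
    have := ballHeight_pos ⟨_, cellVertex_lt C k⟩
    simp only [hη]; exact_mod_cast this
  have hH : affineVal (realQuadruple (cellHeight.getD C 0)) (spacePart x) =
      255 * ∑ k, w k * η k := by
    rw [hw, Finset.mul_sum]
    refine Finset.sum_congr rfl fun k _ => ?_
    rw [affineVal_real, affineVal_cellHeight]
    push_cast
    ring
  have h1 : x 3 ≤ ∑ k, w k * η k := by
    have := hx ⟨C, by omega⟩
    rw [facet_top C C.2, hH] at this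
    linarith
  have h2 : -∑ k, w k * η k ≤ x 3 := by
    have := hx ⟨C + 14, by omega⟩
    rw [facet_bottom C C.2, hH] at this
    linarith
  have hpos : 0 < ∑ k, w k * η k := by
    obtain ⟨k, -, hk⟩ : ∃ k ∈ Finset.univ, w k ≠ 0 := by
      refine Finset.exists_ne_zero_of_sum_ne_zero (s := Finset.univ) (f := w) ?_
      rw [hw1]; exact one_ne_zero
    exact Finset.sum_pos' (fun k _ => mul_nonneg (hw0 k) (hηpos k).le)
      ⟨k, Finset.mem_univ _, mul_pos (lt_of_le_of_ne (hw0 k) (Ne.symm hk)) (hηpos k)⟩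
  set H := ∑ k, w k * η k with hHdef
  -- the point is a combination of its upper and its lower neighbour on the boundary
  set s := x 3 / H with hs
  have hs1 : s ≤ 1 := (div_le_one hpos).2 h1
  have hs2 : -1 ≤ s := by rw [hs, le_div_iff₀ hpos]; linarith
  have hsH : s * H = x 3 := div_mul_cancel₀ _ hpos.ne'
  let top : Fin 8 → EuclideanSpace ℝ (Fin 4) := fun k =>
    vertexPoint ⟨cellVertex C k, by have := cellVertex_lt C k; omega⟩
  let bot : Fin 8 → EuclideanSpace ℝ (Fin 4) := fun k =>
    vertexPoint ⟨cellVertex C k + 36, by have := cellVertex_lt C k; omega⟩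
  have hxsum : x = ∑ k, w k • (((1 + s) / 2) • top k + ((1 - s) / 2) • bot k) := by
    have hpt : ∀ k, spacePart (top k) = realTriple (ballPosition (cellVertex C k)) ∧
        top k 3 = η k := fun k => vertexPoint_top _ (cellVertex_lt C k)
    have hpb : ∀ k, spacePart (bot k) = realTriple (ballPosition (cellVertex C k)) ∧
        bot k 3 = -η k := fun k => vertexPoint_bottom _ (cellVertex_lt C k)
    have e0 := hw (1, 0, 0, 0)
    have e1 := hw (0, 1, 0, 0)
    have e2 := hw (0, 0, 1, 0)
    simp only [affineVal, one_mul, zero_mul, add_zero, zero_add, spacePart] at e0 e1 e2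
    ext i
    simp only [WithLp.ofLp_sum, Finset.sum_apply, PiLp.smul_apply, PiLp.add_apply, smul_eq_mul]
    fin_cases i
    · change x 0 = ∑ k, w k * ((1 + s) / 2 * top k 0 + (1 - s) / 2 * bot k 0)
      rw [e0]
      refine Finset.sum_congr rfl fun k _ => ?_
      have a := congrArg Prod.fst (hpt k).1
      have b := congrArg Prod.fst (hpb k).1
      simp only [spacePart] at a b
      rw [a, b]; ring
    · change x 1 = ∑ k, w k * ((1 + s) / 2 * top k 1 + (1 - s) / 2 * bot k 1)
      rw [e1]
      refine Finset.sum_congr rfl fun k _ => ?_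
      have a := congrArg (fun p => p.2.1) (hpt k).1
      have b := congrArg (fun p => p.2.1) (hpb k).1
      simp only [spacePart] at a b
      rw [a, b]; ring
    · change x 2 = ∑ k, w k * ((1 + s) / 2 * top k 2 + (1 - s) / 2 * bot k 2)
      rw [e2]
      refine Finset.sum_congr rfl fun k _ => ?_
      have a := congrArg (fun p => p.2.2) (hpt k).1
      have b := congrArg (fun p => p.2.2) (hpb k).1
      simp only [spacePart] at a b
      rw [a, b]; ring
    · change x 3 = ∑ k, w k * ((1 + s) / 2 * top k 3 + (1 - s) / 2 * bot k 3)
      rw [← hsH, hHdef, Finset.mul_sum]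
      refine Finset.sum_congr rfl fun k _ => ?_
      rw [(hpt k).2, (hpb k).2]; ring
  rw [hxsum]
  refine (convex_convexHull ℝ _).sum_mem (fun k _ => hw0 k) hw1 fun k _ => ?_
  exact convex_convexHull ℝ _ (subset_convexHull ℝ _ (Set.mem_range_self _))
    (subset_convexHull ℝ _ (Set.mem_range_self _)) (by linarith) (by linarith) (by ring)

/-- The vertices and the facet inequalities describe the same polytope. -/
lemma hvRep_vertexPoint : HVRep vertexPoint facetLin facetConst where
  nonneg j i := by
    rw [facetLin_vertexPoint]
    exact_mod_cast affineEval_nonneg j.2 i.2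
  complete x hx := mem_convexHull_vertexPoint hx

/-! ### The faces of the polytope -/

/-- The edges of the polytope. -/
def edgeCube : List (List ℕ) :=
  [[0, 6], [1, 7], [0, 1], [6, 7], [2, 4], [3, 5], [2, 3], [4, 5], [0, 2], [6, 4], [1, 3],
   [7, 5], [0, 10], [1, 11], [10, 11], [6, 8], [7, 9], [8, 9], [10, 8], [11, 9], [14, 16],
   [15, 17], [14, 15], [16, 17], [0, 14], [2, 16], [1, 15], [3, 17], [18, 19], [18, 8], [19, 9],
   [18, 4], [19, 5], [12, 13], [18, 12], [19, 13], [12, 10], [13, 11], [18, 16], [19, 17],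
   [12, 14], [13, 15], [20, 23], [2, 20], [4, 23], [21, 22], [0, 21], [6, 22], [20, 21],
   [23, 22], [2, 26], [20, 27], [26, 27], [4, 24], [23, 25], [24, 25], [26, 24], [27, 25],
   [30, 32], [31, 33], [30, 31], [32, 33], [2, 30], [0, 32], [20, 31], [21, 33], [34, 35],
   [34, 24], [35, 25], [34, 6], [35, 22], [28, 29], [34, 28], [35, 29], [28, 26], [29, 27],
   [34, 32], [35, 33], [28, 30], [29, 31], [36, 42], [37, 43], [36, 37], [42, 43], [38, 40],
   [39, 41], [38, 39], [40, 41], [36, 38], [42, 40], [37, 39], [43, 41], [36, 46], [37, 47],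
   [46, 47], [42, 44], [43, 45], [44, 45], [46, 44], [47, 45], [50, 52], [51, 53], [50, 51],
   [52, 53], [36, 50], [38, 52], [37, 51], [39, 53], [54, 55], [54, 44], [55, 45], [54, 40],
   [55, 41], [48, 49], [54, 48], [55, 49], [48, 46], [49, 47], [54, 52], [55, 53], [48, 50],
   [49, 51], [56, 59], [38, 56], [40, 59], [57, 58], [36, 57], [42, 58], [56, 57], [59, 58],
   [38, 62], [56, 63], [62, 63], [40, 60], [59, 61], [60, 61], [62, 60], [63, 61], [66, 68],
   [67, 69], [66, 67], [68, 69], [38, 66], [36, 68], [56, 67], [57, 69], [70, 71], [70, 60],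
   [71, 61], [70, 42], [71, 58], [64, 65], [70, 64], [71, 65], [64, 62], [65, 63], [70, 68],
   [71, 69], [64, 66], [65, 67], [1, 37], [7, 43], [3, 39], [5, 41], [0, 36], [10, 46], [11, 47],
   [6, 42], [8, 44], [9, 45], [14, 50], [15, 51], [2, 38], [16, 52], [17, 53], [18, 54], [4, 40],
   [19, 55], [12, 48], [13, 49], [20, 56], [23, 59], [21, 57], [22, 58], [26, 62], [27, 63],
   [24, 60], [25, 61], [30, 66], [31, 67], [32, 68], [33, 69], [34, 70], [35, 71], [28, 64],
   [29, 65]]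

/-- The `2`-faces of the polytope; the vertices are ordered like those of a cube. -/
def quadCube : List (List ℕ) :=
  [[0, 1, 6, 7], [2, 3, 4, 5], [0, 2, 6, 4], [1, 3, 7, 5], [0, 2, 1, 3], [6, 4, 7, 5],
   [0, 1, 10, 11], [6, 7, 8, 9], [0, 6, 10, 8], [1, 7, 11, 9], [10, 8, 11, 9], [14, 15, 16, 17],
   [0, 14, 2, 16], [1, 15, 3, 17], [0, 14, 1, 15], [2, 16, 3, 17], [18, 8, 19, 9],
   [18, 4, 19, 5], [18, 4, 8, 6], [19, 5, 9, 7], [18, 12, 19, 13], [12, 10, 13, 11],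
   [18, 8, 12, 10], [19, 9, 13, 11], [18, 16, 19, 17], [12, 14, 13, 15], [18, 12, 16, 14],
   [19, 13, 17, 15], [18, 16, 4, 2], [19, 17, 5, 3], [2, 20, 4, 23], [0, 21, 6, 22],
   [20, 21, 23, 22], [2, 0, 20, 21], [4, 6, 23, 22], [2, 20, 26, 27], [4, 23, 24, 25],
   [2, 4, 26, 24], [20, 23, 27, 25], [26, 24, 27, 25], [30, 31, 32, 33], [2, 30, 0, 32],
   [20, 31, 21, 33], [2, 30, 20, 31], [0, 32, 21, 33], [34, 24, 35, 25], [34, 6, 35, 22],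
   [34, 6, 24, 4], [35, 22, 25, 23], [34, 28, 35, 29], [28, 26, 29, 27], [34, 24, 28, 26],
   [35, 25, 29, 27], [34, 32, 35, 33], [28, 30, 29, 31], [34, 28, 32, 30], [35, 29, 33, 31],
   [34, 32, 6, 0], [35, 33, 22, 21], [36, 37, 42, 43], [38, 39, 40, 41], [36, 38, 42, 40],
   [37, 39, 43, 41], [36, 38, 37, 39], [42, 40, 43, 41], [36, 37, 46, 47], [42, 43, 44, 45],
   [36, 42, 46, 44], [37, 43, 47, 45], [46, 44, 47, 45], [50, 51, 52, 53], [36, 50, 38, 52],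
   [37, 51, 39, 53], [36, 50, 37, 51], [38, 52, 39, 53], [54, 44, 55, 45], [54, 40, 55, 41],
   [54, 40, 44, 42], [55, 41, 45, 43], [54, 48, 55, 49], [48, 46, 49, 47], [54, 44, 48, 46],
   [55, 45, 49, 47], [54, 52, 55, 53], [48, 50, 49, 51], [54, 48, 52, 50], [55, 49, 53, 51],
   [54, 52, 40, 38], [55, 53, 41, 39], [38, 56, 40, 59], [36, 57, 42, 58], [56, 57, 59, 58],
   [38, 36, 56, 57], [40, 42, 59, 58], [38, 56, 62, 63], [40, 59, 60, 61], [38, 40, 62, 60],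
   [56, 59, 63, 61], [62, 60, 63, 61], [66, 67, 68, 69], [38, 66, 36, 68], [56, 67, 57, 69],
   [38, 66, 56, 67], [36, 68, 57, 69], [70, 60, 71, 61], [70, 42, 71, 58], [70, 42, 60, 40],
   [71, 58, 61, 59], [70, 64, 71, 65], [64, 62, 65, 63], [70, 60, 64, 62], [71, 61, 65, 63],
   [70, 68, 71, 69], [64, 66, 65, 67], [70, 64, 68, 66], [71, 65, 69, 67], [70, 68, 42, 36],
   [71, 69, 58, 57], [1, 7, 37, 43], [3, 5, 39, 41], [1, 3, 37, 39], [7, 5, 43, 41],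
   [0, 1, 36, 37], [10, 11, 46, 47], [0, 10, 36, 46], [1, 11, 37, 47], [6, 8, 42, 44],
   [0, 6, 36, 42], [10, 8, 46, 44], [7, 9, 43, 45], [11, 9, 47, 45], [14, 15, 50, 51],
   [0, 14, 36, 50], [1, 15, 37, 51], [0, 2, 36, 38], [14, 16, 50, 52], [2, 16, 38, 52],
   [15, 17, 51, 53], [3, 17, 39, 53], [18, 8, 54, 44], [4, 6, 40, 42], [18, 4, 54, 40],
   [19, 9, 55, 45], [19, 5, 55, 41], [12, 13, 48, 49], [12, 10, 48, 46], [13, 11, 49, 47],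
   [18, 12, 54, 48], [19, 13, 55, 49], [12, 14, 48, 50], [13, 15, 49, 51], [18, 16, 54, 52],
   [19, 17, 55, 53], [4, 2, 40, 38], [20, 23, 56, 59], [21, 22, 57, 58], [20, 21, 56, 57],
   [23, 22, 59, 58], [2, 20, 38, 56], [26, 27, 62, 63], [2, 26, 38, 62], [20, 27, 56, 63],
   [4, 24, 40, 60], [26, 24, 62, 60], [23, 25, 59, 61], [27, 25, 63, 61], [30, 31, 66, 67],
   [2, 30, 38, 66], [20, 31, 56, 67], [30, 32, 66, 68], [0, 32, 36, 68], [31, 33, 67, 69],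
   [21, 33, 57, 69], [34, 24, 70, 60], [34, 6, 70, 42], [35, 25, 71, 61], [35, 22, 71, 58],
   [28, 29, 64, 65], [28, 26, 64, 62], [29, 27, 65, 63], [34, 28, 70, 64], [35, 29, 71, 65],
   [28, 30, 64, 66], [29, 31, 65, 67], [34, 32, 70, 68], [35, 33, 71, 69]]

/-- The `k`-dimensional faces, as lists of vertices in the order of the vertices of a cube. -/
def faceCubes (k : ℕ) : List (List ℕ) :=
  match k with
  | 0 => (belowL 72).map fun i => [i]
  | 1 => edgeCube
  | 2 => quadCube
  | 3 => facetCube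
  | _ => []

/-- The vertex masks of the `k`-dimensional faces. -/
def faceMasks (k : ℕ) : List ℕ := (faceCubes k).map maskOf

/-- The mask of the positions in the list `c` whose entry belongs to the mask `Z`. -/
def pull (Z : ℕ) (c : List ℕ) : ℕ :=
  List.rec 0 (fun i _ r => Nat.add (Nat.land 1 (Nat.shiftRight Z i)) (Nat.mul 2 r)) c

/-- The intersection of the mask `2 ^ 72 - 1` of all vertices and those masks in `L` that contain
the mask `m`. -/
def closureMask (L : List ℕ) (m : ℕ) : ℕ :=
  List.rec (4722366482869645213695)
    (fun Z _ r => cond (Nat.beq (Nat.land Z m) m) (Nat.land Z r) r) L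

/-- The masks of the subcubes of a cube of dimension at most `3`, and the empty mask. -/
def subcubeMasks : List ℕ :=
  [0, 1, 2, 4, 8, 16, 32, 64, 128, 3, 12, 48, 192, 5, 10, 80, 160, 17, 34, 68, 136, 15, 240, 51,
    204, 85, 170, 255]

/-- The facets of the cube of dimension `k`. -/
def halfMasks (k : ℕ) : List ℕ :=
  match k with
  | 1 => [1, 2]
  | 2 => [5, 10, 3, 12]
  | 3 => [85, 170, 51, 204, 15, 240]
  | _ => []

/-- The list `c` is a face of the polytope, and a cube of dimension `k`: it is an intersection of
facets, all facets restrict to subcubes, and all facets of the cube arise in this way. -/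
def isCubeFace (k : ℕ) (c : List ℕ) : Bool :=
  cond (Nat.beq c.length (Nat.pow 2 k)) (cond (Nat.beq (closureMask facetMask (maskOf c)) (maskOf c))
    ((fun ps => cond (allL (fun p => memL p subcubeMasks) ps)
      (allL (fun h => memL h ps) (halfMasks k)) false)
      (facetMask.map fun Z => pull Z c)) false) false

lemma isCubeFace_zero : allL (isCubeFace 0) (faceCubes 0) = true := by decide +kernel
lemma isCubeFace_one : allL (isCubeFace 1) (faceCubes 1) = true := by decide +kernel
lemma isCubeFace_two : allL (isCubeFace 2) (faceCubes 2) = true := by decide +kernel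
lemma isCubeFace_three : allL (isCubeFace 3) (faceCubes 3) = true := by decide +kernel

/-- The sublist of `c` at the positions `n < 8` with `n &&& a = b`. -/
def subList (a b : ℕ) (c : List ℕ) : List ℕ :=
  (filterL (fun n => Nat.beq (Nat.land n a) b) (belowL 8)).map fun n => c.getD n 0

/-- The subcubes of the cube `c` are faces of the polytope. -/
def hasSubfaces (c : List ℕ) : Bool :=
  allL (fun p => allL (fun b => cond (Nat.beq (Nat.land b p.1) b)
    (memL (maskOf (subList p.1 b c)) (faceMasks p.2)) true) (belowL 8))
    [(0, 3), (1, 2), (2, 2), (4, 2), (3, 1), (5, 1), (6, 1), (7, 0)]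

lemma hasSubfaces_facetCube : allL hasSubfaces facetCube = true := by decide +kernel

/-- The mask `m` is strictly contained in `m'`. -/
def ssubMask (m m' : ℕ) : Bool := cond (Nat.beq (Nat.land m m') m) (!Nat.beq m m') false

/-- All faces of dimension `k` lie in a face of dimension `k + 1`, and all faces of dimension
`k + 1` contain a face of dimension `k`. -/
def isGraded (k : ℕ) : Bool :=
  cond (allL (fun m => anyL (fun m' => ssubMask m m') (faceMasks (k + 1))) (faceMasks k))
    (allL (fun m' => anyL (fun m => ssubMask m m') (faceMasks k)) (faceMasks (k + 1))) false

lemma isGraded_zero : isGraded 0 = true := by decide +kernel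
lemma isGraded_one : isGraded 1 = true := by decide +kernel
lemma isGraded_two : isGraded 2 = true := by decide +kernel

/-- The numbers in the list are distinct. -/
def nodupL (l : List ℕ) : Bool :=
  List.rec true (fun a l r => cond (memL a l) false r) l

lemma nodup_of_nodupL {l : List ℕ} (h : nodupL l = true) : l.Nodup := by
  induction l with
  | nil => exact List.nodup_nil
  | cons a l ih =>
    have h1 : cond (memL a l) false (nodupL l) = true := h
    cases h2 : memL a l
    · rw [h2] at h1
      refine List.nodup_cons.2 ⟨fun h3 => ?_, ih h1⟩
      rw [memL_iff.2 h3] at h2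
      exact Bool.noConfusion h2
    · rw [h2] at h1; exact Bool.noConfusion h1

lemma nodupL_zero : nodupL (faceMasks 0) = true := by decide +kernel
lemma nodupL_one : nodupL (faceMasks 1) = true := by decide +kernel
lemma nodupL_two : nodupL (faceMasks 2) = true := by decide +kernel
lemma nodupL_three : nodupL (faceMasks 3) = true := by decide +kernel

/-! ### The face lattice of the polytope -/

/-- The polytope. -/
def polytope : Set (EuclideanSpace ℝ (Fin 4)) := hull vertexPoint Set.univ

/-- The face with the vertex mask `m`. -/
def faceOf (m : ℕ) : Set (EuclideanSpace ℝ (Fin 4)) := hull vertexPoint (maskSet 72 m)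

lemma testBit_pull {Z : ℕ} {c : List ℕ} {n : ℕ} :
    (pull Z c).testBit n = true ↔ n < c.length ∧ Z.testBit (c.getD n 0) = true := by
  induction c generalizing n with
  | nil => simp [pull]
  | cons i c ih =>
    have h0 : Nat.land 1 (Nat.shiftRight Z i) = (Z.testBit i).toNat := by
      change 1 &&& (Z >>> i) = _
      rw [Nat.one_and_eq_mod_two, Nat.toNat_testBit, Nat.shiftRight_eq_div_pow]
    have h : pull Z (i :: c) = Nat.bit (Z.testBit i) (pull Z c) := by
      change Nat.land 1 (Nat.shiftRight Z i) + 2 * pull Z c = _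
      rw [h0, Nat.bit_val, add_comm]
    rw [h]
    cases n with
    | zero => simp
    | succ n => rw [Nat.testBit_bit_succ, ih]; simp

lemma testBit_closureMask {L : List ℕ} {m i : ℕ} (hi : i < 72)
    (h : ∀ Z ∈ L, Nat.land Z m = m → Z.testBit i = true) :
    (closureMask L m).testBit i = true := by
  induction L with
  | nil =>
    have : closureMask [] m = 2 ^ 72 - 1 := by simp [closureMask]
    rw [this, Nat.testBit_two_pow_sub_one]
    simpa using hi
  | cons Z L ih =>
    have h1 : closureMask (Z :: L) m =
        cond (Nat.beq (Nat.land Z m) m) (Nat.land Z (closureMask L m)) (closureMask L m) := rfl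
    have h2 := ih fun Z hZ => h Z (List.mem_cons_of_mem _ hZ)
    rw [h1]
    cases h3 : Nat.beq (Nat.land Z m) m
    · exact h2
    · change (Z &&& closureMask L m).testBit i = true
      rw [Nat.testBit_land, h2, h Z List.mem_cons_self (Nat.eq_of_beq_eq_true h3)]
      rfl

/-- Masks compare like the sets of their elements. -/
lemma land_eq_left_iff {m m' : ℕ} : m &&& m' = m ↔ ∀ i, m.testBit i = true → m'.testBit i = true := by
  constructor
  · intro h i hi
    rw [← h, Nat.testBit_land, Bool.and_eq_true] at hi
    exact hi.2
  · intro h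
    refine Nat.eq_of_testBit_eq fun i => ?_
    rw [Nat.testBit_land]
    cases hi : m.testBit i
    · rfl
    · rw [h i hi]; rfl

lemma facetMask_length : facetMask.length = 62 := rfl

lemma mem_facetMask {Z : ℕ} : Z ∈ facetMask ↔ ∃ j : Fin 62, facetMask.getD j 0 = Z := by
  constructor
  · intro h
    obtain ⟨n, hn, rfl⟩ := List.mem_iff_getElem.1 h
    exact ⟨⟨n, hn.trans_eq facetMask_length⟩, List.getD_eq_getElem _ _ hn⟩
  · rintro ⟨j, rfl⟩
    rw [List.getD_eq_getElem _ _ (j.2.trans_eq facetMask_length.symm)]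
    exact List.getElem_mem _

lemma facet_eq_zero_iff (j : Fin 62) (i : Fin 72) :
    facetLin j (vertexPoint i) + facetConst j = 0 ↔
      (facetMask.getD j 0).testBit i = true := by
  rw [facetLin_vertexPoint, ← affineEval_eq_zero_iff j.2 i.2]
  exact_mod_cast Iff.rfl

lemma mem_active_maskSet {m : ℕ} (hm : m < 2 ^ 72) {j : Fin 62} :
    j ∈ active vertexPoint facetLin facetConst (maskSet 72 m) ↔
      m &&& facetMask.getD j 0 = m := by
  rw [land_eq_left_iff]
  constructor
  · intro h i hi
    have h72 : i < 72 := by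
      by_contra hcon
      rw [Nat.testBit_lt_two_pow (hm.trans_le (Nat.pow_le_pow_right (by norm_num)
        (not_lt.1 hcon)))] at hi
      exact Bool.noConfusion hi
    exact (facet_eq_zero_iff j ⟨i, h72⟩).1 (h ⟨i, h72⟩ hi)
  · exact fun h i hi => (facet_eq_zero_iff j i).2 (h i hi)

lemma faceCubes_isCubeFace {k : ℕ} (hk : k < 4) {c : List ℕ} (hc : c ∈ faceCubes k) :
    isCubeFace k c = true := by
  have h0 := allL_iff.1 isCubeFace_zero
  have h1 := allL_iff.1 isCubeFace_one
  have h2 := allL_iff.1 isCubeFace_two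
  have h3 := allL_iff.1 isCubeFace_three
  interval_cases k
  exacts [h0 c hc, h1 c hc, h2 c hc, h3 c hc]

lemma faceCubes_spec {k : ℕ} (hk : k < 4) {c : List ℕ} (hc : c ∈ faceCubes k) :
    c.length = 2 ^ k ∧ closureMask facetMask (maskOf c) = maskOf c ∧
      (∀ j : Fin 62, pull (facetMask.getD j 0) c ∈ subcubeMasks) ∧
      ∀ h ∈ halfMasks k, ∃ j : Fin 62, pull (facetMask.getD j 0) c = h := by
  have h := faceCubes_isCubeFace hk hc
  unfold isCubeFace at h
  simp only [Bool.cond_eq_true_distrib, Bool.false_eq_true, if_false_right, Nat.beq_eq] at h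
  obtain ⟨h1, h2, h3, h4⟩ := h
  refine ⟨h1, h2, fun j => ?_, fun h hh => ?_⟩
  · exact memL_iff.1 (allL_iff.1 h3 _ (List.mem_map.2 ⟨_, mem_facetMask.2 ⟨j, rfl⟩, rfl⟩))
  · obtain ⟨Z, hZ, hh'⟩ := List.mem_map.1 (memL_iff.1 (allL_iff.1 h4 h hh))
    obtain ⟨j, rfl⟩ := mem_facetMask.1 hZ
    exact ⟨j, hh'⟩

lemma closureMask_lt (L : List ℕ) (m : ℕ) : closureMask L m < 2 ^ 72 := by
  induction L with
  | nil => simp [closureMask]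
  | cons Z L ih =>
    have h1 : closureMask (Z :: L) m =
        cond (Nat.beq (Nat.land Z m) m) (Nat.land Z (closureMask L m)) (closureMask L m) := rfl
    rw [h1]
    cases Nat.beq (Nat.land Z m) m
    · exact ih
    · exact Nat.and_le_right.trans_lt ih

lemma mem_faceMasks {k m : ℕ} : m ∈ faceMasks k ↔ ∃ c ∈ faceCubes k, maskOf c = m := List.mem_map

lemma faceMasks_lt {k m : ℕ} (hk : k < 4) (hm : m ∈ faceMasks k) : m < 2 ^ 72 := by
  obtain ⟨c, hc, rfl⟩ := mem_faceMasks.1 hm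
  rw [← (faceCubes_spec hk hc).2.1]
  exact closureMask_lt _ _

lemma maskSet_subset_iff {m m' : ℕ} (hm : m < 2 ^ 72) :
    maskSet 72 m ⊆ maskSet 72 m' ↔ m &&& m' = m := by
  rw [land_eq_left_iff]
  refine ⟨fun h i hi => ?_, fun h i hi => h i hi⟩
  have h72 : i < 72 := by
    by_contra hcon
    rw [Nat.testBit_lt_two_pow (hm.trans_le (Nat.pow_le_pow_right (by norm_num)
      (not_lt.1 hcon)))] at hi
    exact Bool.noConfusion hi
  exact h (show (⟨i, h72⟩ : Fin 72) ∈ maskSet 72 m from hi)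

lemma isClosedIdx_faceMasks {k m : ℕ} (hk : k < 4) (hm : m ∈ faceMasks k) :
    IsClosedIdx vertexPoint facetLin facetConst (maskSet 72 m) := by
  have hlt := faceMasks_lt hk hm
  intro i hi
  obtain ⟨c, hc, rfl⟩ := mem_faceMasks.1 hm
  change (maskOf c).testBit i = true
  rw [← (faceCubes_spec hk hc).2.1]
  refine testBit_closureMask i.2 fun Z hZ hZm => ?_
  obtain ⟨j, rfl⟩ := mem_facetMask.1 hZ
  refine (facet_eq_zero_iff j i).1 (hi j ((mem_active_maskSet hlt).2 ?_))
  rw [Nat.land_comm]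
  exact hZm

/-- The masks of subcubes consist of the positions with prescribed binary digits `b` in the places
`a`; the empty mask is the case that `b` has a digit outside `a`. -/
lemma exists_mask_of_mem_subcubeMasks : ∀ Z ∈ subcubeMasks, ∃ a < 8, ∃ b < 9, ∀ n < 8,
    Z.testBit n = true ↔ n &&& a = b := by
  decide +kernel

lemma getD_mem {c : List ℕ} {n : ℕ} (h : n < c.length) : c.getD n 0 ∈ c := by
  rw [List.getD_eq_getElem _ _ h]; exact List.getElem_mem _

/-- The vertices of a cubical face, in the order of the vertices of a cube. -/
def cubeMap {k : ℕ} (hk : k < 4) {c : List ℕ} (hc : c ∈ faceCubes k) (n : Fin (2 ^ k)) : Fin 72 :=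
  ⟨c.getD n 0, by
    have h1 : c.getD n 0 ∈ c := getD_mem (n.2.trans_eq (faceCubes_spec hk hc).1.symm)
    have h2 := testBit_maskOf.2 h1
    by_contra hcon
    rw [Nat.testBit_lt_two_pow ((faceMasks_lt hk (mem_faceMasks.2 ⟨c, hc, rfl⟩)).trans_le
      (Nat.pow_le_pow_right (by norm_num) (not_lt.1 hcon)))] at h2
    exact Bool.noConfusion h2⟩

section

variable {k : ℕ} (hk : k < 4) {c : List ℕ} (hc : c ∈ faceCubes k)

lemma range_cubeMap : Set.range (cubeMap hk hc) = maskSet 72 (maskOf c) := by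
  ext i
  change _ ↔ (maskOf c).testBit i = true
  rw [testBit_maskOf]
  constructor
  · rintro ⟨n, rfl⟩
    exact getD_mem (n.2.trans_eq (faceCubes_spec hk hc).1.symm)
  · intro hi
    obtain ⟨n, hn, h⟩ := List.mem_iff_getElem.1 hi
    refine ⟨⟨n, hn.trans_eq (faceCubes_spec hk hc).1⟩, Fin.ext ?_⟩
    rw [← h]
    exact List.getD_eq_getElem _ _ hn

lemma facet_cubeMap_iff (j : Fin 62) (n : Fin (2 ^ k)) :
    facetLin j (vertexPoint (cubeMap hk hc n)) + facetConst j = 0 ↔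
      (pull (facetMask.getD j 0) c).testBit n = true := by
  rw [facet_eq_zero_iff, testBit_pull]
  exact ⟨fun h => ⟨n.2.trans_eq (faceCubes_spec hk hc).1.symm, h⟩, fun h => h.2⟩

lemma testBit_halfMasks : ∀ k < 4, ∀ i < k, ∀ b : Bool, ∃ h ∈ halfMasks k, ∀ n < 2 ^ k,
    h.testBit n = true ↔ n.testBit i = b := by
  decide +kernel

/-- Every facet of the cube is cut out by a facet of the polytope. -/
lemma exists_facet_cubeMap (j' : Fin k × Bool) : ∃ j : Fin 62, ∀ n : Fin (2 ^ k),
    facetLin j (vertexPoint (cubeMap hk hc n)) + facetConst j = 0 ↔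
      cubeLin k j' (cubeVertex k n) + cubeConst k j' = 0 := by
  obtain ⟨h, hh, hh'⟩ := testBit_halfMasks k hk j'.1 j'.1.2 j'.2
  obtain ⟨j, hj⟩ := (faceCubes_spec hk hc).2.2.2 h hh
  refine ⟨j, fun n => ?_⟩
  rw [facet_cubeMap_iff, hj, cube_eq_zero_iff]
  exact hh' n n.2

lemma facet_cubeMap_closed (j : Fin 62) :
    {n | facetLin j (vertexPoint (cubeMap hk hc n)) + facetConst j = 0} = ∅ ∨
      IsClosedIdx (cubeVertex k) (cubeLin k) (cubeConst k)
        {n | facetLin j (vertexPoint (cubeMap hk hc n)) + facetConst j = 0} := by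
  obtain ⟨a, -, b, -, h⟩ := exists_mask_of_mem_subcubeMasks _ ((faceCubes_spec hk hc).2.2.1 j)
  have : {n : Fin (2 ^ k) | facetLin j (vertexPoint (cubeMap hk hc n)) + facetConst j = 0} =
      {n : Fin (2 ^ k) | (n : ℕ) &&& a = b} := by
    ext n
    have h8 : (n : ℕ) < 8 :=
      n.2.trans_le (Nat.pow_le_pow_right (j := 3) (by norm_num) (by omega))
    exact (facet_cubeMap_iff hk hc j n).trans (h n h8)
  rw [this]
  exact isClosedIdx_subcube k a b

lemma cubeMap_injective : Function.Injective (cubeMap hk hc) := by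
  intro n n' h
  refine Fin.ext (Nat.eq_of_testBit_eq fun i => ?_)
  by_cases hi : i < k
  · obtain ⟨j, hj⟩ := exists_facet_cubeMap hk hc (⟨i, hi⟩, (n : ℕ).testBit i)
    have h1 := (cube_eq_zero_iff (⟨i, hi⟩, (n : ℕ).testBit i) n).2 rfl
    rw [← hj, h, hj, cube_eq_zero_iff] at h1
    exact h1.symm
  · have hle : 2 ^ k ≤ 2 ^ i := Nat.pow_le_pow_right (by norm_num) (not_lt.1 hi)
    rw [Nat.testBit_lt_two_pow (n.2.trans_le hle), Nat.testBit_lt_two_pow (n'.2.trans_le hle)]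

end

lemma combEquiv_faceOf {k : ℕ} (hk : k < 4) {c : List ℕ} (hc : c ∈ faceCubes k) :
    CombEquiv (faceOf (maskOf c)) (stdCube k) := by
  rw [← hull_cubeVertex]
  exact combEquiv_of_vertices hvRep_vertexPoint (hvRep_cube k)
    (isClosedIdx_faceMasks hk (mem_faceMasks.2 ⟨c, hc, rfl⟩)) (cubeMap hk hc)
    (cubeMap_injective hk hc) (range_cubeMap hk hc) (facet_cubeMap_closed hk hc)
    (exists_facet_cubeMap hk hc)

lemma mem_subList {a b i : ℕ} {c : List ℕ} :
    i ∈ subList a b c ↔ ∃ n < 8, n &&& a = b ∧ c.getD n 0 = i := by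
  simp only [subList, List.mem_map, mem_filterL, mem_belowL, Nat.beq_eq, and_assoc]
  rfl

/-- The dimension of the subcube with prescribed coordinates in the positions `a`. -/
lemma exists_subcube_dim : ∀ a < 8, ∃ k < 4, (a, k) ∈
    [(0, 3), (1, 2), (2, 2), (4, 2), (3, 1), (5, 1), (6, 1), (7, 0)] := by
  decide

/-- A proper face lies in a facet, where it is a subcube. -/
lemma exists_faceMask {S : Set (Fin 72)} (hS : IsClosedIdx vertexPoint facetLin facetConst S)
    (hne : S.Nonempty) (huniv : S ≠ Set.univ) : ∃ k < 4, ∃ m ∈ faceMasks k, S = maskSet 72 m := by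
  obtain ⟨j, hj⟩ : (active vertexPoint facetLin facetConst S).Nonempty := by
    rw [Set.nonempty_iff_ne_empty]
    intro h0
    refine huniv (Set.eq_univ_of_forall fun i => hS i fun j hj => ?_)
    rw [h0] at hj
    exact hj.elim
  have hmem : facetMask.getD j 0 ∈ faceMasks 3 := mem_facetMask.2 ⟨j, rfl⟩
  obtain ⟨c, hc, hcj⟩ := mem_faceMasks.1 hmem
  have h3 : 3 < 4 := by norm_num
  have hsub : S ⊆ Set.range (cubeMap h3 hc) := by
    rw [range_cubeMap, hcj]
    exact fun i hi => (facet_eq_zero_iff j i).1 (hj i hi)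
  obtain ⟨i0, hi0⟩ := hne
  obtain ⟨n0, hn0⟩ := hsub hi0
  rcases isClosedIdx_preimage (cubeMap h3 hc) (facet_cubeMap_closed h3 hc) hS with h0 | hT
  · have : n0 ∈ cubeMap h3 hc ⁻¹' S := by rw [Set.mem_preimage, hn0]; exact hi0
    rw [h0] at this
    exact this.elim
  obtain ⟨a, ha, b, hab⟩ := exists_subcube_of_isClosedIdx
    (⟨n0, by rw [Set.mem_preimage, hn0]; exact hi0⟩) hT
  have hn0T : n0 ∈ cubeMap h3 hc ⁻¹' S := by rw [Set.mem_preimage, hn0]; exact hi0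
  rw [hab] at hn0T
  have hb : (n0 : ℕ) &&& a = b := hn0T
  have hb8 : b < 8 := by rw [← hb]; exact Nat.and_le_left.trans_lt n0.2
  have hba : b &&& a = b := by rw [← hb, Nat.land_assoc, Nat.and_self]
  obtain ⟨k, hk, hak⟩ := exists_subcube_dim a ha
  have hc8 := allL_iff.1 (allL_iff.1 (allL_iff.1 hasSubfaces_facetCube c hc) _ hak) b
    (mem_belowL.2 hb8)
  have hba' : Nat.beq (Nat.land b a) b = true := by rw [Nat.beq_eq]; exact hba
  simp only [hba', cond_true, memL_iff] at hc8
  refine ⟨k, hk, _, hc8, ?_⟩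
  ext i
  change _ ↔ (maskOf _).testBit i = true
  rw [testBit_maskOf, mem_subList]
  constructor
  · intro hi
    obtain ⟨n, rfl⟩ := hsub hi
    have hn : n ∈ cubeMap h3 hc ⁻¹' S := hi
    rw [hab] at hn
    exact ⟨n, n.2, hn, rfl⟩
  · rintro ⟨n, hn8, hn, hni⟩
    have : (⟨n, hn8⟩ : Fin (2 ^ 3)) ∈ cubeMap h3 hc ⁻¹' S := by rw [hab]; exact hn
    have h2 : cubeMap h3 hc ⟨n, hn8⟩ = i := Fin.ext hni
    rw [Set.mem_preimage, h2] at this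
    exact this

lemma nonempty_maskSet {k m : ℕ} (hk : k < 4) (hm : m ∈ faceMasks k) : (maskSet 72 m).Nonempty := by
  obtain ⟨c, hc, rfl⟩ := mem_faceMasks.1 hm
  rw [← range_cubeMap hk hc]
  exact ⟨_, ⟨⟨0, by positivity⟩, rfl⟩⟩

lemma maskSet_ne_univ {k m : ℕ} (hk : k < 4) (hm : m ∈ faceMasks k) :
    maskSet 72 m ≠ Set.univ := by
  obtain ⟨c, hc, rfl⟩ := mem_faceMasks.1 hm
  rw [← range_cubeMap hk hc]
  intro h
  have h1 := Fintype.card_le_of_surjective _ (Set.range_eq_univ.1 h)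
  have h2 : 2 ^ k ≤ 2 ^ 3 := Nat.pow_le_pow_right (by norm_num) (by omega)
  simp only [Fintype.card_fin] at h1
  omega

lemma ssubMask_iff {m m' : ℕ} : ssubMask m m' = true ↔ m &&& m' = m ∧ m ≠ m' := by
  unfold ssubMask
  simp only [Bool.cond_eq_true_distrib, Bool.false_eq_true, if_false_right, Nat.beq_eq,
    Bool.not_eq_true', ← Bool.not_eq_true]
  exact Iff.rfl

lemma faceOf_subset_iff {k k' m m' : ℕ} (hk : k < 4) (hm : m ∈ faceMasks k) (hk' : k' < 4)
    (hm' : m' ∈ faceMasks k') : faceOf m ⊆ faceOf m' ↔ m &&& m' = m := by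
  rw [← maskSet_subset_iff (faceMasks_lt hk hm)]
  exact hvRep_vertexPoint.hull_subset_iff (isClosedIdx_faceMasks hk' hm')

lemma faceOf_inj {k k' m m' : ℕ} (hk : k < 4) (hm : m ∈ faceMasks k) (hk' : k' < 4)
    (hm' : m' ∈ faceMasks k') (h : faceOf m = faceOf m') : m = m' := by
  have h1 := (faceOf_subset_iff hk hm hk' hm').1 h.subset
  have h2 := (faceOf_subset_iff hk' hm' hk hm).1 h.symm.subset
  rw [← h1, Nat.land_comm, h2]

lemma dim_faceOf_lt {k k' m m' : ℕ} (hk : k < 4) (hm : m ∈ faceMasks k) (hk' : k' < 4)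
    (hm' : m' ∈ faceMasks k') (h : faceOf m ⊆ faceOf m') (hne : m ≠ m') :
    dim (faceOf m) < dim (faceOf m') := by
  have h1 := (faceOf_subset_iff hk hm hk' hm').1 h
  refine dim_hull_lt (isClosedIdx_faceMasks hk hm) (nonempty_maskSet hk hm)
    (LE.le.ssubset_of_ne ((maskSet_subset_iff (faceMasks_lt hk hm)).2 h1) fun h2 => ?_)
  refine hne (faceOf_inj hk hm hk' hm' ?_)
  rw [faceOf, faceOf, h2]

lemma dim_faceOf_lt_dim_polytope {k m : ℕ} (hk : k < 4) (hm : m ∈ faceMasks k) :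
    dim (faceOf m) < dim polytope :=
  dim_hull_lt (isClosedIdx_faceMasks hk hm) (nonempty_maskSet hk hm)
    (Set.ssubset_univ_iff.2 (maskSet_ne_univ hk hm))

lemma dim_le_finrank {E : Type*} [NormedAddCommGroup E] [NormedSpace ℝ E] [FiniteDimensional ℝ E]
    (A : Set E) : dim A ≤ Module.finrank ℝ E :=
  Submodule.finrank_le _

lemma dim_polytope_le : dim polytope ≤ 4 := by
  have h := dim_le_finrank polytope
  have h4 : Module.finrank ℝ (EuclideanSpace ℝ (Fin 4)) = 4 := finrank_euclideanSpace_fin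
  exact h.trans h4.le

lemma isGraded_spec {k : ℕ} (hk : k < 3) :
    (∀ m ∈ faceMasks k, ∃ m' ∈ faceMasks (k + 1), m &&& m' = m ∧ m ≠ m') ∧
      ∀ m' ∈ faceMasks (k + 1), ∃ m ∈ faceMasks k, m &&& m' = m ∧ m ≠ m' := by
  have h : isGraded k = true := by
    have h0 := isGraded_zero
    have h1 := isGraded_one
    have h2 := isGraded_two
    interval_cases k
    exacts [h0, h1, h2]
  unfold isGraded at h
  simp only [Bool.cond_eq_true_distrib, Bool.false_eq_true, if_false_right, allL_iff, anyL_iff,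
    ssubMask_iff] at h
  exact h

lemma le_dim_faceOf {k m : ℕ} (hk : k < 4) (hm : m ∈ faceMasks k) : k ≤ dim (faceOf m) := by
  induction k generalizing m with
  | zero => exact Nat.zero_le _
  | succ k ih =>
    obtain ⟨m', hm', h1, h2⟩ := (isGraded_spec (by omega)).2 m hm
    have h3 := ih (by omega) hm'
    have h4 := dim_faceOf_lt (by omega) hm' hk hm
      ((faceOf_subset_iff (by omega) hm' hk hm).2 h1) h2
    omega

lemma dim_faceOf_le {k m : ℕ} (hk : k < 4) (hm : m ∈ faceMasks k) : dim (faceOf m) ≤ k := by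
  obtain ⟨d, hd⟩ : ∃ d, k + d = 3 := ⟨3 - k, by omega⟩
  induction d generalizing k m with
  | zero =>
    have := dim_faceOf_lt_dim_polytope hk hm
    have := dim_polytope_le
    omega
  | succ d ih =>
    obtain ⟨m', hm', h1, h2⟩ := (isGraded_spec (by omega)).1 m hm
    have h3 := ih (by omega) hm' (by omega)
    have h4 := dim_faceOf_lt hk hm (by omega) hm'
      ((faceOf_subset_iff hk hm (by omega) hm').2 h1) h2
    omega

/-- The combinatorial rank of a face is its dimension: by strict monotonicity of dimensions along
a maximal chain of faces. -/
lemma dim_faceOf {k m : ℕ} (hk : k < 4) (hm : m ∈ faceMasks k) : dim (faceOf m) = k :=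
  (dim_faceOf_le hk hm).antisymm (le_dim_faceOf hk hm)

lemma exists_mem_faceMasks {k : ℕ} (hk : k < 4) : ∃ m, m ∈ faceMasks k := by
  interval_cases k <;> exact ⟨_, List.mem_cons_self⟩

lemma dim_polytope : dim polytope = 4 := by
  obtain ⟨m, hm⟩ := exists_mem_faceMasks (k := 3) (by norm_num)
  have h1 := dim_faceOf_lt_dim_polytope (by norm_num) hm
  rw [dim_faceOf (by norm_num) hm] at h1
  exact dim_polytope_le.antisymm h1

lemma isExposed_faceOf {k m : ℕ} (hk : k < 4) (hm : m ∈ faceMasks k) :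
    IsExposed ℝ polytope (faceOf m) :=
  hvRep_vertexPoint.isExposed_hull (isClosedIdx_faceMasks hk hm) (Set.subset_univ _)

lemma nonempty_faceOf {k m : ℕ} (hk : k < 4) (hm : m ∈ faceMasks k) : (faceOf m).Nonempty :=
  hull_nonempty (nonempty_maskSet hk hm)

lemma faceOf_ne_polytope {k m : ℕ} (hk : k < 4) (hm : m ∈ faceMasks k) : faceOf m ≠ polytope :=
  fun h => (dim_faceOf_lt_dim_polytope hk hm).ne (congrArg dim h)

lemma isFace_faceOf {k m : ℕ} (hk : k < 4) (hm : m ∈ faceMasks k) :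
    IsFace polytope k (faceOf m) :=
  ⟨isExposed_faceOf hk hm, nonempty_faceOf hk hm, dim_faceOf hk hm⟩

lemma exists_eq_faceOf {F : Set (EuclideanSpace ℝ (Fin 4))} (hF : IsExposed ℝ polytope F)
    (hne : F.Nonempty) (hP : F ≠ polytope) : ∃ k < 4, ∃ m ∈ faceMasks k, F = faceOf m := by
  obtain ⟨S, -, hS, hcl, rfl⟩ := hvRep_vertexPoint.exists_eq_hull isClosedIdx_univ hF hne
  obtain ⟨k, hk, m, hm, rfl⟩ := exists_faceMask hcl hS fun h => hP (by rw [h]; rfl)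
  exact ⟨k, hk, m, hm, rfl⟩

lemma isFace_iff {k : ℕ} (hk : k < 4) {F : Set (EuclideanSpace ℝ (Fin 4))} :
    IsFace polytope k F ↔ ∃ m ∈ faceMasks k, F = faceOf m := by
  constructor
  · rintro ⟨h1, h2, h3⟩
    obtain ⟨k', hk', m, hm, rfl⟩ := exists_eq_faceOf h1 h2 fun h => by
      rw [h, dim_polytope] at h3; omega
    rw [dim_faceOf hk' hm] at h3
    subst h3
    exact ⟨m, hm, rfl⟩
  · rintro ⟨m, hm, rfl⟩
    exact isFace_faceOf hk hm

lemma nodup_faceMasks {k : ℕ} (hk : k < 4) : (faceMasks k).Nodup := by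
  have h0 := nodup_of_nodupL nodupL_zero
  have h1 := nodup_of_nodupL nodupL_one
  have h2 := nodup_of_nodupL nodupL_two
  have h3 := nodup_of_nodupL nodupL_three
  interval_cases k
  exacts [h0, h1, h2, h3]

lemma fNumber_polytope {k : ℕ} (hk : k < 4) : fNumber polytope k = (faceMasks k).length := by
  have : {F | IsFace polytope k F} = faceOf '' ((faceMasks k).toFinset : Set ℕ) := by
    ext F
    rw [Set.mem_ofPred_eq, isFace_iff hk]
    simp [eq_comm]
  rw [fNumber, this, Set.InjOn.ncard_image, Set.ncard_coe_finset,
    List.toFinset_card_of_nodup (nodup_faceMasks hk)]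
  intro m hm m' hm' h
  simp only [List.coe_toFinset, Set.mem_ofPred_eq] at hm hm'
  exact faceOf_inj hk hm hk hm' h

lemma length_faceMasks : (faceMasks 0).length = 72 ∧ (faceMasks 1).length = 196 ∧
    (faceMasks 2).length = 186 ∧ (faceMasks 3).length = 62 := by
  decide +kernel

lemma isCubicalPolytope_polytope : IsCubicalPolytope 4 polytope := by
  refine ⟨⟨⟨_, Set.toFinite (vertexPoint '' Set.univ), ⟨_, ⟨0, trivial, rfl⟩⟩, rfl⟩, dim_polytope⟩,
    fun k hk F hF => ?_⟩
  obtain ⟨m, hm, rfl⟩ := (isFace_iff hk).1 hF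
  obtain ⟨c, hc, rfl⟩ := mem_faceMasks.1 hm
  exact combEquiv_faceOf hk hc

/-! ### The cells of the dual surface -/

/-- A parallel class of edges of the polytope. Any two consecutive edges are opposite in a
`2`-face. -/
def surfaceEdge : List (List ℕ) :=
  [[56, 59], [38, 40], [39, 41], [37, 43], [47, 45], [11, 9], [1, 7], [0, 6], [36, 42], [57, 58],
   [71, 69], [65, 67], [64, 66], [70, 68], [34, 32], [28, 30], [29, 31], [35, 33], [21, 22],
   [20, 23], [27, 25], [63, 61], [62, 60], [70, 64], [66, 68], [30, 32], [0, 2], [1, 3], [7, 5],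
   [19, 9], [13, 11], [49, 47], [48, 46], [12, 10], [18, 8], [6, 4], [34, 24], [28, 26],
   [29, 27], [65, 63], [64, 62], [70, 60], [71, 61], [35, 25], [23, 22], [59, 58], [42, 40],
   [54, 44], [55, 45], [43, 41], [37, 39], [51, 53], [55, 49], [19, 13], [15, 17], [14, 16],
   [18, 12], [10, 8], [46, 44], [54, 48], [50, 52], [36, 38], [56, 57], [20, 21], [31, 33],
   [67, 69], [71, 65], [35, 29], [34, 28], [26, 24], [2, 4], [3, 5], [19, 17], [18, 16],
   [12, 14], [48, 50], [54, 52], [55, 53], [49, 51], [13, 15]]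

/-- The vertex mask of the edge with number `t` in the parallel class. -/
def edgeMask (t : ℕ) : ℕ := maskOf (surfaceEdge.getD t [])

/-- The cells `(F, [e])` of the dual surface, in the order of their dimensions: the numbers of the
edges in `[e]`. Consecutive edges are opposite in a `2`-face of `F`. -/
def surfaceCell : List (List ℕ) :=
  [[0], [1], [2], [3], [4], [5], [6], [7], [8], [9], [10], [11], [12], [13], [14], [15], [16],
   [17], [18], [19], [20], [21], [22], [23], [24], [25], [26], [27], [28], [29], [30], [31],
   [32], [33], [34], [35], [36], [37], [38], [39], [40], [41], [42], [43], [44], [45], [46],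
   [47], [48], [49], [50], [51], [52], [53], [54], [55], [56], [57], [58], [59], [60], [61],
   [62], [63], [64], [65], [66], [67], [68], [69], [70], [71], [72], [73], [74], [75], [76],
   [77], [78], [79], [0, 1], [0, 9], [0, 19], [0, 21], [1, 2], [1, 8], [1, 22], [1, 70], [1, 76],
   [2, 3], [2, 71], [2, 77], [3, 4], [3, 6], [3, 8], [4, 5], [4, 52], [4, 58], [5, 6], [5, 53],
   [5, 57], [6, 7], [6, 71], [7, 8], [7, 14], [7, 18], [7, 57], [7, 70], [8, 9], [8, 13],
   [8, 58], [9, 10], [9, 18], [10, 11], [10, 13], [10, 17], [11, 12], [11, 16], [12, 13],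
   [12, 15], [13, 14], [14, 15], [14, 17], [15, 16], [16, 17], [17, 18], [18, 19], [19, 20],
   [19, 70], [20, 21], [20, 67], [20, 69], [21, 22], [21, 66], [22, 23], [22, 69], [23, 24],
   [23, 66], [23, 68], [24, 25], [24, 61], [24, 65], [25, 26], [25, 64], [25, 68], [26, 27],
   [26, 35], [26, 55], [26, 61], [26, 63], [27, 28], [27, 50], [27, 54], [28, 29], [28, 35],
   [28, 49], [29, 30], [29, 34], [29, 48], [30, 31], [30, 33], [31, 32], [31, 48], [32, 33],
   [32, 47], [33, 34], [34, 35], [34, 47], [35, 36], [35, 44], [35, 46], [36, 37], [36, 41],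
   [36, 43], [37, 38], [37, 40], [38, 39], [38, 43], [39, 40], [39, 42], [40, 41], [41, 42],
   [41, 46], [42, 43], [42, 45], [43, 44], [44, 45], [44, 63], [45, 46], [45, 62], [46, 47],
   [46, 49], [46, 61], [47, 48], [48, 49], [49, 50], [50, 51], [50, 61], [51, 52], [51, 54],
   [51, 60], [52, 53], [52, 59], [53, 54], [53, 56], [54, 55], [55, 56], [55, 60], [56, 57],
   [56, 59], [57, 58], [58, 59], [59, 60], [60, 61], [61, 62], [62, 63], [62, 65], [63, 64],
   [64, 65], [64, 67], [65, 66], [66, 67], [67, 68], [68, 69], [69, 70], [70, 71], [70, 73],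
   [71, 72], [72, 73], [72, 77], [72, 79], [73, 74], [73, 76], [74, 75], [74, 79], [75, 76],
   [75, 78], [76, 77], [77, 78], [78, 79], [0, 1, 8, 9], [0, 1, 22, 21], [0, 9, 18, 19],
   [0, 19, 20, 21], [1, 2, 3, 8], [1, 2, 77, 76], [1, 22, 69, 70], [1, 70, 73, 76],
   [2, 3, 6, 71], [2, 71, 72, 77], [3, 4, 5, 6], [3, 4, 58, 8], [4, 5, 53, 52], [4, 52, 59, 58],
   [5, 6, 7, 57], [5, 53, 56, 57], [6, 7, 70, 71], [7, 8, 13, 14], [7, 8, 58, 57],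
   [7, 14, 17, 18], [7, 18, 19, 70], [8, 9, 10, 13], [9, 10, 17, 18], [10, 11, 12, 13],
   [10, 11, 16, 17], [11, 12, 15, 16], [12, 13, 14, 15], [14, 15, 16, 17], [19, 20, 69, 70],
   [20, 21, 66, 67], [20, 67, 68, 69], [21, 22, 23, 66], [22, 23, 68, 69], [23, 24, 25, 68],
   [23, 24, 65, 66], [24, 25, 26, 61], [24, 61, 62, 65], [25, 26, 63, 64], [25, 64, 67, 68],
   [26, 27, 28, 35], [26, 27, 54, 55], [26, 35, 44, 63], [26, 55, 60, 61], [27, 28, 49, 50],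
   [27, 50, 51, 54], [28, 29, 34, 35], [28, 29, 48, 49], [29, 30, 31, 48], [29, 30, 33, 34],
   [30, 31, 32, 33], [31, 32, 47, 48], [32, 33, 34, 47], [34, 35, 46, 47], [35, 36, 41, 46],
   [35, 36, 43, 44], [36, 37, 38, 43], [36, 37, 40, 41], [37, 38, 39, 40], [38, 39, 42, 43],
   [39, 40, 41, 42], [41, 42, 45, 46], [42, 43, 44, 45], [44, 45, 62, 63], [45, 46, 61, 62],
   [46, 47, 48, 49], [46, 49, 50, 61], [50, 51, 60, 61], [51, 52, 53, 54], [51, 52, 59, 60],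
   [53, 54, 55, 56], [55, 56, 59, 60], [56, 57, 58, 59], [62, 63, 64, 65], [64, 65, 66, 67],
   [70, 71, 72, 73], [72, 73, 74, 79], [72, 77, 78, 79], [73, 74, 75, 76], [74, 75, 78, 79],
   [75, 76, 77, 78]]

/-- The vertex mask of the face of a cell, which is spanned by the edges in the class. -/
def cellFace (l : List ℕ) : ℕ := List.rec 0 (fun t _ r => Nat.lor (edgeMask t) r) l

/-- The dimension of a cell with the given edges. -/
def cellRank (l : List ℕ) : ℕ := Nat.log2 l.length

/-- The edges with the numbers `s` and `t` are opposite in a `2`-face. -/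
def isOppositePair (s t : ℕ) : Bool :=
  cond (Nat.beq (Nat.land (edgeMask s) (edgeMask t)) 0)
    (memL (Nat.lor (edgeMask s) (edgeMask t)) (faceMasks 2)) false

/-- Consecutive edges are opposite in a `2`-face. -/
def isOppositePath : List ℕ → Bool
  | s :: t :: l => cond (isOppositePair s t) (isOppositePath (t :: l)) false
  | _ => true

lemma isOppositePath_all : isOppositePath (belowL 80) = true := by decide +kernel

lemma surfaceEdge_check : cond (allL (fun e => memL (maskOf e) (faceMasks 1)) surfaceEdge)
    (nodupL (surfaceEdge.map maskOf)) false = true := by decide +kernel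

lemma surfaceCell_check : allL (fun l =>
    cond (allL (fun t => Nat.blt t 80) l) (cond (memL (cellFace l) (faceMasks (cellRank l + 1)))
      (isOppositePath l) false) false) surfaceCell = true := by decide +kernel

/-- Every face of dimension `k + 1` that contains an edge of the class is the face of a cell that
contains this edge. -/
def isCompleteSurface (k : ℕ) : Bool :=
  allL (fun t => allL (fun g => cond (Nat.beq (Nat.land (edgeMask t) g) (edgeMask t))
    (anyL (fun l => cond (Nat.beq (cellFace l) g) (memL t l) false) surfaceCell) true)
    (faceMasks (k + 1))) (belowL 80)

lemma isCompleteSurface_zero : isCompleteSurface 0 = true := by decide +kernel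
lemma isCompleteSurface_one : isCompleteSurface 1 = true := by decide +kernel
lemma isCompleteSurface_two : isCompleteSurface 2 = true := by decide +kernel

/-- The code of a cell: the vertex mask of its face and the mask of its edges. -/
def cellCode (l : List ℕ) : ℕ × ℕ := (cellFace l, maskOf l)

/-- The `1`-cells, each consisting of two opposite edges, have no edge or both edges in the class
of a given cell if their face lies in the face of that cell. -/
lemma surfaceCell_closed : allL (fun l => allL (fun q =>
    cond (Nat.beq (Nat.land q.1 l.1) q.1) ((fun s => cond (Nat.beq s 0) true (Nat.beq s q.2))
      (Nat.land q.2 l.2)) true)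
    ((filterL (fun q => Nat.beq (cellRank q) 1) surfaceCell).map cellCode))
      (surfaceCell.map cellCode) = true := by
  decide +kernel

lemma surfaceCell_rank : surfaceCell.map cellRank =
    List.replicate 80 0 ++ List.replicate 160 1 ++ List.replicate 80 2 := by decide +kernel

lemma surfaceCell_length : allL (fun l => Nat.beq l.length (Nat.pow 2 (cellRank l))) surfaceCell =
    true := by decide +kernel

lemma surfaceCell_nodup : nodupL (surfaceCell.map maskOf) = true := by decide +kernel

/-! ### The dual surface -/

/-- The edge with the number `t` in the parallel class. -/
def classEdge (t : ℕ) : Set (EuclideanSpace ℝ (Fin 4)) := faceOf (edgeMask t)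

lemma length_surfaceEdge : surfaceEdge.length = 80 := by decide +kernel

lemma length_surfaceCell : surfaceCell.length = 320 := by decide +kernel

lemma surfaceEdge_spec : (∀ e ∈ surfaceEdge, maskOf e ∈ faceMasks 1) ∧
    (surfaceEdge.map maskOf).Nodup := by
  have h := surfaceEdge_check
  simp only [Bool.cond_eq_true_distrib, Bool.false_eq_true, if_false_right, allL_iff, memL_iff] at h
  exact ⟨h.1, nodup_of_nodupL h.2⟩

lemma edgeMask_mem {t : ℕ} (ht : t < 80) : edgeMask t ∈ faceMasks 1 := by
  refine surfaceEdge_spec.1 _ ?_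
  rw [List.getD_eq_getElem _ _ (ht.trans_eq length_surfaceEdge.symm)]
  exact List.getElem_mem _

lemma edgeMask_inj {s t : ℕ} (hs : s < 80) (ht : t < 80) (h : edgeMask s = edgeMask t) : s = t := by
  have hs' := hs.trans_eq length_surfaceEdge.symm
  have ht' := ht.trans_eq length_surfaceEdge.symm
  rw [edgeMask, edgeMask, List.getD_eq_getElem _ _ hs', List.getD_eq_getElem _ _ ht'] at h
  have h1 : (surfaceEdge.map maskOf)[s]'(by simpa using hs') =
      (surfaceEdge.map maskOf)[t]'(by simpa using ht') := by simpa using h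
  exact (List.Nodup.getElem_inj_iff surfaceEdge_spec.2).1 h1

lemma classEdge_inj {s t : ℕ} (hs : s < 80) (ht : t < 80) (h : classEdge s = classEdge t) : s = t :=
  edgeMask_inj hs ht (faceOf_inj (by norm_num) (edgeMask_mem hs) (by norm_num) (edgeMask_mem ht) h)

lemma isFace_classEdge {t : ℕ} (ht : t < 80) : IsFace polytope 1 (classEdge t) :=
  isFace_faceOf (by norm_num) (edgeMask_mem ht)

lemma cell_lt {l : List ℕ} (hl : l ∈ surfaceCell) {t : ℕ} (ht : t ∈ l) : t < 80 := by
  have h := allL_iff.1 surfaceCell_check l hl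
  simp only [Bool.cond_eq_true_distrib, Bool.false_eq_true, if_false_right, allL_iff,
    Nat.blt_eq] at h
  exact h.1 t ht

lemma cellFace_mem {l : List ℕ} (hl : l ∈ surfaceCell) :
    cellFace l ∈ faceMasks (cellRank l + 1) := by
  have h := allL_iff.1 surfaceCell_check l hl
  simp only [Bool.cond_eq_true_distrib, Bool.false_eq_true, if_false_right, memL_iff] at h
  exact h.2.1

lemma cell_path {l : List ℕ} (hl : l ∈ surfaceCell) : isOppositePath l = true := by
  have h := allL_iff.1 surfaceCell_check l hl
  simp only [Bool.cond_eq_true_distrib, Bool.false_eq_true, if_false_right] at h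
  exact h.2.2

lemma cellRank_lt {l : List ℕ} (hl : l ∈ surfaceCell) : cellRank l < 3 := by
  have h : cellRank l ∈ surfaceCell.map cellRank := List.mem_map_of_mem hl
  rw [surfaceCell_rank] at h
  simp only [List.mem_append, List.mem_replicate] at h
  omega

lemma length_cell {l : List ℕ} (hl : l ∈ surfaceCell) : l.length = 2 ^ cellRank l :=
  Nat.eq_of_beq_eq_true (allL_iff.1 surfaceCell_length l hl)

lemma cellRank_succ_lt {l : List ℕ} (hl : l ∈ surfaceCell) : cellRank l + 1 < 4 := by
  have := cellRank_lt hl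
  omega

lemma dim_cellFace {l : List ℕ} (hl : l ∈ surfaceCell) :
    dim (faceOf (cellFace l)) = cellRank l + 1 :=
  dim_faceOf (cellRank_succ_lt hl) (cellFace_mem hl)

lemma testBit_cellFace {l : List ℕ} {i : ℕ} :
    (cellFace l).testBit i = true ↔ ∃ t ∈ l, (edgeMask t).testBit i = true := by
  induction l with
  | nil => simp [cellFace]
  | cons a l ih =>
    have : cellFace (a :: l) = edgeMask a ||| cellFace l := rfl
    rw [this, Nat.testBit_lor, Bool.or_eq_true, ih]
    simp

lemma classEdge_subset_cellFace {l : List ℕ} {t : ℕ} (ht : t ∈ l) :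
    classEdge t ⊆ faceOf (cellFace l) :=
  hull_mono fun _ hi => testBit_cellFace.2 ⟨t, ht, hi⟩

/-- Every face that contains an edge of the class is the face of a cell that contains this edge. -/
lemma exists_cell {t k g : ℕ} (ht : t < 80) (hk : k < 4) (hg : g ∈ faceMasks k)
    (h : classEdge t ⊆ faceOf g) : ∃ l ∈ surfaceCell, cellFace l = g ∧ t ∈ l := by
  have h1 := (faceOf_subset_iff (by norm_num) (edgeMask_mem ht) hk hg).1 h
  obtain ⟨k, rfl⟩ : ∃ k', k = k' + 1 := by
    refine Nat.exists_eq_succ_of_ne_zero fun h0 => ?_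
    subst h0
    have h2 := dim_faceOf (by norm_num) (edgeMask_mem ht)
    have h3 := dim_faceOf (by norm_num) hg
    by_cases heq : edgeMask t = g
    · rw [heq] at h2; omega
    · have := dim_faceOf_lt (by norm_num) (edgeMask_mem ht) (by norm_num) hg h heq
      omega
  have hc : isCompleteSurface k = true := by
    have h0 := isCompleteSurface_zero
    have h1 := isCompleteSurface_one
    have h2 := isCompleteSurface_two
    have hk3 : k < 3 := by omega
    interval_cases k
    exacts [h0, h1, h2]
  have h2 := allL_iff.1 (allL_iff.1 hc t (mem_belowL.2 ht)) g hg
  have h3 : Nat.beq (Nat.land (edgeMask t) g) (edgeMask t) = true := by rw [Nat.beq_eq]; exact h1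
  rw [h3, cond_true] at h2
  obtain ⟨l, hl, hl'⟩ := anyL_iff.1 h2
  simp only [Bool.cond_eq_true_distrib, Bool.false_eq_true, if_false_right, Nat.beq_eq,
    memL_iff] at hl'
  exact ⟨l, hl, hl'⟩

lemma disjoint_faceOf_iff {k' m m' : ℕ} (hk' : k' < 4)
    (hm' : m' ∈ faceMasks k') : Disjoint (faceOf m) (faceOf m') ↔
      ∀ i < 72, m.testBit i = true → m'.testBit i ≠ true := by
  rw [Set.disjoint_iff_inter_eq_empty, faceOf, faceOf,
    hvRep_vertexPoint.hull_inter (isClosedIdx_faceMasks hk' hm')]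
  constructor
  · intro h i hi h1 h2
    have : vertexPoint ⟨i, hi⟩ ∈ hull vertexPoint (maskSet 72 m ∩ maskSet 72 m') :=
      vertex_mem_hull ⟨h1, h2⟩
    rw [h] at this
    exact this
  · intro h
    have : maskSet 72 m ∩ maskSet 72 m' = ∅ := by
      ext i
      simp only [Set.mem_inter_iff, Set.mem_empty_iff_false, iff_false, not_and]
      exact fun h1 => h i i.2 h1
    rw [this]
    simp [hull]

lemma oppositeEdges_symm {P F e e' : Set (EuclideanSpace ℝ (Fin 4))} (h : OppositeEdges P F e e') :
    OppositeEdges P F e' e := by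
  obtain ⟨G, h1, h2, h3, h4, h5, h6, h7⟩ := h
  exact ⟨G, h1, h2, h4, h3, h6, h5, h7.symm⟩

/-- A set of edges that is closed under opposition is closed under parallelism. -/
lemma ParallelEdges.mem_of_closed {P F e e' : Set (EuclideanSpace ℝ (Fin 4))}
    {A : Set (Set (EuclideanSpace ℝ (Fin 4)))}
    (hA : ∀ e ∈ A, ∀ e', OppositeEdges P F e e' → e' ∈ A) (h : ParallelEdges P F e e')
    (he : e ∈ A) : e' ∈ A := by
  have h' : e ∈ A ↔ e' ∈ A := by
    clear he
    induction h with
    | rel x y hxy => exact ⟨fun hx => hA x hx y hxy, fun hy => hA y hy x (oppositeEdges_symm hxy)⟩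
    | refl => rfl
    | symm _ _ _ ih => exact ih.symm
    | trans _ _ _ _ _ ih ih' => exact ih.trans ih'
  exact h'.1 he

lemma oppositeEdges_of_isOppositePair {s t : ℕ} (hs : s < 80) (ht : t < 80)
    (h : isOppositePair s t = true) {F : Set (EuclideanSpace ℝ (Fin 4))}
    (hF : faceOf (edgeMask s ||| edgeMask t) ⊆ F) :
    OppositeEdges polytope F (classEdge s) (classEdge t) := by
  unfold isOppositePair at h
  simp only [Bool.cond_eq_true_distrib, Bool.false_eq_true, if_false_right, Nat.beq_eq,
    memL_iff] at h
  refine ⟨_, isFace_faceOf (by norm_num) h.2, hF, isFace_classEdge hs, isFace_classEdge ht,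
    hull_mono fun i hi => ?_, hull_mono fun i hi => ?_, ?_⟩
  · change (edgeMask s ||| edgeMask t).testBit i = true
    rw [Nat.testBit_lor, Bool.or_eq_true]
    exact Or.inl hi
  · change (edgeMask s ||| edgeMask t).testBit i = true
    rw [Nat.testBit_lor, Bool.or_eq_true]
    exact Or.inr hi
  · refine (disjoint_faceOf_iff (k' := 1) (by norm_num) (edgeMask_mem ht)).2 fun i _ h1 h2 => ?_
    have h3 : (edgeMask s &&& edgeMask t).testBit i = true := by rw [Nat.testBit_land, h1, h2]; rfl
    rw [show edgeMask s &&& edgeMask t = 0 from h.1] at h3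
    simp at h3

/-- An edge that is opposite to an edge of the class belongs to the class, and the two edges form a
`1`-cell. -/
lemma OppositeEdges.exists_cell {F e' : Set (EuclideanSpace ℝ (Fin 4))} {s : ℕ} (hs : s < 80)
    (h : OppositeEdges polytope F (classEdge s) e') : ∃ q ∈ surfaceCell, cellRank q = 1 ∧ s ∈ q ∧
      faceOf (cellFace q) ⊆ F ∧ ∃ s' ∈ q, e' = classEdge s' := by
  obtain ⟨G, hG, hGF, -, he', h1, h2, h3⟩ := h
  obtain ⟨g, hg, rfl⟩ := (isFace_iff (by norm_num)).1 hG
  obtain ⟨x, hx, rfl⟩ := (isFace_iff (by norm_num)).1 he'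
  obtain ⟨q, hq, rfl, hsq⟩ := CubicalPolytope.exists_cell hs (by norm_num) hg h1
  have hrank : cellRank q = 1 := by
    have h4 := dim_cellFace hq
    have h5 := dim_faceOf (by norm_num) hg
    omega
  refine ⟨q, hq, hrank, hsq, hGF, ?_⟩
  have hlen := length_cell hq
  rw [hrank, pow_one, List.length_eq_two] at hlen
  obtain ⟨a, b, rfl⟩ := hlen
  have hsub := land_eq_left_iff.1 ((faceOf_subset_iff (by norm_num) hx (by norm_num) hg).1 h2)
  have hlt := faceMasks_lt (by norm_num) hx
  have hdis := (disjoint_faceOf_iff (k' := 1) (by norm_num) hx).1 h3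
  have key : ∀ t ∈ [a, b], (∀ r ∈ [a, b], r = s ∨ r = t) → faceOf x = classEdge t := by
    intro t ht hall
    have hsub' : faceOf x ⊆ classEdge t := by
      refine hull_mono fun i hi => ?_
      obtain ⟨r, hr, hri⟩ := testBit_cellFace.1 (hsub i hi)
      rcases hall r hr with rfl | rfl
      · exact absurd hi (hdis i i.2 hri)
      · exact hri
    have ht80 := cell_lt hq ht
    by_contra hne
    have h6 := dim_faceOf_lt (by norm_num) hx (by norm_num) (edgeMask_mem ht80) hsub'
      fun h => hne (by rw [h]; rfl)
    rw [dim_faceOf (by norm_num) hx, dim_faceOf (by norm_num) (edgeMask_mem ht80)] at h6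
    exact lt_irrefl _ h6
  simp only [List.mem_cons, List.not_mem_nil, or_false] at hsq
  rcases hsq with rfl | rfl
  · exact ⟨b, by simp, key b (by simp) (by simp)⟩
  · exact ⟨a, by simp, key a (by simp) (by simp)⟩

lemma rel_of_isOppositePath {R : ℕ → ℕ → Prop} (hR : Equivalence R) {l : List ℕ}
    (hl : isOppositePath l = true)
    (h : ∀ s ∈ l, ∀ t ∈ l, isOppositePair s t = true → R s t) {s t : ℕ} (hs : s ∈ l)
    (ht : t ∈ l) : R s t := by
  have key : ∀ (l : List ℕ) (a : ℕ), isOppositePath (a :: l) = true →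
      (∀ s ∈ a :: l, ∀ t ∈ a :: l, isOppositePair s t = true → R s t) →
      ∀ t ∈ a :: l, R a t := by
    intro l
    induction l with
    | nil =>
      intro a _ _ t ht
      rw [List.mem_singleton] at ht
      exact ht ▸ hR.refl a
    | cons b l ih =>
      intro a hp h t ht
      have hp' : cond (isOppositePair a b) (isOppositePath (b :: l)) false = true := hp
      simp only [Bool.cond_eq_true_distrib, Bool.false_eq_true, if_false_right] at hp'
      rcases List.mem_cons.1 ht with rfl | ht
      · exact hR.refl _
      · exact hR.trans (h a (by simp) b (by simp) hp'.1)
          (ih b hp'.2 (fun s hs t ht => h s (List.mem_cons_of_mem _ hs) t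
            (List.mem_cons_of_mem _ ht)) t ht)
  cases l with
  | nil => simp at hs
  | cons a l => exact hR.trans (hR.symm (key l a hl h s hs)) (key l a hl h t ht)

lemma parallelEdges_equivalence (P F : Set (EuclideanSpace ℝ (Fin 4))) :
    Equivalence fun s t => ParallelEdges P F (classEdge s) (classEdge t) :=
  ⟨fun _ => Relation.EqvGen.refl _, fun h => Relation.EqvGen.symm _ _ h,
    fun h h' => Relation.EqvGen.trans _ _ _ h h'⟩

/-- The edges of a cell form a parallel class of its face. -/
lemma cell_isClass {l : List ℕ} (hl : l ∈ surfaceCell) {t : ℕ} (ht : t ∈ l) :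
    classEdge '' {s | s ∈ l} =
      {e' | ParallelEdges polytope (faceOf (cellFace l)) (classEdge t) e'} := by
  apply Set.Subset.antisymm
  · rintro _ ⟨s, hs, rfl⟩
    refine rel_of_isOppositePath (parallelEdges_equivalence polytope (faceOf (cellFace l)))
      (cell_path hl) (fun a ha b hb hab => Relation.EqvGen.rel _ _ ?_) ht hs
    refine oppositeEdges_of_isOppositePair (cell_lt hl ha) (cell_lt hl hb) hab
      (hull_mono fun i hi => ?_)
    have hi' : (edgeMask a ||| edgeMask b).testBit i = true := hi
    rw [Nat.testBit_lor, Bool.or_eq_true] at hi'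
    exact testBit_cellFace.2 (hi'.elim (fun h => ⟨a, ha, h⟩) fun h => ⟨b, hb, h⟩)
  · intro e' he'
    refine ParallelEdges.mem_of_closed ?_ he' ⟨t, ht, rfl⟩
    rintro _ ⟨s, hs, rfl⟩ e' he'
    obtain ⟨q, hq, hrank, hsq, hqF, s', hs', rfl⟩ := he'.exists_cell (cell_lt hl hs)
    have hc := allL_iff.1 (allL_iff.1 surfaceCell_closed _ (List.mem_map_of_mem hl)) _
      (List.mem_map_of_mem (mem_filterL.2 ⟨hq, by rw [hrank]; rfl⟩))
    have h1 := (faceOf_subset_iff (cellRank_succ_lt hq) (cellFace_mem hq) (cellRank_succ_lt hl)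
      (cellFace_mem hl)).1 hqF
    have h1' : Nat.beq (Nat.land (cellCode q).1 (cellCode l).1) (cellCode q).1 = true := by
      rw [Nat.beq_eq]; exact h1
    simp only [h1', cond_true, Bool.cond_eq_true_distrib, Nat.beq_eq, if_true_left] at hc
    have h2 : (maskOf q &&& maskOf l).testBit s = true := by
      rw [Nat.testBit_land, testBit_maskOf.2 hsq, testBit_maskOf.2 hs]; rfl
    have h3 : maskOf q &&& maskOf l = maskOf q := by
      by_contra hne
      refine hne (hc fun h0 => ?_)
      rw [show maskOf q &&& maskOf l = 0 from h0] at h2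
      simp at h2
    exact ⟨s', testBit_maskOf.1 (land_eq_left_iff.1 h3 s' (testBit_maskOf.2 hs')), rfl⟩

/-- The edges of the cell with the number `i`. -/
def cellEdges (i : Fin 320) : List ℕ := surfaceCell.getD i []

lemma cellEdges_mem (i : Fin 320) : cellEdges i ∈ surfaceCell := by
  rw [cellEdges, List.getD_eq_getElem _ _ (i.2.trans_eq length_surfaceCell.symm)]
  exact List.getElem_mem _

lemma exists_cellEdges {l : List ℕ} (hl : l ∈ surfaceCell) : ∃ i, cellEdges i = l := by
  obtain ⟨n, hn, rfl⟩ := List.mem_iff_getElem.1 hl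
  exact ⟨⟨n, hn.trans_eq length_surfaceCell⟩, List.getD_eq_getElem _ _ hn⟩

lemma cellEdges_ne_nil (i : Fin 320) : ∃ t, t ∈ cellEdges i := by
  refine List.exists_mem_of_length_pos ?_
  rw [length_cell (cellEdges_mem i)]
  positivity

/-- The vertex mask of the face of the cell with the number `i`. -/
def cellMask (i : Fin 320) : ℕ := cellFace (cellEdges i)

/-- The dimension of the cell with the number `i`. -/
def rank (i : Fin 320) : ℕ := cellRank (cellEdges i)

lemma rank_lt (i : Fin 320) : rank i < 3 := cellRank_lt (cellEdges_mem i)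

lemma rank_succ_lt (i : Fin 320) : rank i + 1 < 4 := cellRank_succ_lt (cellEdges_mem i)

lemma cellMask_mem (i : Fin 320) : cellMask i ∈ faceMasks (rank i + 1) :=
  cellFace_mem (cellEdges_mem i)

/-- The cell with the number `i` of the dual surface. -/
def cellAt (i : Fin 320) : DerivCell polytope where
  face := faceOf (cellMask i)
  cls := classEdge '' {s | s ∈ cellEdges i}
  isExposed := isExposed_faceOf (rank_succ_lt i) (cellMask_mem i)
  nonempty := nonempty_faceOf (rank_succ_lt i) (cellMask_mem i)
  proper := faceOf_ne_polytope (rank_succ_lt i) (cellMask_mem i)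
  isClass := by
    obtain ⟨t, ht⟩ := cellEdges_ne_nil i
    exact ⟨classEdge t, isFace_classEdge (cell_lt (cellEdges_mem i) ht),
      classEdge_subset_cellFace ht, cell_isClass (cellEdges_mem i) ht⟩

lemma dim_cellAt (i : Fin 320) : dim (cellAt i).face = rank i + 1 :=
  dim_faceOf (rank_succ_lt i) (cellMask_mem i)

lemma cellAt_face_subset_iff {i j : Fin 320} :
    (cellAt i).face ⊆ (cellAt j).face ↔ cellMask i &&& cellMask j = cellMask i :=
  faceOf_subset_iff (rank_succ_lt i) (cellMask_mem i) (rank_succ_lt j) (cellMask_mem j)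

lemma cellAt_cls_subset_iff {i j : Fin 320} :
    (cellAt i).cls ⊆ (cellAt j).cls ↔ ∀ t ∈ cellEdges i, t ∈ cellEdges j := by
  constructor
  · intro h t ht
    obtain ⟨s, hs, hst⟩ := h ⟨t, ht, rfl⟩
    rw [← classEdge_inj (cell_lt (cellEdges_mem j) hs) (cell_lt (cellEdges_mem i) ht) hst]
    exact hs
  · rintro h _ ⟨t, ht, rfl⟩
    exact ⟨t, h t ht, rfl⟩

/-- Two cells are comparable if so are their faces, and they have a common edge. -/
lemma cellAt_le_iff {i j : Fin 320} {t : ℕ} (hi : t ∈ cellEdges i) (hj : t ∈ cellEdges j) :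
    cellAt i ≤ cellAt j ↔ cellMask i &&& cellMask j = cellMask i := by
  rw [← cellAt_face_subset_iff]
  refine ⟨fun h => h.1, fun h => ⟨h, ?_⟩⟩
  have h1 : (cellAt i).cls = _ := cell_isClass (cellEdges_mem i) hi
  have h2 : (cellAt j).cls = _ := cell_isClass (cellEdges_mem j) hj
  rw [h1, h2]
  intro e' he'
  refine Relation.EqvGen.mono ?_ _ _ he'
  rintro a b ⟨G, hG, hGF, hr⟩
  exact ⟨G, hG, hGF.trans h, hr⟩

lemma cellAt_injective : Function.Injective cellAt := by
  intro i j h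
  have hb : maskOf (cellEdges i) = maskOf (cellEdges j) := by
    refine Nat.eq_of_testBit_eq fun t => ?_
    rw [Bool.eq_iff_iff, testBit_maskOf, testBit_maskOf]
    exact ⟨cellAt_cls_subset_iff.1 (congrArg DerivCell.cls h).subset t,
      cellAt_cls_subset_iff.1 (congrArg DerivCell.cls h).symm.subset t⟩
  have hi := i.2.trans_eq length_surfaceCell.symm
  have hj := j.2.trans_eq length_surfaceCell.symm
  rw [cellEdges, cellEdges, List.getD_eq_getElem _ _ hi, List.getD_eq_getElem _ _ hj] at hb
  have h1 : (surfaceCell.map maskOf)[(i : ℕ)]'(by simpa using hi) =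
      (surfaceCell.map maskOf)[(j : ℕ)]'(by simpa using hj) := by simpa using hb
  exact Fin.ext ((List.Nodup.getElem_inj_iff (nodup_of_nodupL surfaceCell_nodup)).1 h1)

/-- A cell of the derivative complex whose class contains one of the given edges. -/
lemma exists_cellAt {c : DerivCell polytope} {t : ℕ} (ht : t < 80) (h : classEdge t ∈ c.cls) :
    ∃ i, cellAt i = c ∧ t ∈ cellEdges i := by
  obtain ⟨k, hk, g, hg, hface⟩ := exists_eq_faceOf c.isExposed c.nonempty c.proper
  obtain ⟨e, he, heF, hcls⟩ := c.isClass
  rw [hcls] at h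
  have hsub : classEdge t ⊆ c.face := by
    refine ParallelEdges.mem_of_closed (A := {e' | e' ⊆ c.face}) ?_ h heF
    rintro a - b ⟨G, hG, hGF, -, -, -, hb, -⟩
    exact hb.trans hGF
  rw [hface] at hsub
  obtain ⟨l, hl, hlg, htl⟩ := exists_cell ht hk hg hsub
  obtain ⟨i, rfl⟩ := exists_cellEdges hl
  have hF : (cellAt i).face = c.face := by rw [hface, ← hlg]; rfl
  refine ⟨i, DerivCell.ext hF ?_, htl⟩
  have h1 : (cellAt i).cls = _ := cell_isClass hl htl
  rw [h1, hcls]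
  change {e' | ParallelEdges polytope (cellAt i).face (classEdge t) e'} = _
  rw [hF]
  ext e'
  exact ⟨fun h' => Relation.EqvGen.trans _ _ _ h h',
    fun h' => Relation.EqvGen.trans _ _ _ (Relation.EqvGen.symm _ _ h) h'⟩

lemma cellEdges_lt_80 : ∀ t : Fin 80, cellEdges (Fin.ofNat 320 t) = [(t : ℕ)] := by
  decide +kernel

lemma cellAt_edge_le {t : ℕ} {j : Fin 320} (h : t ∈ cellEdges j) :
    cellAt (Fin.ofNat 320 t) ≤ cellAt j := by
  have ht := cell_lt (cellEdges_mem j) h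
  have h1 := cellEdges_lt_80 ⟨t, ht⟩
  have h2 : t ∈ cellEdges (Fin.ofNat 320 t) := by rw [h1]; simp
  refine (cellAt_le_iff h2 h).2 (land_eq_left_iff.2 fun i hi => ?_)
  rw [cellMask, h1] at hi
  obtain ⟨s, hs, hsi⟩ := testBit_cellFace.1 hi
  rw [List.mem_singleton] at hs
  subst hs
  exact testBit_cellFace.2 ⟨_, h, hsi⟩

/-- The dual surface. -/
def surface : Set (DerivCell polytope) := Set.range cellAt

/-- The cells with edges in the parallel class form a connected component: the class is closed
under opposition, and any two of its edges are joined by a path of opposite edges. -/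
lemma isDualManifold_surface : IsDualManifold polytope surface := by
  have hR : Equivalence fun s t : ℕ =>
      Relation.EqvGen (· ≤ ·) (cellAt (Fin.ofNat 320 s)) (cellAt (Fin.ofNat 320 t)) :=
    ⟨fun _ => Relation.EqvGen.refl _, fun h => Relation.EqvGen.symm _ _ h,
      fun h h' => Relation.EqvGen.trans _ _ _ h h'⟩
  have hlink : ∀ s < 80, ∀ t < 80,
      Relation.EqvGen (· ≤ ·) (cellAt (Fin.ofNat 320 s)) (cellAt (Fin.ofNat 320 t)) := by
    intro s hs t ht
    refine rel_of_isOppositePath hR isOppositePath_all (fun a ha b hb hab => ?_)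
      (mem_belowL.2 hs) (mem_belowL.2 ht)
    rw [mem_belowL] at ha hb
    obtain ⟨q, hq, -, haq, -, b', hb', hbb'⟩ := (oppositeEdges_of_isOppositePair ha hb hab
      (F := polytope) (hull_mono (Set.subset_univ _))).exists_cell ha
    have := classEdge_inj hb (cell_lt hq hb') hbb'
    subst this
    obtain ⟨i, rfl⟩ := exists_cellEdges hq
    exact Relation.EqvGen.trans _ _ _ (Relation.EqvGen.rel _ _ (cellAt_edge_le haq))
      (Relation.EqvGen.symm _ _ (Relation.EqvGen.rel _ _ (cellAt_edge_le hb')))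
  refine ⟨cellAt (Fin.ofNat 320 0), Set.Subset.antisymm ?_ ?_⟩
  · rintro _ ⟨i, rfl⟩
    obtain ⟨t, ht⟩ := cellEdges_ne_nil i
    exact Relation.EqvGen.trans _ _ _ (hlink 0 (by norm_num) t (cell_lt (cellEdges_mem i) ht))
      (Relation.EqvGen.rel _ _ (cellAt_edge_le ht))
  · intro c hc
    have key : ∀ c c' : DerivCell polytope, Relation.EqvGen (· ≤ ·) c c' →
        (c ∈ surface ↔ c' ∈ surface) := by
      intro c c' h
      induction h with
      | rel c c' hle =>
        constructor
        · rintro ⟨i, rfl⟩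
          obtain ⟨t, ht⟩ := cellEdges_ne_nil i
          obtain ⟨j, hj, -⟩ := exists_cellAt (cell_lt (cellEdges_mem i) ht) (hle.2 ⟨t, ht, rfl⟩)
          exact ⟨j, hj⟩
        · rintro ⟨j, rfl⟩
          obtain ⟨e, -, -, hcls⟩ := c.isClass
          have he : e ∈ c.cls := by rw [hcls]; exact Relation.EqvGen.refl _
          obtain ⟨t, ht, rfl⟩ := hle.2 he
          obtain ⟨i, hi, -⟩ := exists_cellAt (cell_lt (cellEdges_mem j) ht) he
          exact ⟨i, hi⟩
      | refl => rfl
      | symm _ _ _ ih => exact ih.symm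
      | trans _ _ _ _ _ ih ih' => exact ih.trans ih'
    exact (key _ _ hc).1 ⟨_, rfl⟩

lemma cellNumber_surface (k : ℕ) :
    cellNumber surface k = (Finset.univ.filter fun i => rank i = k).card := by
  have : {c ∈ surface | dim c.face = k + 1} =
      cellAt '' ((Finset.univ.filter fun i => rank i = k : Finset (Fin 320)) : Set (Fin 320)) := by
    ext c
    constructor
    · rintro ⟨⟨i, rfl⟩, hi⟩
      rw [dim_cellAt] at hi
      exact ⟨i, by simpa using hi, rfl⟩
    · rintro ⟨i, hi, rfl⟩
      refine ⟨⟨i, rfl⟩, ?_⟩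
      rw [dim_cellAt]
      simpa using hi
  rw [cellNumber, this, Set.ncard_image_of_injective _ cellAt_injective, Set.ncard_coe_finset]

lemma rank_eq : ∀ i : Fin 320, rank i = if (i : ℕ) < 80 then 0 else if (i : ℕ) < 240 then 1 else 2 := by
  decide +kernel

lemma cellNumber_surface_eq : cellNumber surface 0 = 80 ∧ cellNumber surface 1 = 160 ∧
    cellNumber surface 2 = 80 := by
  simp only [cellNumber_surface, rank_eq]
  decide +kernel

/-! ### The flags of the dual surface -/

/-- The numbers of the two `2`-cells that contain the `1`-cell with the number `n + 80`. -/
def upperCell : List (List ℕ) :=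
  [[240, 241], [240, 242], [242, 243], [241, 243], [244, 245], [240, 244], [241, 246],
   [246, 247], [245, 247], [244, 248], [248, 249], [245, 249], [250, 251], [248, 250],
   [244, 251], [250, 252], [252, 253], [251, 253], [250, 254], [252, 255], [254, 255],
   [254, 256], [248, 256], [257, 258], [257, 259], [259, 260], [254, 258], [256, 260],
   [240, 261], [257, 261], [251, 258], [261, 262], [242, 262], [263, 264], [261, 263],
   [262, 264], [263, 265], [264, 265], [263, 266], [265, 266], [257, 266], [266, 267],
   [259, 267], [265, 267], [264, 267], [259, 262], [242, 260], [243, 268], [260, 268],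
   [243, 269], [269, 270], [268, 270], [241, 271], [269, 271], [271, 272], [246, 272],
   [273, 274], [271, 274], [272, 273], [273, 275], [275, 276], [274, 276], [275, 277],
   [277, 278], [273, 278], [279, 280], [279, 281], [280, 282], [275, 282], [277, 281],
   [279, 283], [283, 284], [280, 284], [285, 286], [279, 285], [283, 286], [287, 288],
   [285, 288], [286, 287], [287, 289], [288, 289], [289, 290], [287, 290], [289, 291],
   [290, 291], [288, 291], [285, 292], [291, 292], [293, 294], [281, 294], [292, 293],
   [295, 296], [293, 296], [294, 295], [295, 297], [296, 297], [297, 298], [295, 298],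
   [297, 299], [298, 299], [296, 299], [299, 300], [293, 300], [298, 301], [300, 301],
   [294, 301], [301, 302], [281, 302], [300, 303], [302, 303], [292, 304], [304, 305],
   [303, 305], [290, 304], [286, 304], [283, 305], [284, 306], [305, 306], [307, 308],
   [284, 307], [306, 308], [252, 307], [253, 308], [307, 309], [255, 309], [280, 309],
   [309, 310], [282, 310], [255, 311], [310, 311], [258, 311], [253, 311], [308, 310],
   [282, 306], [276, 303], [302, 312], [276, 312], [277, 312], [312, 313], [278, 313],
   [274, 313], [269, 313], [270, 278], [270, 272], [246, 268], [256, 314], [247, 314],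
   [249, 314], [314, 315], [249, 316], [315, 316], [315, 317], [247, 317], [317, 318],
   [315, 318], [317, 319], [318, 319], [245, 319], [316, 319], [316, 318]]

/-- The flags of cells, as triples of numbers. -/
def flagTriple : List (ℕ × ℕ × ℕ) :=
  (belowL 160).flatMap fun n => (surfaceCell.getD (n + 80) []).flatMap fun e =>
    (upperCell.getD n []).map fun f => (e, n + 80, f)

/-- The bit mask of a triple. -/
def tripleMask (t : ℕ × ℕ × ℕ) : ℕ :=
  Nat.lor (bitMask t.1) (Nat.lor (bitMask t.2.1) (bitMask t.2.2))

/-- Comparison of cells by their codes. -/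
def codeLE (p q : ℕ × ℕ) : Bool :=
  cond (Nat.beq (Nat.land p.1 q.1) p.1) (Nat.beq (Nat.land p.2 q.2) p.2) false

/-- The codes of the cells with numbers from `n` on, for `k` numbers in descending order. -/
def codesFrom (n k : ℕ) : List (ℕ × ℕ × ℕ) :=
  (belowL k).map fun i => (i + n, cellCode (surfaceCell.getD (i + n) []))

lemma upperCell_check : allL (fun q => allL (fun f =>
    cond (codeLE q.2 f.2) (memL f.1 (upperCell.getD (Nat.sub q.1 80) [])) true)
      (codesFrom 240 80)) (codesFrom 80 160) = true := by
  decide +kernel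

lemma flagTriple_check : allL (fun t => codeLE (cellCode (surfaceCell.getD t.2.1 []))
    (cellCode (surfaceCell.getD t.2.2 []))) flagTriple = true := by
  decide +kernel

lemma flagTriple_bounds : allL (fun t => cond (Nat.blt t.1 80) (cond (Nat.blt t.2.2 320)
    (Nat.ble 240 t.2.2) false) false) flagTriple = true := by
  decide +kernel

lemma between_check : allL (fun f => allL (fun e =>
    anyL (fun q => cond (hasBit q.2.2 e) (codeLE q.2 f.2) false) (codesFrom 80 160))
      (surfaceCell.getD f.1 [])) (codesFrom 240 80) = true := by
  decide +kernel

lemma lower_check : allL (fun e => anyL (fun q => hasBit q.2.2 e) (codesFrom 80 160)) (belowL 80) =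
    true := by
  decide +kernel

lemma upper_check : allL (fun n => !Nat.beq (upperCell.getD n []).length 0) (belowL 160) = true := by
  decide +kernel

/-- Stellar moves that transform the barycentric subdivision of the dual surface. The first ones
remove the barycenters of the `1`-cells and of the `2`-cells; the other ones are edge flips and
removals of vertices. -/
def surfaceMove : List Move :=
  [(false, 7, 6, 101), (false, 70, 71, 225), (false, 26, 35, 146), (false, 7, 70, 107),
   (false, 27, 28, 150), (false, 6, 71, 102), (false, 26, 27, 145), (false, 35, 28, 154),
   (false, 7, 57, 106), (false, 6, 5, 98), (false, 57, 5, 100), (false, 55, 54, 205),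
   (false, 26, 55, 147), (false, 27, 54, 152), (false, 34, 29, 157), (false, 35, 34, 166),
   (false, 28, 29, 153), (false, 56, 53, 204), (false, 33, 30, 160), (false, 34, 33, 165),
   (false, 57, 56, 208), (false, 29, 30, 156), (false, 5, 53, 99), (false, 73, 72, 228),
   (false, 74, 79, 234), (false, 55, 56, 206), (false, 73, 74, 231), (false, 54, 53, 203),
   (false, 72, 79, 230), (false, 70, 73, 226), (false, 71, 72, 227), (false, 70, 19, 128),
   (false, 7, 18, 105), (false, 63, 44, 187), (false, 19, 18, 126), (false, 26, 63, 149),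
   (false, 35, 44, 169), (false, 70, 69, 224), (false, 19, 20, 127), (false, 69, 20, 131),
   (false, 25, 64, 143), (false, 26, 25, 142), (false, 63, 64, 217), (false, 36, 43, 173),
   (false, 35, 36, 168), (false, 44, 43, 185), (false, 68, 67, 222), (false, 37, 38, 174),
   (false, 36, 37, 171), (false, 69, 68, 223), (false, 43, 38, 177), (false, 20, 67, 130),
   (false, 14, 17, 122), (false, 15, 16, 123), (false, 25, 68, 144), (false, 14, 15, 121),
   (false, 64, 67, 219), (false, 17, 16, 124), (false, 7, 14, 104), (false, 18, 17, 125),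
   (false, 8, 3, 94), (false, 1, 2, 84), (false, 61, 46, 192), (false, 8, 1, 85),
   (false, 50, 49, 195), (false, 3, 2, 89), (false, 61, 50, 197), (false, 46, 49, 191),
   (false, 8, 58, 110), (false, 3, 4, 92), (false, 58, 4, 97), (false, 60, 51, 200),
   (false, 61, 60, 213), (false, 50, 51, 196), (false, 47, 48, 193), (false, 46, 47, 190),
   (false, 49, 48, 194), (false, 59, 52, 202), (false, 32, 31, 161), (false, 47, 32, 164),
   (false, 58, 59, 211), (false, 48, 31, 162), (false, 4, 52, 96), (false, 76, 77, 237),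
   (false, 75, 78, 236), (false, 60, 59, 212), (false, 76, 75, 235), (false, 51, 52, 198),
   (false, 77, 78, 238), (false, 1, 76, 88), (false, 2, 77, 91), (false, 1, 0, 80),
   (false, 8, 9, 108), (false, 62, 45, 189), (false, 0, 9, 81), (false, 61, 62, 214),
   (false, 46, 45, 188), (false, 1, 22, 86), (false, 0, 21, 83), (false, 22, 21, 132),
   (false, 24, 65, 141), (false, 61, 24, 140), (false, 62, 65, 216), (false, 41, 42, 181),
   (false, 46, 41, 182), (false, 45, 42, 184), (false, 23, 66, 137), (false, 40, 39, 178),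
   (false, 41, 40, 180), (false, 22, 23, 134), (false, 42, 39, 179), (false, 21, 66, 133),
   (false, 13, 10, 114), (false, 12, 11, 116), (false, 24, 23, 136), (false, 13, 12, 118),
   (false, 65, 66, 220), (false, 10, 11, 113), (false, 8, 13, 109), (false, 9, 10, 111),
   (false, 6, 3, 93), (false, 71, 2, 90), (false, 27, 50, 151), (false, 28, 49, 155),
   (false, 7, 8, 103), (false, 57, 58, 210), (false, 5, 4, 95), (false, 26, 61, 148),
   (false, 55, 60, 207), (false, 54, 51, 199), (false, 34, 47, 167), (false, 35, 46, 170),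
   (false, 29, 48, 158), (false, 33, 32, 163), (false, 30, 31, 159), (false, 56, 59, 209),
   (false, 53, 52, 201), (false, 74, 75, 233), (false, 79, 78, 239), (false, 73, 76, 232),
   (false, 72, 77, 229), (false, 70, 1, 87), (false, 19, 0, 82), (false, 18, 9, 112),
   (false, 63, 62, 215), (false, 44, 45, 186), (false, 69, 22, 135), (false, 20, 21, 129),
   (false, 25, 24, 139), (false, 64, 65, 218), (false, 36, 41, 172), (false, 43, 42, 183),
   (false, 37, 40, 175), (false, 38, 39, 176), (false, 68, 23, 138), (false, 67, 66, 221),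
   (false, 15, 12, 119), (false, 16, 11, 117), (false, 14, 13, 120), (false, 17, 10, 115),
   (false, 26, 28, 279), (false, 7, 71, 256), (false, 7, 5, 254), (false, 26, 54, 280),
   (false, 35, 29, 285), (false, 34, 30, 288), (false, 57, 53, 255), (false, 55, 53, 309),
   (false, 73, 79, 315), (false, 70, 72, 314), (false, 26, 44, 281), (false, 7, 19, 260),
   (false, 70, 20, 268), (false, 26, 64, 277), (false, 35, 43, 294), (false, 36, 38, 295),
   (false, 69, 67, 270), (false, 25, 67, 278), (false, 14, 16, 267), (false, 7, 17, 259),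
   (false, 61, 49, 305), (false, 8, 2, 244), (false, 8, 4, 251), (false, 61, 51, 306),
   (false, 46, 48, 304), (false, 47, 31, 290), (false, 58, 52, 253), (false, 60, 52, 308),
   (false, 76, 78, 319), (false, 1, 77, 245), (false, 61, 45, 303), (false, 8, 0, 240),
   (false, 1, 21, 241), (false, 61, 65, 276), (false, 46, 42, 300), (false, 41, 39, 299),
   (false, 22, 66, 271), (false, 24, 66, 274), (false, 13, 11, 263), (false, 8, 10, 261),
   (false, 27, 49, 283), (false, 6, 2, 248), (false, 7, 58, 258), (false, 6, 4, 250),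
   (false, 26, 60, 282), (false, 27, 51, 284), (false, 35, 47, 292), (false, 28, 48, 286),
   (false, 33, 31, 289), (false, 34, 32, 291), (false, 57, 59, 311), (false, 29, 31, 287),
   (false, 5, 52, 252), (false, 74, 78, 318), (false, 55, 59, 310), (false, 73, 75, 317),
   (false, 54, 52, 307), (false, 72, 78, 316), (false, 70, 76, 247), (false, 71, 77, 249),
   (false, 63, 45, 302), (false, 19, 9, 242), (false, 70, 22, 246), (false, 19, 21, 243),
   (false, 26, 24, 275), (false, 63, 65, 312), (false, 35, 41, 293), (false, 44, 42, 301),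
   (false, 37, 39, 297), (false, 36, 40, 296), (false, 69, 23, 272), (false, 43, 39, 298),
   (false, 20, 66, 269), (false, 15, 11, 265), (false, 25, 23, 273), (false, 14, 12, 266),
   (false, 64, 66, 313), (false, 17, 11, 264), (false, 7, 13, 257), (false, 18, 10, 262),
   (false, 73, 78, 79), (false, 14, 11, 16), (false, 15, 13, 12), (false, 6, 8, 3),
   (false, 69, 25, 68), (false, 57, 55, 56), (false, 74, 76, 75), (false, 63, 61, 62),
   (false, 36, 39, 38), (false, 27, 61, 50), (false, 37, 41, 40), (false, 34, 31, 32),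
   (false, 29, 33, 30), (true, 59, 58, 101), (false, 57, 52, 101), (false, 57, 60, 59),
   (true, 0, 1, 101), (false, 21, 8, 101), (false, 19, 8, 0), (false, 19, 10, 9),
   (false, 7, 10, 18), (false, 7, 11, 17), (false, 7, 15, 14), (false, 15, 10, 11),
   (false, 15, 8, 13), (false, 19, 15, 10), (true, 45, 44, 101), (false, 42, 63, 101),
   (false, 63, 46, 45), (true, 34, 35, 101), (false, 29, 47, 101), (false, 33, 47, 34),
   (false, 33, 48, 31), (true, 7, 19, 101), (false, 70, 15, 101), (false, 7, 19, 15),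
   (true, 2, 77, 101), (false, 71, 1, 101), (false, 6, 1, 2), (true, 29, 35, 101),
   (false, 47, 28, 101), (false, 28, 33, 29), (true, 44, 26, 101), (false, 63, 35, 101),
   (false, 35, 42, 44), (false, 35, 39, 43), (false, 35, 37, 36), (false, 37, 42, 39),
   (false, 37, 46, 41), (false, 63, 37, 42), (true, 73, 78, 101), (false, 72, 74, 101),
   (false, 73, 78, 74), (false, 70, 78, 73), (false, 70, 77, 76), (false, 71, 78, 72),
   (false, 1, 78, 77), (true, 53, 55, 101), (false, 54, 57, 101), (false, 5, 54, 53),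
   (false, 26, 57, 55), (true, 71, 7, 101), (false, 6, 70, 101), (false, 6, 78, 71),
   (true, 51, 27, 101), (false, 54, 61, 101), (false, 54, 60, 51), (true, 23, 66, 101),
   (false, 24, 22, 101), (false, 69, 24, 23), (true, 48, 28, 101), (false, 33, 49, 101),
   (false, 33, 46, 48), (false, 35, 33, 47), (false, 35, 49, 33), (false, 26, 49, 28),
   (false, 54, 49, 27), (true, 58, 52, 101), (false, 4, 57, 101), (false, 7, 4, 58),
   (true, 60, 54, 101), (false, 52, 61, 101), (false, 26, 52, 60), (true, 63, 46, 101),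
   (false, 61, 37, 101), (false, 35, 61, 37), (true, 67, 20, 101), (false, 66, 69, 101),
   (false, 69, 64, 67), (false, 26, 69, 25), (true, 49, 35, 101), (false, 46, 26, 101),
   (false, 54, 46, 49), (false, 63, 46, 35), (false, 54, 63, 46), (true, 20, 21, 101),
   (false, 66, 19, 101), (false, 70, 66, 20), (true, 65, 61, 101), (false, 63, 24, 101),
   (false, 63, 66, 65), (false, 26, 66, 64), (true, 19, 21, 101), (false, 66, 8, 101),
   (false, 7, 66, 19), (false, 8, 22, 21), (true, 63, 61, 101), (false, 24, 54, 101),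
   (false, 54, 66, 63), (false, 52, 24, 61), (true, 69, 24, 101), (false, 26, 22, 101),
   (false, 70, 26, 69), (true, 1, 6, 101), (false, 78, 8, 101), (false, 70, 8, 1),
   (true, 22, 70, 101), (false, 8, 26, 101), (false, 8, 24, 22), (true, 70, 8, 101),
   (false, 26, 78, 101), (false, 6, 26, 78), (false, 7, 26, 70), (true, 66, 24, 101),
   (false, 54, 8, 101), (false, 7, 54, 66), (false, 8, 52, 24), (true, 7, 8, 101),
   (false, 54, 4, 101), (true, 5, 4, 101), (false, 6, 52, 101), (true, 54, 52, 101),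
   (false, 5, 8, 101)]

/-- The vertices of the dual surface that remain as vertices of the grid. -/
def gridVertex : Fin 9 → Fin 320 := ![26, 54, 8, 6, 7, 4, 52, 5, 57]

/-- The triangles of the grid. -/
def gridTriangles : List GridTriangle :=
  (List.finRange 3).flatMap fun i => (List.finRange 3).flatMap fun j =>
    [((i, j), true), ((i, j), false)]

/-- The triangles of the quotient of the grid, as bit masks. -/
def gridMask : List ℕ := gridTriangles.map fun τ =>
  tripleMask (gridVertex (gridLabel (τ.vertex 0)), gridVertex (gridLabel (τ.vertex 1)),
    gridVertex (gridLabel (τ.vertex 2)))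

lemma runMoves_surface : runMoves 320 gridMask surfaceMove
    (blocks 16 40 (flagTriple.map tripleMask)) = true := by
  decide +kernel

lemma mem_codesFrom {n k : ℕ} {p : ℕ × ℕ × ℕ} : p ∈ codesFrom n k ↔
    ∃ i < k, p = (i + n, cellCode (surfaceCell.getD (i + n) [])) := by
  simp only [codesFrom, List.mem_map, mem_belowL]
  exact ⟨fun ⟨i, hi, h⟩ => ⟨i, hi, h.symm⟩, fun ⟨i, hi, h⟩ => ⟨i, hi, h.symm⟩⟩

lemma codeLE_iff {i j : Fin 320} :
    codeLE (cellCode (cellEdges i)) (cellCode (cellEdges j)) = true ↔ cellAt i ≤ cellAt j := by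
  unfold codeLE
  simp only [Bool.cond_eq_true_distrib, Bool.false_eq_true, if_false_right, Nat.beq_eq]
  refine and_congr cellAt_face_subset_iff.symm ?_
  rw [cellAt_cls_subset_iff]
  refine land_eq_left_iff.trans ?_
  simp only [cellCode, testBit_maskOf]

lemma rank_zero_iff {i : Fin 320} : rank i = 0 ↔ (i : ℕ) < 80 := by
  have h := rank_eq i
  split_ifs at h <;> omega

lemma rank_one_iff {i : Fin 320} : rank i = 1 ↔ 80 ≤ (i : ℕ) ∧ (i : ℕ) < 240 := by
  have h := rank_eq i
  split_ifs at h <;> omega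

lemma rank_two_iff {i : Fin 320} : rank i = 2 ↔ 240 ≤ (i : ℕ) := by
  have h := rank_eq i
  split_ifs at h <;> omega

lemma code_mem_one {q : Fin 320} (hq : rank q = 1) :
    ((q : ℕ), cellCode (cellEdges q)) ∈ codesFrom 80 160 := by
  rw [rank_one_iff] at hq
  refine mem_codesFrom.2 ⟨q - 80, by omega, ?_⟩
  rw [Nat.sub_add_cancel hq.1]; rfl

lemma code_mem_two {f : Fin 320} (hf : rank f = 2) :
    ((f : ℕ), cellCode (cellEdges f)) ∈ codesFrom 240 80 := by
  rw [rank_two_iff] at hf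
  have := f.2
  refine mem_codesFrom.2 ⟨f - 240, by omega, ?_⟩
  rw [Nat.sub_add_cancel hf]; rfl

lemma exists_of_mem_codesFrom_one {p : ℕ × ℕ × ℕ} (hp : p ∈ codesFrom 80 160) :
    ∃ q : Fin 320, rank q = 1 ∧ p = ((q : ℕ), cellCode (cellEdges q)) := by
  obtain ⟨i, hi, rfl⟩ := mem_codesFrom.1 hp
  exact ⟨⟨i + 80, by omega⟩, rank_one_iff.2 ⟨by simp, by simp; omega⟩, rfl⟩

lemma cellEdges_of_rank_zero {e : Fin 320} (he : rank e = 0) : cellEdges e = [(e : ℕ)] := by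
  rw [rank_zero_iff] at he
  have h := cellEdges_lt_80 ⟨e, he⟩
  have h' : Fin.ofNat 320 (e : ℕ) = e := Fin.ext (Nat.mod_eq_of_lt e.2)
  simp only [h'] at h
  exact h

lemma le_of_mem_cellEdges {e i : Fin 320} (h : (e : ℕ) ∈ cellEdges i) :
    cellAt e ≤ cellAt i := by
  have := cellAt_edge_le h
  rwa [show Fin.ofNat 320 (e : ℕ) = e from Fin.ext (Nat.mod_eq_of_lt e.2)] at this

lemma mem_cellEdges_of_le {e i : Fin 320} (he : rank e = 0) (h : cellAt e ≤ cellAt i) :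
    (e : ℕ) ∈ cellEdges i :=
  cellAt_cls_subset_iff.1 h.2 e (by rw [cellEdges_of_rank_zero he]; simp)

/-- A chain of three cells of the dual surface, one of each dimension. -/
structure IsFlag (e q f : Fin 320) : Prop where
  rank_e : rank e = 0
  rank_q : rank q = 1
  rank_f : rank f = 2
  le : cellAt e ≤ cellAt q
  le' : cellAt q ≤ cellAt f

lemma mem_flagTriple {t : ℕ × ℕ × ℕ} : t ∈ flagTriple ↔ ∃ n < 160,
    t.2.1 = n + 80 ∧ t.1 ∈ surfaceCell.getD (n + 80) [] ∧ t.2.2 ∈ upperCell.getD n [] := by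
  obtain ⟨e, q, f⟩ := t
  simp only [flagTriple, List.mem_flatMap, List.mem_map, mem_belowL, Prod.mk.injEq]
  constructor
  · rintro ⟨n, hn, e', he', f', hf', rfl, rfl, rfl⟩
    exact ⟨n, hn, rfl, he', hf'⟩
  · rintro ⟨n, hn, rfl, he', hf'⟩
    exact ⟨n, hn, e, he', f, hf', rfl, rfl, rfl⟩

lemma IsFlag.mem_flagTriple {e q f : Fin 320} (h : IsFlag e q f) :
    ((e : ℕ), (q : ℕ), (f : ℕ)) ∈ flagTriple := by
  have hq := rank_one_iff.1 h.rank_q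
  refine CubicalPolytope.mem_flagTriple.2 ⟨q - 80, by omega, ?_, ?_, ?_⟩
  · simp only; omega
  · rw [Nat.sub_add_cancel hq.1]
    exact mem_cellEdges_of_le h.rank_e h.le
  · have hc := allL_iff.1 (allL_iff.1 upperCell_check _ (code_mem_one h.rank_q)) _
      (code_mem_two h.rank_f)
    simp only [codeLE_iff.2 h.le', cond_true, memL_iff] at hc
    exact hc

lemma exists_isFlag_of_mem {t : ℕ × ℕ × ℕ} (ht : t ∈ flagTriple) :
    ∃ e q f : Fin 320, IsFlag e q f ∧ t = ((e : ℕ), (q : ℕ), (f : ℕ)) := by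
  have hb := allL_iff.1 flagTriple_bounds t ht
  have hc := allL_iff.1 flagTriple_check t ht
  obtain ⟨n, hn, h1, h2, h3⟩ := mem_flagTriple.1 ht
  obtain ⟨e, q, f⟩ := t
  simp only [Bool.cond_eq_true_distrib, Bool.false_eq_true, if_false_right, Nat.blt_eq,
    Nat.ble_eq] at hb
  simp only at h1 h2 h3
  subst h1
  refine ⟨⟨e, by omega⟩, ⟨n + 80, by omega⟩, ⟨f, hb.2.1⟩, ⟨rank_zero_iff.2 hb.1,
    rank_one_iff.2 ⟨by simp, by simp; omega⟩, rank_two_iff.2 hb.2.2, ?_, ?_⟩, rfl⟩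
  · exact le_of_mem_cellEdges h2
  · exact codeLE_iff.1 hc

lemma exists_between {e f : Fin 320} (he : rank e = 0) (hf : rank f = 2)
    (h : cellAt e ≤ cellAt f) : ∃ q, IsFlag e q f := by
  have hc := allL_iff.1 (allL_iff.1 between_check _ (code_mem_two hf)) e (mem_cellEdges_of_le he h)
  obtain ⟨p, hp, hc⟩ := anyL_iff.1 hc
  obtain ⟨q, hq, rfl⟩ := exists_of_mem_codesFrom_one hp
  simp only [Bool.cond_eq_true_distrib, Bool.false_eq_true, if_false_right, hasBit_eq] at hc
  exact ⟨q, he, hq, hf, le_of_mem_cellEdges (testBit_maskOf.1 hc.1), codeLE_iff.1 hc.2⟩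

lemma exists_upper {q : Fin 320} (hq : rank q = 1) : ∃ f, rank f = 2 ∧ cellAt q ≤ cellAt f := by
  have hq' := rank_one_iff.1 hq
  have h := allL_iff.1 upper_check (q - 80) (mem_belowL.2 (by omega))
  obtain ⟨f, hf⟩ := List.exists_mem_of_length_pos (l := upperCell.getD (q - 80) []) (by
    rw [Nat.pos_iff_ne_zero]
    intro h0
    rw [h0] at h
    exact Bool.noConfusion h)
  obtain ⟨t, ht⟩ := cellEdges_ne_nil q
  have hmem : (t, (q : ℕ), f) ∈ flagTriple := by
    refine mem_flagTriple.2 ⟨q - 80, by omega, by simp only; omega, ?_, hf⟩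
    rw [Nat.sub_add_cancel hq'.1]
    exact ht
  obtain ⟨e, q', f', hfl, heq⟩ := exists_isFlag_of_mem hmem
  simp only [Prod.mk.injEq] at heq
  have : q = q' := Fin.ext heq.2.1
  subst this
  exact ⟨f', hfl.rank_f, hfl.le'⟩

lemma exists_lower (q : Fin 320) : ∃ e, rank e = 0 ∧ cellAt e ≤ cellAt q := by
  obtain ⟨t, ht⟩ := cellEdges_ne_nil q
  have h80 := cell_lt (cellEdges_mem q) ht
  have h0 : rank ⟨t, by omega⟩ = 0 := rank_zero_iff.2 h80
  exact ⟨⟨t, by omega⟩, h0, le_of_mem_cellEdges ht⟩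

lemma exists_middle_of_rank_zero {e : Fin 320} (he : rank e = 0) :
    ∃ q, rank q = 1 ∧ cellAt e ≤ cellAt q := by
  obtain ⟨p, hp, hc⟩ := anyL_iff.1 (allL_iff.1 lower_check e (mem_belowL.2 (rank_zero_iff.1 he)))
  obtain ⟨q, hq, rfl⟩ := exists_of_mem_codesFrom_one hp
  rw [hasBit_eq] at hc
  exact ⟨q, hq, le_of_mem_cellEdges (testBit_maskOf.1 hc)⟩

lemma exists_flag_of_rank_two {f : Fin 320} (hf : rank f = 2) : ∃ e q, IsFlag e q f := by
  obtain ⟨t, ht⟩ := cellEdges_ne_nil f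
  have h80 := cell_lt (cellEdges_mem f) ht
  have h0 : rank ⟨t, by omega⟩ = 0 := rank_zero_iff.2 h80
  obtain ⟨q, hq⟩ := exists_between h0 hf (le_of_mem_cellEdges ht)
  exact ⟨_, q, hq⟩

lemma exists_flag_of_le {e q : Fin 320} (he : rank e = 0) (hq : rank q = 1)
    (h : cellAt e ≤ cellAt q) : ∃ f, IsFlag e q f := by
  obtain ⟨f, hf, hle⟩ := exists_upper hq
  exact ⟨f, he, hq, hf, h, hle⟩

/-- The dimension is strictly monotone on the cells. -/
lemma rank_lt_of_le {i j : Fin 320} (h : cellAt i ≤ cellAt j) (hne : i ≠ j) : rank i < rank j := by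
  by_cases hm : cellMask i = cellMask j
  · exfalso
    obtain ⟨t, ht⟩ := cellEdges_ne_nil i
    have ht' := cellAt_cls_subset_iff.1 h.2 t ht
    have h1 : cellAt j ≤ cellAt i := (cellAt_le_iff ht' ht).2 (by rw [hm, Nat.and_self])
    exact hne (cellAt_injective (le_antisymm h h1))
  · have h1 := dim_faceOf_lt (rank_succ_lt i) (cellMask_mem i) (rank_succ_lt j) (cellMask_mem j)
      h.1 hm
    have h2 := dim_cellAt i
    have h3 := dim_cellAt j
    simp only [cellAt] at h2 h3
    omega

/-- Every chain of cells can be completed to a flag. -/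
lemma exists_flag {T : Set (Fin 320)}
    (hT : ∀ i ∈ T, ∀ j ∈ T, cellAt i ≤ cellAt j ∨ cellAt j ≤ cellAt i) :
    ∃ e q f, IsFlag e q f ∧ ∀ x ∈ T, x = e ∨ x = q ∨ x = f := by
  have huniq : ∀ i ∈ T, ∀ j ∈ T, rank i = rank j → i = j := by
    intro i hi j hj h
    by_contra hne
    rcases hT i hi j hj with h1 | h1
    · exact (rank_lt_of_le h1 hne).ne h
    · exact (rank_lt_of_le h1 (Ne.symm hne)).ne h.symm
  have hle : ∀ i ∈ T, ∀ j ∈ T, rank i < rank j → cellAt i ≤ cellAt j := by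
    intro i hi j hj h
    rcases hT i hi j hj with h1 | h1
    · exact h1
    · by_cases hij : j = i
      · rw [hij] at h; exact absurd h (lt_irrefl _)
      · exact absurd (rank_lt_of_le h1 hij) h.not_gt
  -- a flag that contains an element of `T` of each dimension in which there is one
  have key : ∃ e q f, IsFlag e q f ∧ (∀ x ∈ T, rank x = 0 → x = e) ∧
      (∀ x ∈ T, rank x = 1 → x = q) ∧ (∀ x ∈ T, rank x = 2 → x = f) := by
    by_cases h1 : ∃ q ∈ T, rank q = 1
    · obtain ⟨q, hqT, hq⟩ := h1
      obtain ⟨e, he, hee, heT⟩ : ∃ e, rank e = 0 ∧ cellAt e ≤ cellAt q ∧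
          ∀ x ∈ T, rank x = 0 → x = e := by
        by_cases h0 : ∃ e ∈ T, rank e = 0
        · obtain ⟨e, heT, he⟩ := h0
          exact ⟨e, he, hle e heT q hqT (by omega),
            fun x hx h => huniq x hx e heT (h.trans he.symm)⟩
        · obtain ⟨e, he, hee⟩ := exists_lower q
          exact ⟨e, he, hee, fun x hx h => absurd ⟨x, hx, h⟩ h0⟩
      obtain ⟨f, hf, hff, hfT⟩ : ∃ f, rank f = 2 ∧ cellAt q ≤ cellAt f ∧
          ∀ x ∈ T, rank x = 2 → x = f := by
        by_cases h0 : ∃ f ∈ T, rank f = 2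
        · obtain ⟨f, hfT, hf⟩ := h0
          exact ⟨f, hf, hle q hqT f hfT (by omega),
            fun x hx h => huniq x hx f hfT (h.trans hf.symm)⟩
        · obtain ⟨f, hf, hff⟩ := exists_upper hq
          exact ⟨f, hf, hff, fun x hx h => absurd ⟨x, hx, h⟩ h0⟩
      exact ⟨e, q, f, ⟨he, hq, hf, hee, hff⟩, heT,
        fun x hx h => huniq x hx q hqT (h.trans hq.symm), hfT⟩
    · have h1' : ∀ q : Fin 320, ∀ x ∈ T, rank x = 1 → x = q := fun _ x hx h =>
        absurd ⟨x, hx, h⟩ h1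
      by_cases h2 : ∃ f ∈ T, rank f = 2
      · obtain ⟨f, hfT, hf⟩ := h2
        by_cases h0 : ∃ e ∈ T, rank e = 0
        · obtain ⟨e, heT, he⟩ := h0
          obtain ⟨q, hfl⟩ := exists_between he hf (hle e heT f hfT (by omega))
          exact ⟨e, q, f, hfl, fun x hx h => huniq x hx e heT (h.trans he.symm), h1' q,
            fun x hx h => huniq x hx f hfT (h.trans hf.symm)⟩
        · obtain ⟨e, q, hfl⟩ := exists_flag_of_rank_two hf
          exact ⟨e, q, f, hfl, fun x hx h => absurd ⟨x, hx, h⟩ h0, h1' q,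
            fun x hx h => huniq x hx f hfT (h.trans hf.symm)⟩
      · obtain ⟨e, he, heT⟩ : ∃ e : Fin 320, rank e = 0 ∧ ∀ x ∈ T, rank x = 0 → x = e := by
          by_cases h0 : ∃ e ∈ T, rank e = 0
          · obtain ⟨e, heT, he⟩ := h0
            exact ⟨e, he, fun x hx h => huniq x hx e heT (h.trans he.symm)⟩
          · exact ⟨0, rank_zero_iff.2 (by norm_num), fun x hx h => absurd ⟨x, hx, h⟩ h0⟩
        obtain ⟨q, hq, hle'⟩ := exists_middle_of_rank_zero he
        obtain ⟨f, hfl⟩ := exists_flag_of_le he hq hle'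
        exact ⟨e, q, f, hfl, heT, h1' q, fun x hx h => absurd ⟨x, hx, h⟩ h2⟩
  obtain ⟨e, q, f, hfl, h0, h1, h2⟩ := key
  refine ⟨e, q, f, hfl, fun x hx => ?_⟩
  have hlt := rank_lt x
  rcases (by omega : rank x = 0 ∨ rank x = 1 ∨ rank x = 2) with h | h | h
  · exact Or.inl (h0 x hx h)
  · exact Or.inr (Or.inl (h1 x hx h))
  · exact Or.inr (Or.inr (h2 x hx h))

lemma maskSet_tripleMask (a b c : Fin 320) :
    maskSet 320 (tripleMask ((a : ℕ), (b : ℕ), (c : ℕ))) = {a, b, c} := by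
  ext i
  change (bitMask a ||| (bitMask b ||| bitMask c)).testBit i = true ↔ _
  simp only [Nat.testBit_lor, testBit_bitMask, Bool.or_eq_true, decide_eq_true_eq,
    Set.mem_insert_iff, Set.mem_singleton_iff, Fin.ext_iff, eq_comm (a := (i : ℕ))]

/-- The order complex of the dual surface, as a complex on the numbers of the cells. -/
def flagComplex : Set (Set (Fin 320)) := maskComplex 320 (flagTriple.map tripleMask)

lemma mem_flagComplex {T : Set (Fin 320)} :
    T ∈ flagComplex ↔ ∃ e q f, IsFlag e q f ∧ T = {e, q, f} := by
  constructor
  · rintro ⟨m, hm, rfl⟩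
    obtain ⟨t, ht, rfl⟩ := List.mem_map.1 hm
    obtain ⟨e, q, f, h, rfl⟩ := exists_isFlag_of_mem ht
    exact ⟨e, q, f, h, maskSet_tripleMask e q f⟩
  · rintro ⟨e, q, f, h, rfl⟩
    exact ⟨_, List.mem_map.2 ⟨_, h.mem_flagTriple, rfl⟩, (maskSet_tripleMask e q f).symm⟩

lemma chain_iff {S : Set (Fin 320)} :
    (∀ i ∈ S, ∀ j ∈ S, cellAt i ≤ cellAt j ∨ cellAt j ≤ cellAt i) ↔ ∃ T ∈ flagComplex, S ⊆ T := by
  constructor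
  · intro h
    obtain ⟨e, q, f, hfl, hS⟩ := exists_flag h
    exact ⟨_, mem_flagComplex.2 ⟨e, q, f, hfl, rfl⟩, fun x hx => hS x hx⟩
  · rintro ⟨T, hT, hST⟩ i hi j hj
    obtain ⟨e, q, f, hfl, rfl⟩ := mem_flagComplex.1 hT
    have h1 := hfl.le
    have h2 := hfl.le'
    have h3 := h1.trans h2
    rcases hST hi with rfl | rfl | rfl <;> rcases hST hj with rfl | rfl | rfl <;> simp [*]

/-- The cells of the dual surface and their numbers. -/
def cellEquiv : Fin 320 ≃ surface := Equiv.ofInjective cellAt cellAt_injective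

lemma cellEquiv_le_iff {i j : Fin 320} : cellEquiv i ≤ cellEquiv j ↔ cellAt i ≤ cellAt j := Iff.rfl

/-- Numbering the cells turns the order complex of the dual surface into a complex on `Fin 320`. -/
def orderRealizationHomeomorph : OrderRealization surface ≃ₜ Realization flagComplex where
  toFun w := ⟨fun i => w.1 (cellEquiv i), fun i => w.2.1 _, by
    rw [← finsum_eq_sum_of_fintype, finsum_comp_equiv cellEquiv (f := w.1)]
    exact w.2.2.2, chain_iff.1 fun i hi j hj => by
      rw [← cellEquiv_le_iff, ← cellEquiv_le_iff]
      exact w.2.2.1.total hi hj⟩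
  invFun w := ⟨fun c => w.1 (cellEquiv.symm c), fun c => w.2.1 _, by
    intro c hc c' hc' _
    have := chain_iff.2 w.2.2.2 _ hc _ hc'
    rw [← cellEquiv_le_iff, ← cellEquiv_le_iff] at this
    simpa using this, by
    rw [finsum_comp_equiv cellEquiv.symm (f := w.1), finsum_eq_sum_of_fintype]
    exact w.2.2.1⟩
  left_inv w := Subtype.ext (funext fun c => by simp)
  right_inv w := Subtype.ext (funext fun i => by simp)
  continuous_toFun := by
    refine Continuous.subtype_mk (continuous_pi fun i => ?_) _
    exact (continuous_apply _).comp continuous_subtype_val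
  continuous_invFun := by
    refine Continuous.subtype_mk (continuous_pi fun i => ?_) _
    exact (continuous_apply _).comp continuous_subtype_val

lemma mem_gridTriangles : ∀ τ : GridTriangle, τ ∈ gridTriangles := by decide

lemma maskComplex_gridMask : maskComplex 320 gridMask = kleinComplex gridVertex := by
  have h : ∀ τ : GridTriangle, maskSet 320 (tripleMask (gridVertex (gridLabel (τ.vertex 0)),
      gridVertex (gridLabel (τ.vertex 1)), gridVertex (gridLabel (τ.vertex 2)))) =
      Set.range fun k => gridVertex (gridLabel (τ.vertex k)) := by
    intro τ
    rw [maskSet_tripleMask]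
    ext x
    simp [Fin.exists_fin_succ, eq_comm]
  ext T
  constructor
  · rintro ⟨t, ht, rfl⟩
    obtain ⟨τ, -, rfl⟩ := List.mem_map.1 ht
    exact ⟨τ, h τ⟩
  · rintro ⟨τ, rfl⟩
    exact ⟨_, List.mem_map.2 ⟨τ, mem_gridTriangles τ, rfl⟩, (h τ).symm⟩

lemma gridVertex_injective : Function.Injective gridVertex := by decide

lemma orderRealization_surface_homeomorph :
    Nonempty (OrderRealization surface ≃ₜ KleinBottle) := by
  obtain ⟨e⟩ := realization_homeomorph_of_runMoves _ _ (isCover_blocks _ _ _)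
    runMoves_surface
  rw [flatten_blocks, maskComplex_gridMask] at e
  obtain ⟨e'⟩ := kleinBottle_homeomorph gridVertex_injective
  exact ⟨orderRealizationHomeomorph.trans (e.trans e')⟩

/-! ### The canonical map -/

section Barycenter

variable {E ι κ : Type*} [NormedAddCommGroup E] [NormedSpace ℝ E]
  {V : ι → E} {l : κ → E →L[ℝ] ℝ} {c : κ → ℝ} {S : Set ι}

lemma hull_singleton (V : ι → E) (i : ι) : hull V {i} = {V i} := by
  rw [hull, Set.image_singleton, convexHull_singleton]

variable [Finite ι]

lemma HVRep.vertex_injective (H : HVRep V l c) (hV : ∀ i, IsClosedIdx V l c {i}) :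
    Function.Injective V := by
  intro i i' h
  have : V i' ∈ hull V {i} := by rw [hull_singleton, h]; rfl
  exact ((H.vertex_mem_iff (hV i)).1 this).symm

lemma HVRep.extremePoints_hull [Finite κ] (H : HVRep V l c) (hV : ∀ i, IsClosedIdx V l c {i}) :
    (hull V S).extremePoints ℝ = V '' S := by
  refine Set.Subset.antisymm extremePoints_convexHull_subset ?_
  rintro _ ⟨i, hi, rfl⟩
  have h := (H.isExposed_hull (hV i) (Set.singleton_subset_iff.2 hi)).isExtreme
  rw [hull_singleton] at h
  exact isExtreme_singleton.1 h

lemma HVRep.barycenter_hull [Finite κ] (H : HVRep V l c) (hV : ∀ i, IsClosedIdx V l c {i}) :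
    barycenter (hull V S) = (S.ncard : ℝ)⁻¹ • ∑ i ∈ S.toFinite.toFinset, V i := by
  rw [barycenter, H.extremePoints_hull hV,
    Set.ncard_image_of_injective _ (H.vertex_injective hV),
    finsum_mem_image (H.vertex_injective hV).injOn, finsum_mem_eq_finite_toFinset_sum _ S.toFinite]

/-- The barycenter of a face lies in its relative interior. -/
lemma HVRep.barycenter_nonneg [Finite κ] (H : HVRep V l c) (hV : ∀ i, IsClosedIdx V l c {i})
    (hne : S.Nonempty) (j : κ) :
    0 ≤ l j (barycenter (hull V S)) + c j ∧
      (l j (barycenter (hull V S)) + c j = 0 ↔ j ∈ active V l c S) := by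
  have hpos : (0 : ℝ) < S.ncard := by
    exact_mod_cast (Set.ncard_pos S.toFinite).2 hne
  have hval : l j (barycenter (hull V S)) + c j =
      (S.ncard : ℝ)⁻¹ * ∑ i ∈ S.toFinite.toFinset, (l j (V i) + c j) := by
    rw [H.barycenter_hull hV, map_smul, map_sum, Finset.sum_add_distrib, Finset.sum_const,
      ← Set.ncard_eq_toFinset_card S, smul_eq_mul, mul_add, nsmul_eq_mul, ← mul_assoc,
      inv_mul_cancel₀ hpos.ne', one_mul]
  have hnn : ∀ i ∈ S.toFinite.toFinset, 0 ≤ l j (V i) + c j := fun i _ => H.nonneg j i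
  rw [hval]
  refine ⟨mul_nonneg (inv_pos.2 hpos).le (Finset.sum_nonneg hnn), ?_⟩
  rw [mul_eq_zero, or_iff_right (inv_pos.2 hpos).ne', Finset.sum_eq_zero_iff_of_nonneg hnn]
  simp [active]

end Barycenter

/-- Points in a nonnegative cone are determined by their coordinates if the vectors `A i` that occur
have distinct zero sets, which form a chain for each of the two points: after common summands are
cancelled, the zero set of the sum is the smallest one that occurs. -/
lemma eq_of_sum_eq {ι κ : Type*} [Fintype ι] [Finite κ] {A : ι → κ → ℝ} (hA : ∀ i j, 0 ≤ A i j)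
    (hA0 : ∀ i, ∃ j, A i j ≠ 0) {w w' : ι → ℝ} (hw : ∀ i, 0 ≤ w i) (hw' : ∀ i, 0 ≤ w' i)
    (hc : ∀ i k, w i ≠ 0 → w k ≠ 0 → {j | A i j = 0} ⊆ {j | A k j = 0} ∨
      {j | A k j = 0} ⊆ {j | A i j = 0})
    (hc' : ∀ i k, w' i ≠ 0 → w' k ≠ 0 → {j | A i j = 0} ⊆ {j | A k j = 0} ∨
      {j | A k j = 0} ⊆ {j | A i j = 0})
    (hinj : ∀ i k, w i ≠ 0 → w' k ≠ 0 → {j | A i j = 0} = {j | A k j = 0} → i = k)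
    (h : ∀ j, ∑ i, w i * A i j = ∑ i, w' i * A i j) : w = w' := by
  classical
  set u : ι → ℝ := fun i => w i - min (w i) (w' i) with hu
  set u' : ι → ℝ := fun i => w' i - min (w i) (w' i) with hu'
  have hu0 : ∀ i, 0 ≤ u i := fun i => sub_nonneg.2 (min_le_left _ _)
  have hu0' : ∀ i, 0 ≤ u' i := fun i => sub_nonneg.2 (min_le_right _ _)
  have huw : ∀ i, u i ≠ 0 → w i ≠ 0 := by
    intro i hi h0
    refine hi ?_
    simp only [hu, h0, min_eq_left (hw' i), sub_zero]
  have huw' : ∀ i, u' i ≠ 0 → w' i ≠ 0 := by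
    intro i hi h0
    refine hi ?_
    simp only [hu', h0, min_eq_right (hw i), sub_zero]
  have hdisj : ∀ i, u i = 0 ∨ u' i = 0 := by
    intro i
    rcases le_total (w i) (w' i) with hle | hle
    · left; simp [hu, hle]
    · right; simp [hu', hle]
  have hsum : ∀ j, ∑ i, u i * A i j = ∑ i, u' i * A i j := by
    intro j
    simp only [hu, hu', sub_mul, Finset.sum_sub_distrib, h j]
  have hzero : ∀ v : ι → ℝ, (∀ i, 0 ≤ v i) → ∀ j,
      ∑ i, v i * A i j = 0 ↔ ∀ i, v i ≠ 0 → A i j = 0 := by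
    intro v hv j
    rw [Finset.sum_eq_zero_iff_of_nonneg fun i _ => mul_nonneg (hv i) (hA i j)]
    simp only [Finset.mem_univ, true_implies, mul_eq_zero]
    exact forall_congr' fun i => by tauto
  -- the zero set of a sum along a chain
  have hmin : ∀ v : ι → ℝ, (∀ i, 0 ≤ v i) → (∃ i, v i ≠ 0) →
      (∀ i k, v i ≠ 0 → v k ≠ 0 → {j | A i j = 0} ⊆ {j | A k j = 0} ∨
        {j | A k j = 0} ⊆ {j | A i j = 0}) →
      ∃ i, v i ≠ 0 ∧ {j | ∑ i, v i * A i j = 0} = {j | A i j = 0} := by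
    intro v hv hex hch
    obtain ⟨i, hi, hle⟩ := Finset.exists_min_image (Finset.univ.filter fun i => v i ≠ 0)
      (fun i => {j | A i j = 0}.ncard) (by obtain ⟨i, hi⟩ := hex; exact ⟨i, by simpa using hi⟩)
    simp only [Finset.mem_filter, Finset.mem_univ, true_and] at hi hle
    refine ⟨i, hi, ?_⟩
    ext j
    rw [Set.mem_ofPred_eq, hzero v hv j]
    refine ⟨fun h => h i hi, fun hj k hk => ?_⟩
    rcases hch i k hi hk with hs | hs
    · exact hs hj
    · have := Set.eq_of_subset_of_ncard_le hs (hle k hk) (Set.toFinite _)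
      have hj' : j ∈ {j | A i j = 0} := hj
      rw [← this] at hj'
      exact hj'
  have hex : (∃ i, u i ≠ 0) ↔ ∃ i, u' i ≠ 0 := by
    have aux : ∀ v v' : ι → ℝ, (∀ i, 0 ≤ v i) → (∀ i, 0 ≤ v' i) →
        (∀ j, ∑ i, v i * A i j = ∑ i, v' i * A i j) → (∃ i, v i ≠ 0) → ∃ i, v' i ≠ 0 := by
      rintro v v' hv hv' hvv ⟨i, hi⟩
      by_contra! hcon
      obtain ⟨j, hj⟩ := hA0 i
      have h1 : ∑ i, v i * A i j = 0 := by rw [hvv j]; simp [hcon]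
      exact hj ((hzero v hv j).1 h1 i hi)
    exact ⟨aux u u' hu0 hu0' hsum, aux u' u hu0' hu0 fun j => (hsum j).symm⟩
  by_cases hcase : ∃ i, u i ≠ 0
  · obtain ⟨i, hi, hiz⟩ := hmin u hu0 hcase fun i k hi hk => hc i k (huw i hi) (huw k hk)
    obtain ⟨k, hk, hkz⟩ := hmin u' hu0' (hex.1 hcase) fun i k hi hk =>
      hc' i k (huw' i hi) (huw' k hk)
    have heq : {j | A i j = 0} = {j | A k j = 0} := by
      rw [← hiz, ← hkz]; simp only [hsum]
    have := hinj i k (huw i hi) (huw' k hk) heq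
    subst this
    exact ((hdisj i).elim hi hk).elim
  · have hcase' : ¬ ∃ i, u' i ≠ 0 := fun h => hcase (hex.2 h)
    push Not at hcase hcase'
    funext i
    have h1 := hcase i
    have h2 := hcase' i
    simp only [hu, hu', sub_eq_zero] at h1 h2
    rw [h1, ← h2]

lemma isClosedIdx_singleton (i : Fin 72) :
    IsClosedIdx vertexPoint facetLin facetConst {i} := by
  have hm : bitMask i ∈ faceMasks 0 := by
    refine mem_faceMasks.2 ⟨[(i : ℕ)], List.mem_map.2 ⟨i, mem_belowL.2 i.2, rfl⟩, ?_⟩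
    exact Nat.or_zero _
  have h := isClosedIdx_faceMasks (by norm_num) hm
  have : maskSet 72 (bitMask i) = {i} := by
    ext k
    change (bitMask i).testBit k = true ↔ _
    rw [testBit_bitMask, decide_eq_true_iff, Set.mem_singleton_iff, Fin.ext_iff, eq_comm]
  rwa [this] at h

/-- The barycenter of the face of a cell. -/
def cellCenter (i : Fin 320) : EuclideanSpace ℝ (Fin 4) := barycenter (cellAt i).face

/-- The value of a facet functional at the barycenter of the face of a cell. -/
def centerValue (i : Fin 320) (j : Fin 62) : ℝ := facetLin j (cellCenter i) + facetConst j

lemma isClosedIdx_cellMask (i : Fin 320) :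
    IsClosedIdx vertexPoint facetLin facetConst (maskSet 72 (cellMask i)) :=
  isClosedIdx_faceMasks (rank_succ_lt i) (cellMask_mem i)

lemma centerValue_spec (i : Fin 320) (j : Fin 62) : 0 ≤ centerValue i j ∧
    (centerValue i j = 0 ↔
      j ∈ active vertexPoint facetLin facetConst (maskSet 72 (cellMask i))) :=
  hvRep_vertexPoint.barycenter_nonneg isClosedIdx_singleton
    (nonempty_maskSet (rank_succ_lt i) (cellMask_mem i)) j

lemma setOf_centerValue (i : Fin 320) : {j | centerValue i j = 0} =
    active vertexPoint facetLin facetConst (maskSet 72 (cellMask i)) :=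
  Set.ext fun j => (centerValue_spec i j).2

lemma active_anti_of_le {i k : Fin 320} (h : cellAt i ≤ cellAt k) :
    {j | centerValue k j = 0} ⊆ {j | centerValue i j = 0} := by
  rw [setOf_centerValue, setOf_centerValue]
  exact active_anti ((maskSet_subset_iff (faceMasks_lt (rank_succ_lt i) (cellMask_mem i))).2
    (cellAt_face_subset_iff.1 h.1))

lemma exists_active (i : Fin 320) : ∃ j, centerValue i j = 0 := by
  by_contra! hcon
  refine maskSet_ne_univ (rank_succ_lt i) (cellMask_mem i) (Set.eq_univ_of_forall fun k => ?_)
  refine isClosedIdx_cellMask i k fun j hj => ?_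
  exact absurd ((centerValue_spec i j).2.2 hj) (hcon j)

/-- No vertex lies in all facets. -/
lemma exists_facet_ne_zero (i : Fin 72) : ∃ j, facetLin j (vertexPoint i) + facetConst j ≠ 0 := by
  by_contra! hcon
  obtain ⟨k, hk⟩ : ∃ k : Fin 72, k ≠ i := by
    by_cases h : i = 0
    · exact ⟨1, by rw [h]; decide⟩
    · exact ⟨0, Ne.symm h⟩
  exact hk (isClosedIdx_singleton k i fun j _ => hcon j).symm

lemma exists_not_active (i : Fin 320) : ∃ j, centerValue i j ≠ 0 := by
  obtain ⟨k, hk⟩ := nonempty_maskSet (rank_succ_lt i) (cellMask_mem i)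
  obtain ⟨j, hj⟩ := exists_facet_ne_zero k
  exact ⟨j, fun h => hj ((centerValue_spec i j).2.1 h k hk)⟩

/-- The face of a cell is determined by the facets that contain it. -/
lemma cellMask_eq_of_centerValue {i k : Fin 320}
    (h : {j | centerValue i j = 0} = {j | centerValue k j = 0}) : cellMask i = cellMask k := by
  rw [setOf_centerValue, setOf_centerValue] at h
  have aux : ∀ {i k : Fin 320}, active vertexPoint facetLin facetConst (maskSet 72 (cellMask i)) =
      active vertexPoint facetLin facetConst (maskSet 72 (cellMask k)) →
      maskSet 72 (cellMask i) ⊆ maskSet 72 (cellMask k) := by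
    intro i k h n hn
    refine isClosedIdx_cellMask k n fun j hj => ?_
    rw [← h] at hj
    exact hj n hn
  refine faceOf_inj (rank_succ_lt i) (cellMask_mem i) (rank_succ_lt k) (cellMask_mem k) ?_
  rw [faceOf, faceOf, (aux h).antisymm (aux h.symm)]

/-- Different `1`-cells in a `2`-cell lie in different faces. -/
lemma lowerFace_nodup : allL (fun f => nodupL ((filterL (fun q => codeLE q f)
    ((codesFrom 80 160).map Prod.snd)).map Prod.fst)) ((codesFrom 240 80).map Prod.snd) = true := by
  decide +kernel

lemma cellMask_inj_of_rank_zero {i k : Fin 320} (hi : rank i = 0) (hk : rank k = 0)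
    (h : cellMask i = cellMask k) : i = k := by
  rw [cellMask, cellMask, cellEdges_of_rank_zero hi, cellEdges_of_rank_zero hk] at h
  have h' : edgeMask i ||| 0 = edgeMask k ||| 0 := h
  rw [Nat.or_zero, Nat.or_zero] at h'
  exact Fin.ext (edgeMask_inj (rank_zero_iff.1 hi) (rank_zero_iff.1 hk) h')

lemma rank_eq_of_cellMask_eq {i k : Fin 320} (h : cellMask i = cellMask k) : rank i = rank k := by
  have h1 := dim_cellAt i
  have h2 := dim_cellAt k
  simp only [cellAt, h] at h1 h2
  omega

lemma eq_of_map_nodup {α β : Type*} {f : α → β} {L : List α} (h : (L.map f).Nodup) {a b : α}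
    (ha : a ∈ L) (hb : b ∈ L) (hab : f a = f b) : a = b :=
  List.inj_on_of_nodup_map h ha hb hab

lemma cellCode_injective {i k : Fin 320} (h : cellCode (cellEdges i) = cellCode (cellEdges k)) :
    i = k := by
  refine cellAt_injective (le_antisymm ?_ ?_)
  · rw [← codeLE_iff, h, codeLE_iff]
  · rw [← codeLE_iff, h, codeLE_iff]

/-- In the star of a cell, the cells are determined by their faces. -/
lemma eq_of_cellMask_eq {i k r : Fin 320} (hi : cellAt i ≤ cellAt r ∨ cellAt r ≤ cellAt i)
    (hk : cellAt k ≤ cellAt r ∨ cellAt r ≤ cellAt k) (h : cellMask i = cellMask k) : i = k := by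
  have hr := rank_eq_of_cellMask_eq h
  by_cases hir : i = r
  · subst hir
    by_contra hne
    rcases hk with hk | hk
    · exact (rank_lt_of_le hk (Ne.symm hne)).ne hr.symm
    · exact (rank_lt_of_le hk hne).ne hr
  by_cases hkr : k = r
  · subst hkr
    by_contra hne
    rcases hi with hi | hi
    · exact (rank_lt_of_le hi hne).ne hr
    · exact (rank_lt_of_le hi (Ne.symm hne)).ne hr.symm
  rcases hi with hi | hi
  · have h1 := rank_lt_of_le hi hir
    rcases hk with hk | hk
    · have h2 := rank_lt r
      rcases (by omega : rank i = 0 ∨ rank i = 1) with h0 | h0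
      · exact cellMask_inj_of_rank_zero h0 (hr ▸ h0) h
      · have hr2 : rank r = 2 := by omega
        have hnd := nodup_of_nodupL (allL_iff.1 lowerFace_nodup _
          (List.mem_map.2 ⟨_, code_mem_two hr2, rfl⟩))
        refine cellCode_injective (eq_of_map_nodup hnd (mem_filterL.2
          ⟨List.mem_map.2 ⟨_, code_mem_one h0, rfl⟩, codeLE_iff.2 hi⟩) (mem_filterL.2
          ⟨List.mem_map.2 ⟨_, code_mem_one (hr ▸ h0), rfl⟩, codeLE_iff.2 hk⟩) ?_)
        exact h
    · have h2 := rank_lt_of_le hk (Ne.symm hkr)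
      omega
  · have h1 := rank_lt_of_le hi (Ne.symm hir)
    rcases hk with hk | hk
    · have h2 := rank_lt_of_le hk hkr
      omega
    · obtain ⟨t, ht⟩ := cellEdges_ne_nil r
      have hti := cellAt_cls_subset_iff.1 hi.2 t ht
      have htk := cellAt_cls_subset_iff.1 hk.2 t ht
      refine cellAt_injective (le_antisymm ((cellAt_le_iff hti htk).2 ?_)
        ((cellAt_le_iff htk hti).2 ?_))
      · rw [h, Nat.and_self]
      · rw [h, Nat.and_self]

lemma canonicalMap_eq (w : OrderRealization surface) :
    canonicalMap surface w = ∑ i, w.1 (cellEquiv i) • cellCenter i := by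
  rw [canonicalMap, ← finsum_comp_equiv cellEquiv, finsum_eq_sum_of_fintype]
  rfl

lemma sum_weight (w : OrderRealization surface) : ∑ i, w.1 (cellEquiv i) = 1 := by
  rw [← finsum_eq_sum_of_fintype, finsum_comp_equiv cellEquiv (f := w.1)]
  exact w.2.2.2

lemma le_total_of_weight_ne_zero (w : OrderRealization surface) {i k : Fin 320}
    (hi : w.1 (cellEquiv i) ≠ 0) (hk : w.1 (cellEquiv k) ≠ 0) :
    cellAt i ≤ cellAt k ∨ cellAt k ≤ cellAt i :=
  w.2.2.1.total (x := cellEquiv i) (y := cellEquiv k) hi hk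

lemma facet_canonicalMap (w : OrderRealization surface) (j : Fin 62) :
    facetLin j (canonicalMap surface w) + facetConst j =
      ∑ i, w.1 (cellEquiv i) * centerValue i j := by
  simp only [canonicalMap_eq, map_sum, map_smul, smul_eq_mul, centerValue, mul_add,
    Finset.sum_add_distrib, ← Finset.sum_mul, sum_weight, one_mul]

lemma mem_polytope_of_nonneg {x : EuclideanSpace ℝ (Fin 4)}
    (hx : ∀ j, 0 ≤ facetLin j x + facetConst j) : x ∈ polytope := by
  rw [polytope, hull, Set.image_univ]
  exact hvRep_vertexPoint.complete x hx

lemma canonicalMap_mem_frontier (w : OrderRealization surface) :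
    canonicalMap surface w ∈ frontier polytope := by
  have hmem : canonicalMap surface w ∈ polytope := by
    refine mem_polytope_of_nonneg fun j => ?_
    rw [facet_canonicalMap]
    exact Finset.sum_nonneg fun i _ => mul_nonneg (w.2.1 _) (centerValue_spec i j).1
  refine ⟨subset_closure hmem, fun hint => ?_⟩
  -- all cells in the support lie in the facet of a `2`-cell
  obtain ⟨e, q, f, hfl, hsupp⟩ := exists_flag (T := {i | w.1 (cellEquiv i) ≠ 0})
    fun i hi k hk => le_total_of_weight_ne_zero w hi hk
  obtain ⟨j, hj⟩ := exists_active f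
  have hz : facetLin j (canonicalMap surface w) + facetConst j = 0 := by
    rw [facet_canonicalMap]
    refine Finset.sum_eq_zero fun i _ => ?_
    by_cases hi : w.1 (cellEquiv i) = 0
    · rw [hi, zero_mul]
    · have hle : cellAt i ≤ cellAt f := by
        rcases hsupp i hi with rfl | rfl | rfl
        · exact hfl.le.trans hfl.le'
        · exact hfl.le'
        · exact le_rfl
      have : centerValue i j = 0 := active_anti_of_le hle hj
      rw [this, mul_zero]
  -- a facet functional that has a local minimum is constant, and so it vanishes on all vertices
  have hlin : facetLin j = 0 := by
    refine IsLocalMin.hasFDerivAt_eq_zero (f := facetLin j) (a := canonicalMap surface w) ?_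
      (facetLin j).hasFDerivAt
    filter_upwards [mem_interior_iff_mem_nhds.1 hint] with y hy
    have := hvRep_vertexPoint.nonneg_of_mem hy j
    linarith
  have hconst : facetConst j = 0 := by simpa [hlin] using hz
  obtain ⟨k, hk⟩ : (maskSet 72 (facetMask.getD j 0))ᶜ.Nonempty := by
    rw [Set.nonempty_compl]
    exact maskSet_ne_univ (k := 3) (by norm_num) (mem_facetMask.2 ⟨j, rfl⟩)
  refine hk ((facet_eq_zero_iff j k).1 ?_)
  rw [hlin, hconst]
  simp

lemma continuous_canonicalMap : Continuous (canonicalMap surface) := by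
  have : canonicalMap surface = fun w : OrderRealization surface =>
      ∑ i, w.1 (cellEquiv i) • cellCenter i := funext canonicalMap_eq
  rw [this]
  exact continuous_finsetSum _ fun i _ =>
    ((continuous_apply (cellEquiv i)).comp continuous_subtype_val).smul continuous_const

/-- The canonical map is injective on the open star of a cell. -/
lemma canonicalMap_injOn_star {w w' : OrderRealization surface} {r : Fin 320}
    (hr : w.1 (cellEquiv r) ≠ 0) (hr' : w'.1 (cellEquiv r) ≠ 0)
    (h : canonicalMap surface w = canonicalMap surface w') : w = w' := by
  have hch : ∀ (v : OrderRealization surface) (i k : Fin 320), v.1 (cellEquiv i) ≠ 0 →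
      v.1 (cellEquiv k) ≠ 0 → {j | centerValue i j = 0} ⊆ {j | centerValue k j = 0} ∨
        {j | centerValue k j = 0} ⊆ {j | centerValue i j = 0} := fun v i k hi hk =>
    (le_total_of_weight_ne_zero v hi hk).symm.imp active_anti_of_le active_anti_of_le
  have key := eq_of_sum_eq (fun i j => (centerValue_spec i j).1) exists_not_active
    (w := fun i => w.1 (cellEquiv i)) (w' := fun i => w'.1 (cellEquiv i))
    (fun i => w.2.1 _) (fun i => w'.2.1 _) (hch w) (hch w')
    (fun i k hi hk hik => eq_of_cellMask_eq (le_total_of_weight_ne_zero w hi hr)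
      (le_total_of_weight_ne_zero w' hk hr') (cellMask_eq_of_centerValue hik))
    (fun j => by rw [← facet_canonicalMap, ← facet_canonicalMap, h])
  refine Subtype.ext (funext fun c => ?_)
  have := congrFun key (cellEquiv.symm c)
  simpa using this

lemma isTopImmersion_canonicalMap : IsTopImmersion (canonicalMap surface) := by
  intro w
  obtain ⟨e⟩ := orderRealization_surface_homeomorph
  have hcomp : CompactSpace (OrderRealization surface) := e.symm.compactSpace
  obtain ⟨r, hr⟩ : ∃ r, w.1 (cellEquiv r) ≠ 0 := by
    by_contra! hcon
    have := sum_weight w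
    simp [hcon] at this
  have hpos : 0 < w.1 (cellEquiv r) := lt_of_le_of_ne (w.2.1 _) (Ne.symm hr)
  have hcont : Continuous fun v : OrderRealization surface => v.1 (cellEquiv r) :=
    (continuous_apply _).comp continuous_subtype_val
  refine ⟨{v | w.1 (cellEquiv r) / 2 ≤ v.1 (cellEquiv r)}, ?_, ?_⟩
  · filter_upwards [(isOpen_lt continuous_const hcont).mem_nhds
      (show w.1 (cellEquiv r) / 2 < w.1 (cellEquiv r) by linarith)] with v hv
    exact le_of_lt hv
  · have hclosed : IsClosed {v : OrderRealization surface |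
        w.1 (cellEquiv r) / 2 ≤ v.1 (cellEquiv r)} := isClosed_le continuous_const hcont
    have := isCompact_iff_compactSpace.1 hclosed.isCompact
    refine (Continuous.isClosedEmbedding (continuous_canonicalMap.comp continuous_subtype_val)
      fun v v' hvv => Subtype.ext ?_).isEmbedding
    have h1 := v.2
    have h2 := v'.2
    simp only [Set.mem_ofPred_eq] at h1 h2
    exact canonicalMap_injOn_star (r := r) (by linarith) (by linarith) hvv

/-! ### Edge orientations -/

/-- A closed path of opposite edges along which the direction is reversed: the starting points of
consecutive directed edges are joined by edges, and the last edge is the reverse of the first. -/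
def moebiusPath : Fin 10 → Fin 72 × Fin 72 :=
  ![(0, 6), (2, 4), (26, 24), (28, 34), (30, 32), (2, 0), (16, 14), (18, 12), (8, 10), (6, 0)]

/-- The vertex mask of a directed edge. -/
def pairMask (p : Fin 72 × Fin 72) : ℕ := Nat.lor (bitMask p.1) (bitMask p.2)

/-- The directed edges `p` and `q` are opposite in a `2`-face, of which neither the segment from the
start of `p` to the end of `q` nor that from the end of `p` to the start of `q` is an edge. -/
def isTransport (p q : Fin 72 × Fin 72) : Bool :=
  memL (pairMask p) (faceMasks 1) && memL (pairMask q) (faceMasks 1) &&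
    Nat.beq (Nat.land (pairMask p) (pairMask q)) 0 &&
    memL (Nat.lor (pairMask p) (pairMask q)) (faceMasks 2) &&
    allL (fun m => !(hasBit m p.1 && hasBit m q.2) && !(hasBit m p.2 && hasBit m q.1))
      (faceMasks 1)

lemma moebiusPath_transport : ∀ i : Fin 9,
    isTransport (moebiusPath i.castSucc) (moebiusPath i.succ) = true := by
  decide +kernel

lemma testBit_pairMask {p : Fin 72 × Fin 72} {i : ℕ} :
    (pairMask p).testBit i = true ↔ (p.1 : ℕ) = i ∨ (p.2 : ℕ) = i := by
  change (bitMask p.1 ||| bitMask p.2).testBit i = true ↔ _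
  simp only [Nat.testBit_lor, testBit_bitMask, Bool.or_eq_true, decide_eq_true_eq]

lemma maskSet_pairMask (p : Fin 72 × Fin 72) : maskSet 72 (pairMask p) = {p.1, p.2} := by
  ext i
  refine testBit_pairMask.trans ?_
  simp only [Set.mem_insert_iff, Set.mem_singleton_iff, Fin.ext_iff, eq_comm (a := (i : ℕ))]

lemma vertexPoint_injective : Function.Injective vertexPoint :=
  hvRep_vertexPoint.vertex_injective isClosedIdx_singleton

/-- If an edge is written as a segment, then the endpoints are the vertices of the edge. -/
lemma eq_or_eq_of_faceOf_eq_segment {p : Fin 72 × Fin 72} {x y : EuclideanSpace ℝ (Fin 4)}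
    (hp : p.1 ≠ p.2) (h : faceOf (pairMask p) = segment ℝ x y) :
    (x = vertexPoint p.1 ∧ y = vertexPoint p.2) ∨ (x = vertexPoint p.2 ∧ y = vertexPoint p.1) := by
  have h1 : vertexPoint '' {p.1, p.2} ⊆ {x, y} := by
    rw [← maskSet_pairMask, ← hvRep_vertexPoint.extremePoints_hull isClosedIdx_singleton]
    change (faceOf (pairMask p)).extremePoints ℝ ⊆ _
    rw [h, ← convexHull_pair]
    exact extremePoints_convexHull_subset
  have ha : vertexPoint p.1 = x ∨ vertexPoint p.1 = y := h1 ⟨p.1, by simp, rfl⟩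
  have hb : vertexPoint p.2 = x ∨ vertexPoint p.2 = y := h1 ⟨p.2, by simp, rfl⟩
  have hne : vertexPoint p.1 ≠ vertexPoint p.2 := fun h => hp (vertexPoint_injective h)
  rcases ha with ha | ha <;> rcases hb with hb | hb
  · exact absurd (ha.trans hb.symm) hne
  · exact Or.inl ⟨ha.symm, hb.symm⟩
  · exact Or.inr ⟨hb.symm, ha.symm⟩
  · exact absurd (ha.trans hb.symm) hne

lemma not_isFace_segment {a b : Fin 72}
    (h : ∀ m ∈ faceMasks 1, ¬ (m.testBit a = true ∧ m.testBit b = true)) :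
    ¬ IsFace polytope 1 (segment ℝ (vertexPoint a) (vertexPoint b)) := by
  intro hF
  obtain ⟨m, hm, hseg⟩ := (isFace_iff (by norm_num)).1 hF
  have hc := isClosedIdx_faceMasks (by norm_num) hm
  refine h m hm ⟨(hvRep_vertexPoint.vertex_mem_iff hc).1 ?_,
    (hvRep_vertexPoint.vertex_mem_iff hc).1 ?_⟩
  · change _ ∈ faceOf m
    rw [← hseg]; exact left_mem_segment ℝ _ _
  · change _ ∈ faceOf m
    rw [← hseg]; exact right_mem_segment ℝ _ _

/-- An edge orientation is transported to opposite edges. -/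
lemma tail_transport {p q : Fin 72 × Fin 72} (hp : p.1 ≠ p.2) (hq : q.1 ≠ q.2)
    (h : isTransport p q = true)
    {tail head : Set (EuclideanSpace ℝ (Fin 4)) → EuclideanSpace ℝ (Fin 4)}
    (hseg : ∀ e, IsFace polytope 1 e → e = segment ℝ (tail e) (head e))
    (hopp : ∀ e e', OppositeEdges polytope polytope e e' →
      IsFace polytope 1 (segment ℝ (tail e) (tail e'))) :
    tail (faceOf (pairMask p)) = vertexPoint p.1 ↔
      tail (faceOf (pairMask q)) = vertexPoint q.1 := by
  simp only [isTransport, Bool.and_eq_true, memL_iff, Nat.beq_eq, allL_iff, Bool.not_eq_true',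
    hasBit_eq] at h
  obtain ⟨⟨⟨⟨hpe, hqe⟩, hdis⟩, hquad⟩, hdiag⟩ := h
  have hfp := isFace_faceOf (by norm_num) hpe
  have hfq := isFace_faceOf (by norm_num) hqe
  have hop : OppositeEdges polytope polytope (faceOf (pairMask p)) (faceOf (pairMask q)) := by
    refine ⟨_, isFace_faceOf (by norm_num) hquad, hull_mono (Set.subset_univ _), hfp, hfq,
      hull_mono fun i hi => ?_, hull_mono fun i hi => ?_, ?_⟩
    · change (pairMask p ||| pairMask q).testBit i = true
      rw [Nat.testBit_lor, Bool.or_eq_true]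
      exact Or.inl hi
    · change (pairMask p ||| pairMask q).testBit i = true
      rw [Nat.testBit_lor, Bool.or_eq_true]
      exact Or.inr hi
    · refine (disjoint_faceOf_iff (k' := 1) (by norm_num) hqe).2 fun i _ h1 h2 => ?_
      have h3 : (pairMask p &&& pairMask q).testBit i = true := by
        rw [Nat.testBit_land, h1, h2]; rfl
      rw [show pairMask p &&& pairMask q = 0 from hdis] at h3
      simp at h3
  have hface := hopp _ _ hop
  have hd1 : ¬ IsFace polytope 1 (segment ℝ (vertexPoint p.1) (vertexPoint q.2)) :=
    not_isFace_segment fun m hm hb => by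
      have := (hdiag m hm).1
      rw [hb.1, hb.2] at this
      exact Bool.noConfusion this
  have hd2 : ¬ IsFace polytope 1 (segment ℝ (vertexPoint p.2) (vertexPoint q.1)) :=
    not_isFace_segment fun m hm hb => by
      have := (hdiag m hm).2
      rw [hb.1, hb.2] at this
      exact Bool.noConfusion this
  have hnp : vertexPoint p.1 ≠ vertexPoint p.2 := fun h => hp (vertexPoint_injective h)
  have hnq : vertexPoint q.1 ≠ vertexPoint q.2 := fun h => hq (vertexPoint_injective h)
  rcases eq_or_eq_of_faceOf_eq_segment hp (hseg _ hfp) with ⟨h1, -⟩ | ⟨h1, -⟩ <;>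
    rcases eq_or_eq_of_faceOf_eq_segment hq (hseg _ hfq) with ⟨h2, -⟩ | ⟨h2, -⟩ <;>
    rw [h1, h2] at hface <;> rw [h1, h2]
  · simp
  · exact absurd hface hd1
  · exact absurd hface hd2
  · exact ⟨fun h => absurd h.symm hnp, fun h => absurd h.symm hnq⟩

lemma moebiusPath_ne : ∀ i, (moebiusPath i).1 ≠ (moebiusPath i).2 := by
  decide +kernel

lemma moebiusPath_reversed :
    moebiusPath (Fin.last _) = ((moebiusPath 0).2, (moebiusPath 0).1) := by
  decide +kernel

/-- The transport along the closed path would reverse the direction of an edge. -/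
lemma not_edgeOrientable_polytope : ¬ EdgeOrientable polytope := by
  rintro ⟨tail, head, hseg, hopp⟩
  have step : ∀ i, tail (faceOf (pairMask (moebiusPath 0))) = vertexPoint (moebiusPath 0).1 ↔
      tail (faceOf (pairMask (moebiusPath i))) = vertexPoint (moebiusPath i).1 := by
    intro i
    induction i using Fin.induction with
    | zero => rfl
    | succ i ih =>
      exact ih.trans (tail_transport (moebiusPath_ne _) (moebiusPath_ne _)
        (moebiusPath_transport i) hseg fun e e' h => (hopp e e' h).1)
  have h := step (Fin.last _)
  have hmask : pairMask (moebiusPath (Fin.last _)) = pairMask (moebiusPath 0) := by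
    rw [moebiusPath_reversed]
    exact Nat.lor_comm _ _
  rw [hmask, moebiusPath_reversed] at h
  have hne : vertexPoint (moebiusPath 0).1 ≠ vertexPoint (moebiusPath 0).2 :=
    fun h => moebiusPath_ne 0 (vertexPoint_injective h)
  have hface : IsFace polytope 1 (faceOf (pairMask (moebiusPath 0))) := by
    have h0 := moebiusPath_transport 0
    simp only [isTransport, Bool.and_eq_true, memL_iff] at h0
    exact isFace_faceOf (by norm_num) h0.1.1.1.1
  rcases eq_or_eq_of_faceOf_eq_segment (moebiusPath_ne 0) (hseg _ hface) with ⟨h1, -⟩ | ⟨h1, -⟩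
  · exact hne (h1.symm.trans (h.1 h1))
  · exact hne ((h.2 h1).symm.trans h1)

end CubicalPolytope

end

theorem mainTheorem2 :
    ∃ P : Set (EuclideanSpace ℝ (Fin 4)),
      CubicalPolytope.IsCubicalPolytope 4 P ∧
      (CubicalPolytope.fNumber P 0 = 72 ∧ CubicalPolytope.fNumber P 1 = 196 ∧
        CubicalPolytope.fNumber P 2 = 186 ∧ CubicalPolytope.fNumber P 3 = 62) ∧
      (∃ M : Set (CubicalPolytope.DerivCell P),
        CubicalPolytope.IsDualManifold P M ∧
        (CubicalPolytope.cellNumber M 0 = 80 ∧ CubicalPolytope.cellNumber M 1 = 160 ∧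
          CubicalPolytope.cellNumber M 2 = 80) ∧
        Nonempty (CubicalPolytope.OrderRealization M ≃ₜ CubicalPolytope.KleinBottle) ∧
        (∀ w, CubicalPolytope.canonicalMap M w ∈ frontier P) ∧
        CubicalPolytope.IsTopImmersion (CubicalPolytope.canonicalMap M)) ∧
      ¬ CubicalPolytope.EdgeOrientable P := by
  obtain ⟨h0, h1, h2, h3⟩ := CubicalPolytope.length_faceMasks
  have hf := fun k (hk : k < 4) => CubicalPolytope.fNumber_polytope hk
  exact ⟨CubicalPolytope.polytope, CubicalPolytope.isCubicalPolytope_polytope,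
    ⟨(hf 0 (by norm_num)).trans h0, (hf 1 (by norm_num)).trans h1,
      (hf 2 (by norm_num)).trans h2, (hf 3 (by norm_num)).trans h3⟩,
    ⟨CubicalPolytope.surface, CubicalPolytope.isDualManifold_surface,
      CubicalPolytope.cellNumber_surface_eq, CubicalPolytope.orderRealization_surface_homeomorph,
      CubicalPolytope.canonicalMap_mem_frontier, CubicalPolytope.isTopImmersion_canonicalMap⟩,
    CubicalPolytope.not_edgeOrientable_polytope⟩
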